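/- For every $\theta>0$ there exists a constant $C(\theta)>0$, depending only on $\theta$, with the following property. Let $p,n$ be positive integers such that $y:=p/n$ satisfies $\theta<y\le 1$, and let $X_{ij}$, $1\le i\le p$, $1\le j\le n$, be independent (not necessarily identically distributed) real random variables with $$\mathbf{E}X_{ij}=0,\qquad \mathbf{E}|X_{ij}|^2=1,\qquad M_4:=\sup_{1\le i\le p,\,1\le j\le n}\mathbf{E}|X_{ij}|^4<\infty .$$ Let $\lambda_1\le\dots\le\lambda_p$ be the eigenvalues, counted with multiplicity, of $\mathbf{W}=\frac1n\mathbf{X}\mathbf{X}^T$, where $\mathbf X=(X_{ij})$ is the $p\times n$ matrix with these entries, let $F_p(x)=\frac1p\#\{k:\lambda_k\le x\}$ be the empirical spectral distribution function, and let $F_y$ be the Marchenko–Pastur distribution function, which for $0<y\le1$ has density $$f_y(x)=\frac{1}{2\pi xy}\sqrt{(b-x)(x-a)}\;I_{[a,b]}(x),\qquad a=(1-\sqrt y)^2,\quad b=(1+\sqrt y)^2 .$$ Then $$\Delta_p:=\sup_{x\in\mathbb{R}}\bigl|\mathbf{E}F_p(x)-F_y(x)\bigr|\le C(\theta)\,M_4^{1/2}\,n^{-1/2}.$$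 In particular the bound is uniform in $y\in(\theta,1]$, including $y=1$. -/

import Mathlib

open MeasureTheory ProbabilityTheory
open scoped ENNReal

noncomputable section

namespace SampleCov

/-- The sample covariance matrix `W = (1/n) X Xᵀ` of a real `p × n` matrix `X`. -/
def sampleCov {p n : ℕ} (X : Matrix (Fin p) (Fin n) ℝ) : Matrix (Fin p) (Fin p) ℝ :=
  (1 / (n : ℝ)) • (X * X.transpose)

theorem sampleCov_isHermitian {p n : ℕ} (X : Matrix (Fin p) (Fin n) ℝ) :
    (sampleCov X).IsHermitian := by
  unfold sampleCov Matrix.IsHermitian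
  rw [Matrix.conjTranspose_eq_transpose_of_trivial, Matrix.transpose_smul,
    Matrix.transpose_mul, Matrix.transpose_transpose]

/-- The empirical spectral distribution function `F_p(x) = (1/p) #{k : λ_k ≤ x}`, where
`λ_1, …, λ_p` are the eigenvalues of `W`, counted with multiplicity. -/
def empiricalSpectralCDF {p n : ℕ} (X : Matrix (Fin p) (Fin n) ℝ) (x : ℝ) : ℝ :=
  (1 / (p : ℝ)) * ∑ k : Fin p, if (sampleCov_isHermitian X).eigenvalues k ≤ x then 1 else 0

/-- The expected spectral distribution function `E F_p(x)` of a random matrix. -/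
def expectedSpectralCDF {Ω : Type*} [MeasurableSpace Ω] (P : Measure Ω) {p n : ℕ}
    (X : Fin p → Fin n → Ω → ℝ) (x : ℝ) : ℝ :=
  ∫ ω, empiricalSpectralCDF (Matrix.of fun i j => X i j ω) x ∂P

/-- The density of the absolutely continuous part of the Marchenko–Pastur law with ratio `y`:
`√((b - x)(x - a)) / (2 π x y)` on `[a, b]`, where `a = (1 - √y)²` and `b = (1 + √y)²`. -/
def mpDensity (y x : ℝ) : ℝ :=
  (Set.Icc ((1 - √y) ^ 2) ((1 + √y) ^ 2)).indicator
    (fun t => √(((1 + √y) ^ 2 - t) * (t - (1 - √y) ^ 2)) / (2 * t * y * Real.pi)) x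

/-- The Marchenko–Pastur law with ratio `y`, including its atom at `0` when `y > 1`. -/
def mpLaw (y : ℝ) : Measure ℝ :=
  volume.withDensity (fun x => ENNReal.ofReal (mpDensity y x)) +
    (if 1 ≤ y then ENNReal.ofReal (1 - y⁻¹) else 0) • Measure.dirac 0

/-- The Marchenko–Pastur distribution function `F_y`. -/
def mpCDF (y x : ℝ) : ℝ := (mpLaw y).real (Set.Iic x)

/-- The Kolmogorov distance `sup_x |F(x) - G(x)|`, as an extended nonnegative real. -/
def kolmogorovDist (F G : ℝ → ℝ) : ℝ≥0∞ := ⨆ x : ℝ, ENNReal.ofReal |F x - G x|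

/-- The maximal fourth moment `M_4 = sup_{i,j} E |X_ij|⁴`. -/
def maxFourthMoment {Ω : Type*} [MeasurableSpace Ω] (P : Measure Ω) {p n : ℕ}
    (X : Fin p → Fin n → Ω → ℝ) : ℝ :=
  ⨆ ij : Fin p × Fin n, ∫ ω, |X ij.1 ij.2 ω| ^ 4 ∂P

end SampleCov

end

/-! Everything is done for the law of `±√λ` instead of `λ`. At `w` in the upper half plane, `v = Im
w`, its Stieltjes transform is `p⁻¹ tr (w (W - w²)⁻¹)`. Symmetrizing removes the `x^(-1/2)`
singularity of the Marchenko–Pastur density at the hard edge `y = 1`: the limiting distribution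
function becomes Lipschitz with constant `1/y`, uniformly up to `y = 1`. It also turns the
self-consistent equation into that of a semicircle law.

Put `γ = n⁻¹ tr (w (W - w²)⁻¹)` and `β = (1 - y)/w`. Removing one column at a time yields the exact
identity `γ - β = -n⁻¹ ∑ 1/r_j` with `r_j = w + n⁻¹ x_jᵀ B_j x_j` (`meanResolvent_sub_eq`), while
the limit `g` satisfies `(g - β)(w + g) = -1` (`mp_selfConsistent`). Subtracting, `(γ - g)(w + g + γ
- β) = n⁻¹ ∑ (r_j - w - γ)/r_j`. All imaginary parts in the factor on the left have the same sign,
so its modulus is at least `den = Im w + Im g + Im γ - Im β`, with no a priori control of `γ`.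

Given the other columns, the variance of `n⁻¹ x_jᵀ B_j x_j` is at most `2M n⁻² ∑ |B_j(k,l)|²`, and
the Ward-type inequality `v ∑ |B(k,l)|² ≤ Im tr B` turns this into `2M/(nv)` times an imaginary part
that `den` absorbs (`lintegral_formFluct_le`). So the self-normalized error has mean `O(M/(nv))`.
Near the bulk the deterministic part of `den` is at least a constant times `√v`, edges included
(`selfConsistent_bounds`). With `v₀ = √(M/n)` and `v ≥ v₀`, this gives `E|γ - g| ≲ v₀ v^(-3/4) + v₀²
v⁻²`, and also `E|γ - g| ≲ v₀ v⁻²`, the one used for `v ≥ 1`.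

Finally both distribution functions are smoothed by a Cauchy kernel of width `v₀`. The derivative in
`v` of the smoothed difference is `π⁻¹` times the real part of the difference of Stieltjes
transforms, so it suffices to integrate down one vertical line, from infinity to `v₀`; each bound
integrates to `O(v₀)`. Undoing the smoothing costs the Lipschitz constant times `v₀`
(`abs_real_Iic_sub_le_of_smoothDiff`). -/

namespace SampleCov

/-! ### Deterministic resolvent inequalities and rank-one perturbation -/

section Resolvent

open Matrix
open scoped ComplexOrder

variable {ι : Type*} [Fintype ι]

theorem star_dotProduct_self_eq (u : ι → ℂ) : star u ⬝ᵥ u = ((∑ i, ‖u i‖ ^ 2 : ℝ) : ℂ) := by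
  simp only [dotProduct, Pi.star_apply, RCLike.star_def, Complex.conj_mul']
  push_cast
  rfl

/-- The rank-one matrix `c x xᵀ` with a real vector `x`. -/
noncomputable def rankOne (c : ℝ) (x : ι → ℝ) : Matrix ι ι ℂ :=
  (c : ℂ) • Matrix.vecMulVec (fun i => (x i : ℂ)) (fun i => (x i : ℂ))

theorem rankOne_mulVec (c : ℝ) (x : ι → ℝ) (u : ι → ℂ) :
    rankOne c x *ᵥ u = ((c : ℂ) * ((fun i => (x i : ℂ)) ⬝ᵥ u)) • fun i => (x i : ℂ) := by
  rw [rankOne, Matrix.smul_mulVec, Matrix.vecMulVec_mulVec, op_smul_eq_smul, smul_smul]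

variable [DecidableEq ι]

/-- The symmetrized resolvent `w (A - w²)⁻¹`. -/
noncomputable def symResolvent (A : Matrix ι ι ℂ) (w : ℂ) : Matrix ι ι ℂ :=
  w • (A - w ^ 2 • (1 : Matrix ι ι ℂ))⁻¹

/-- Since `x = w⁻¹ A u - w u`, the pairing of `x` with `u` equals `w̄⁻¹ ⟨u, A u⟩ - w̄ |u|²`. For
positive semidefinite `A` and `Im w > 0` both terms have nonnegative imaginary part, and the second
alone contributes `Im w |u|²`. This one-sided Ward identity is the source of all later positivity.
-/
theorem im_mul_sum_norm_sq_le {A : Matrix ι ι ℂ} (hA : A.PosSemidef) {w : ℂ} (hw : 0 < w.im)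
    {u x : ι → ℂ} (h : (A - w ^ 2 • (1 : Matrix ι ι ℂ)) *ᵥ u = w • x) :
    w.im * ∑ i, ‖u i‖ ^ 2 ≤ (star x ⬝ᵥ u).im := by
  have hw0 : w ≠ 0 := by rintro rfl; simp at hw
  obtain ⟨hherm, hnn⟩ := Matrix.posSemidef_iff_dotProduct_mulVec.1 hA
  obtain ⟨r, hr, hru⟩ : ∃ r : ℝ, 0 ≤ r ∧ star u ⬝ᵥ (A *ᵥ u) = r := by
    obtain ⟨h1, h2⟩ := Complex.le_def.1 (hnn u)
    exact ⟨_, by simpa using h1, Complex.ext rfl (by simpa using h2.symm)⟩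
  have hx : x = w⁻¹ • (A *ᵥ u) - w • u := by
    have : w • x = A *ᵥ u - w ^ 2 • u := by
      rw [← h, Matrix.sub_mulVec, Matrix.smul_mulVec, Matrix.one_mulVec]
    calc x = w⁻¹ • (w • x) := by rw [smul_smul, inv_mul_cancel₀ hw0, one_smul]
      _ = _ := by
        rw [this, smul_sub, smul_smul]
        congr 2
        field_simp
  have hAu : star (A *ᵥ u) ⬝ᵥ u = r := by
    rw [Matrix.star_mulVec, ← Matrix.dotProduct_mulVec, hherm.eq, hru]
  have key : star x ⬝ᵥ u = (star w)⁻¹ * r - star w * ((∑ i, ‖u i‖ ^ 2 : ℝ) : ℂ) := by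
    rw [hx, star_sub, star_smul, star_smul, sub_dotProduct, smul_dotProduct, smul_dotProduct,
      hAu, star_dotProduct_self_eq, star_inv₀]
    simp
  rw [key]
  have h1 : ((star w)⁻¹ * (r : ℂ)).im = w.im / Complex.normSq w * r := by
    simp [Complex.mul_im, Complex.inv_im, Complex.inv_re]
  have h2 : (star w * ((∑ i, ‖u i‖ ^ 2 : ℝ) : ℂ)).im = - (w.im * ∑ i, ‖u i‖ ^ 2) := by
    rw [Complex.im_mul_ofReal]
    simp
  rw [Complex.sub_im, h1, h2]
  have : 0 ≤ w.im / Complex.normSq w * r :=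
    mul_nonneg (div_nonneg hw.le (Complex.normSq_nonneg _)) hr
  linarith

/-- A kernel vector would satisfy the preceding inequality with `x = 0`, hence vanish. -/
theorem isUnit_det_sub_sq {A : Matrix ι ι ℂ} (hA : A.PosSemidef) {w : ℂ} (hw : 0 < w.im) :
    IsUnit (A - w ^ 2 • (1 : Matrix ι ι ℂ)).det := by
  rw [isUnit_iff_ne_zero]
  intro h0
  obtain ⟨u, hu, h⟩ := Matrix.exists_mulVec_eq_zero_iff.2 h0
  have := im_mul_sum_norm_sq_le hA hw (u := u) (x := 0) (by simpa using h)
  simp only [star_zero, zero_dotProduct, Complex.zero_im] at this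
  apply hu
  have hs : ∑ i, ‖u i‖ ^ 2 ≤ 0 := by
    by_contra hc
    push Not at hc
    nlinarith [mul_pos hw hc]
  have hs' := (Finset.sum_eq_zero_iff_of_nonneg (fun i _ => by positivity)).1
    (le_antisymm hs (Finset.sum_nonneg fun i _ => by positivity))
  ext i
  simpa using hs' i (Finset.mem_univ i)

theorem sub_sq_mulVec_symResolvent {A : Matrix ι ι ℂ} (hA : A.PosSemidef) {w : ℂ}
    (hw : 0 < w.im) (x : ι → ℂ) :
    (A - w ^ 2 • (1 : Matrix ι ι ℂ)) *ᵥ (symResolvent A w *ᵥ x) = w • x := by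
  rw [Matrix.mulVec_mulVec, symResolvent, Matrix.mul_smul,
    Matrix.mul_nonsing_inv _ (isUnit_det_sub_sq hA hw), Matrix.smul_mulVec, Matrix.one_mulVec]

theorem symResolvent_mulVec_eq {A : Matrix ι ι ℂ} (hA : A.PosSemidef) {w : ℂ}
    (hw : 0 < w.im) {x u : ι → ℂ} (h : (A - w ^ 2 • (1 : Matrix ι ι ℂ)) *ᵥ u = w • x) :
    symResolvent A w *ᵥ x = u := by
  have := congrArg (fun y => (A - w ^ 2 • (1 : Matrix ι ι ℂ))⁻¹ *ᵥ y) h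
  simp only [Matrix.mulVec_mulVec, Matrix.nonsing_inv_mul _ (isUnit_det_sub_sq hA hw),
    Matrix.one_mulVec, Matrix.mulVec_smul] at this
  rw [symResolvent, Matrix.smul_mulVec, this]

theorem im_mul_sum_norm_sq_symResolvent_le {A : Matrix ι ι ℂ} (hA : A.PosSemidef) {w : ℂ}
    (hw : 0 < w.im) :
    w.im * ∑ k, ∑ l, ‖symResolvent A w k l‖ ^ 2 ≤ (symResolvent A w).trace.im := by
  have h (l : ι) : w.im * ∑ k, ‖symResolvent A w k l‖ ^ 2 ≤ (symResolvent A w l l).im := by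
    have := im_mul_sum_norm_sq_le hA hw (sub_sq_mulVec_symResolvent hA hw (Pi.single l 1))
    simpa [Matrix.mulVec_single_one, ← Pi.single_star] using this
  rw [Finset.sum_comm, Finset.mul_sum, Matrix.trace, Complex.im_sum]
  exact Finset.sum_le_sum fun l _ => h l

theorem trace_symResolvent_im_nonneg {A : Matrix ι ι ℂ} (hA : A.PosSemidef) {w : ℂ}
    (hw : 0 < w.im) : 0 ≤ (symResolvent A w).trace.im :=
  le_trans (by positivity) (im_mul_sum_norm_sq_symResolvent_le hA hw)

theorem symResolvent_isSymm {A : Matrix ι ι ℂ} (hA : A.IsSymm) (w : ℂ) :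
    (symResolvent A w).IsSymm := by
  unfold symResolvent Matrix.IsSymm
  rw [Matrix.transpose_smul, Matrix.transpose_nonsing_inv, Matrix.transpose_sub,
    Matrix.transpose_smul, Matrix.transpose_one, hA.eq]

/-- The quadratic form of the symmetrized resolvent at a real vector. -/
noncomputable def resolventForm (A : Matrix ι ι ℂ) (w : ℂ) (x : ι → ℝ) : ℂ :=
  (fun i => (x i : ℂ)) ⬝ᵥ (symResolvent A w *ᵥ fun i => (x i : ℂ))

theorem im_mul_sum_norm_sq_le_resolventForm {A : Matrix ι ι ℂ} (hA : A.PosSemidef) {w : ℂ}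
    (hw : 0 < w.im) (x : ι → ℝ) :
    w.im * ∑ i, ‖(symResolvent A w *ᵥ fun i => (x i : ℂ)) i‖ ^ 2 ≤ (resolventForm A w x).im := by
  have := im_mul_sum_norm_sq_le hA hw (sub_sq_mulVec_symResolvent hA hw fun i => (x i : ℂ))
  have hs : star (fun i => (x i : ℂ)) = fun i => (x i : ℂ) := by ext i; simp
  rwa [hs] at this

theorem resolventForm_im_nonneg {A : Matrix ι ι ℂ} (hA : A.PosSemidef) {w : ℂ}
    (hw : 0 < w.im) (x : ι → ℝ) : 0 ≤ (resolventForm A w x).im :=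
  le_trans (by positivity) (im_mul_sum_norm_sq_le_resolventForm hA hw x)

/-- Sherman–Morrison along the perturbing vector, obtained by checking that the candidate solves the
perturbed linear system. -/
theorem symResolvent_add_rankOne_mulVec {A : Matrix ι ι ℂ} (hA : A.PosSemidef) {w : ℂ}
    (hw : 0 < w.im) {c : ℝ} (x : ι → ℝ) (hA' : (A + rankOne c x).PosSemidef)
    (hr : w + c * resolventForm A w x ≠ 0) :
    symResolvent (A + rankOne c x) w *ᵥ (fun i => (x i : ℂ)) =
      (w / (w + c * resolventForm A w x)) • (symResolvent A w *ᵥ fun i => (x i : ℂ)) := by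
  have hw0 : w ≠ 0 := by rintro rfl; simp at hw
  apply symResolvent_mulVec_eq hA' hw
  rw [Matrix.mulVec_smul, add_sub_right_comm, Matrix.add_mulVec, rankOne_mulVec,
    sub_sq_mulVec_symResolvent hA hw, ← add_smul, smul_smul]
  congr 1
  change _ * (_ + c * resolventForm A w x) = _
  rw [div_mul_cancel₀ _ hr]

theorem resolventForm_add_rankOne {A : Matrix ι ι ℂ} (hA : A.PosSemidef) {w : ℂ}
    (hw : 0 < w.im) {c : ℝ} (x : ι → ℝ) (hA' : (A + rankOne c x).PosSemidef)
    (hr : w + c * resolventForm A w x ≠ 0) :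
    c * resolventForm (A + rankOne c x) w x = w * (1 - w / (w + c * resolventForm A w x)) := by
  rw [resolventForm, symResolvent_add_rankOne_mulVec hA hw x hA' hr, dotProduct_smul]
  change _ * (_ • resolventForm A w x) = _
  rw [smul_eq_mul]
  field_simp
  ring

theorem symResolvent_sub_symResolvent {A B : Matrix ι ι ℂ} (hA : A.PosSemidef)
    (hB : B.PosSemidef) {w : ℂ} (hw : 0 < w.im) :
    symResolvent A w - symResolvent B w =
      w⁻¹ • (symResolvent A w * (B - A) * symResolvent B w) := by
  have hw0 : w ≠ 0 := by rintro rfl; simp at hw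
  have hA1 := Matrix.nonsing_inv_mul _ (isUnit_det_sub_sq hA hw)
  have hB1 := Matrix.mul_nonsing_inv _ (isUnit_det_sub_sq hB hw)
  have : B - A = (B - w ^ 2 • (1 : Matrix ι ι ℂ)) - (A - w ^ 2 • (1 : Matrix ι ι ℂ)) := by abel
  rw [this]
  simp only [symResolvent, Matrix.smul_mul, Matrix.mul_smul]
  rw [Matrix.mul_sub, Matrix.sub_mul, Matrix.mul_assoc, hB1, hA1, Matrix.one_mul, Matrix.mul_one,
    smul_smul, smul_smul, inv_mul_cancel₀ hw0, one_mul, smul_sub]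

/-- With `u` the unperturbed resolvent applied to `x` and `r` the Sherman–Morrison denominator, the
trace changes by `-(c/r) uᵀu`. The Ward inequality gives `|r| ≥ Im r ≥ c v |u|²`, so the size of `x`
drops out. -/
theorem norm_trace_symResolvent_add_rankOne_sub_le {A : Matrix ι ι ℂ} (hA : A.PosSemidef)
    (hAs : A.IsSymm) {w : ℂ} (hw : 0 < w.im) {c : ℝ} (hc : 0 ≤ c) (x : ι → ℝ)
    (hA' : (A + rankOne c x).PosSemidef) :
    ‖(symResolvent (A + rankOne c x) w).trace - (symResolvent A w).trace‖ ≤ 1 / w.im := by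
  have hw0 : w ≠ 0 := by rintro rfl; simp at hw
  set r := w + c * resolventForm A w x with hrdef
  have him : w.im + c * (resolventForm A w x).im = r.im := by simp [hrdef]
  have hrim : 0 < r.im := by
    rw [← him]
    have := resolventForm_im_nonneg hA hw x
    positivity
  have hr : r ≠ 0 := by intro h; simp [h] at hrim
  set xc : ι → ℂ := fun i => (x i : ℂ) with hxc
  set u := symResolvent A w *ᵥ xc with hu
  have h1 : (symResolvent (A + rankOne c x) w).trace - (symResolvent A w).trace =
      - ((c : ℂ) / r * (u ⬝ᵥ u)) := by
    rw [← Matrix.trace_sub, symResolvent_sub_symResolvent hA' hA hw]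
    have : A - (A + rankOne c x) = - rankOne c x := by abel
    have hu' := symResolvent_add_rankOne_mulVec hA hw x hA' hr
    set R := symResolvent (A + rankOne c x) w
    rw [this, Matrix.mul_neg, Matrix.neg_mul, rankOne, Matrix.mul_smul, Matrix.smul_mul,
      Matrix.mul_vecMulVec, Matrix.vecMulVec_mul, Matrix.trace_smul, Matrix.trace_neg,
      Matrix.trace_smul, Matrix.trace_vecMulVec, hu', ← Matrix.mulVec_transpose,
      (symResolvent_isSymm hAs w).eq, smul_dotProduct]
    simp only [smul_eq_mul]
    rw [← hrdef, ← hxc, ← hu]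
    field_simp
  rw [h1, norm_neg, norm_mul, norm_div, Complex.norm_real, Real.norm_of_nonneg hc]
  have h2 : ‖u ⬝ᵥ u‖ ≤ ∑ i, ‖u i‖ ^ 2 := by
    refine (norm_sum_le _ _).trans (Finset.sum_le_sum fun i _ => ?_)
    rw [norm_mul, sq]
  have h3 : w.im * ∑ i, ‖u i‖ ^ 2 ≤ (resolventForm A w x).im :=
    im_mul_sum_norm_sq_le_resolventForm hA hw x
  have h4 : r.im ≤ ‖r‖ := (le_abs_self _).trans (Complex.abs_im_le_norm r)
  have h5 : c * (w.im * ∑ i, ‖u i‖ ^ 2) ≤ ‖r‖ := by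
    have := mul_le_mul_of_nonneg_left h3 hc
    linarith
  have hrn : 0 < ‖r‖ := norm_pos_iff.2 hr
  rw [div_mul_eq_mul_div, div_le_div_iff₀ hrn hw]
  have := mul_le_mul_of_nonneg_left h2 (mul_nonneg hc hw.le)
  nlinarith

end Resolvent

/-! ### The leave-one-out identity for sample covariance matrices -/

section SampleCovResolvent

open Matrix
open scoped ComplexOrder

variable {p n : ℕ}

/-- The sample covariance matrix as a complex matrix. -/
noncomputable def complexCov (X : Matrix (Fin p) (Fin n) ℝ) : Matrix (Fin p) (Fin p) ℂ :=
  (sampleCov X).map (↑)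

theorem complexCov_apply (X : Matrix (Fin p) (Fin n) ℝ) (k l : Fin p) :
    complexCov X k l = (1 / (n : ℂ)) * ∑ j, (X k j : ℂ) * X l j := by
  simp [complexCov, sampleCov, Matrix.mul_apply]

theorem complexCov_posSemidef (X : Matrix (Fin p) (Fin n) ℝ) : (complexCov X).PosSemidef := by
  have h : complexCov X = (1 / (n : ℂ)) • (X.map ((↑) : ℝ → ℂ) * (X.map ((↑) : ℝ → ℂ))ᴴ) := by
    ext k l
    simp [complexCov_apply, Matrix.mul_apply]
  rw [h]
  refine (Matrix.posSemidef_self_mul_conjTranspose _).smul ?_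
  rw [Complex.le_def]
  simp only [Complex.zero_re, Complex.zero_im, one_div]
  rw [← Complex.ofReal_natCast, ← Complex.ofReal_inv, Complex.ofReal_re, Complex.ofReal_im]
  exact ⟨by positivity, rfl⟩

theorem complexCov_isSymm (X : Matrix (Fin p) (Fin n) ℝ) : (complexCov X).IsSymm := by
  ext k l
  simp [complexCov_apply, mul_comm]

theorem complexCov_eq_add_rankOne (X : Matrix (Fin p) (Fin n) ℝ) (j : Fin n) :
    complexCov X = complexCov (X.updateCol j 0) + rankOne (1 / (n : ℝ)) (fun i => X i j) := by
  ext k l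
  rw [Matrix.add_apply, complexCov_apply, complexCov_apply]
  simp only [rankOne, Matrix.smul_apply, Matrix.vecMulVec_apply, smul_eq_mul,
    Matrix.updateCol_apply]
  push_cast
  rw [← mul_add]
  congr 1
  rw [← Finset.add_sum_erase _ _ (Finset.mem_univ j),
    ← Finset.add_sum_erase _ (fun m => ((if m = j then (0 : Fin p → ℝ) k else X k m : ℝ) : ℂ) *
      ((if m = j then (0 : Fin p → ℝ) l else X l m : ℝ) : ℂ)) (Finset.mem_univ j)]
  simp only [if_true, Pi.zero_apply, Complex.ofReal_zero, zero_mul, zero_add]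
  rw [add_comm]
  congr 1
  refine Finset.sum_congr rfl fun m hm => ?_
  rw [if_neg (Finset.ne_of_mem_erase hm), if_neg (Finset.ne_of_mem_erase hm)]

/-- The normalized trace `n⁻¹ tr (w (W - w²)⁻¹)`. -/
noncomputable def meanResolvent (X : Matrix (Fin p) (Fin n) ℝ) (w : ℂ) : ℂ :=
  (1 / (n : ℂ)) * (symResolvent (complexCov X) w).trace

/-- The denominator `w + n⁻¹ x_jᵀ B_j x_j` in the leave-one-out formula. -/
noncomputable def leaveOneOut (X : Matrix (Fin p) (Fin n) ℝ) (w : ℂ) (j : Fin n) : ℂ :=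
  w + ((1 / (n : ℝ) : ℝ) : ℂ) *
    resolventForm (complexCov (X.updateCol j 0)) w (fun i => X i j)

theorem im_le_im_leaveOneOut (X : Matrix (Fin p) (Fin n) ℝ) {w : ℂ} (hw : 0 < w.im)
    (j : Fin n) : w.im ≤ (leaveOneOut X w j).im := by
  have := resolventForm_im_nonneg (complexCov_posSemidef (X.updateCol j 0)) hw (fun i => X i j)
  rw [leaveOneOut, Complex.add_im, Complex.im_ofReal_mul]
  have : 0 ≤ 1 / (n : ℝ) * (resolventForm (complexCov (X.updateCol j 0)) w fun i => X i j).im := by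
    positivity
  linarith

theorem meanResolvent_im_nonneg (X : Matrix (Fin p) (Fin n) ℝ) {w : ℂ} (hw : 0 < w.im) :
    0 ≤ (meanResolvent X w).im := by
  have h := trace_symResolvent_im_nonneg (complexCov_posSemidef X) hw
  have : (1 / (n : ℂ)) = ((1 / (n : ℝ) : ℝ) : ℂ) := by push_cast; rfl
  rw [meanResolvent, this, Complex.im_ofReal_mul]
  positivity

theorem norm_meanResolvent_sub_le (X : Matrix (Fin p) (Fin n) ℝ) {w : ℂ} (hw : 0 < w.im)
    (j : Fin n) :
    ‖meanResolvent X w - meanResolvent (X.updateCol j 0) w‖ ≤ 1 / (n * w.im) := by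
  have hA := complexCov_posSemidef (X.updateCol j 0)
  have hA' := complexCov_posSemidef X
  have h := complexCov_eq_add_rankOne X j
  rw [h] at hA'
  have := norm_trace_symResolvent_add_rankOne_sub_le hA (complexCov_isSymm _) hw
    (by positivity : (0 : ℝ) ≤ 1 / n) (fun i => X i j) hA'
  rw [meanResolvent, meanResolvent, ← mul_sub, norm_mul, h]
  have h1 : ‖(1 / (n : ℂ))‖ = 1 / n := by simp
  rw [h1, one_div_mul_eq_div, mul_comm, ← div_div]
  exact div_le_div_of_nonneg_right this (by positivity)

/-- The trace of `W · w (W - w²)⁻¹` is computed twice: as the sum over columns of quadratic forms,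
each expressed through `1/r_j` by Sherman–Morrison, and from `W = (W - w²) + w²`. The term `(1 -
p/n)/w` comes from comparing the `n` columns with the `p` diagonal entries. -/
theorem meanResolvent_sub_eq (X : Matrix (Fin p) (Fin n) ℝ) {w : ℂ} (hw : 0 < w.im)
    (hn : n ≠ 0) :
    meanResolvent X w - (1 - (p : ℂ) / n) / w =
      -((1 / (n : ℂ)) * ∑ j, (leaveOneOut X w j)⁻¹) := by
  have hw0 : w ≠ 0 := by rintro rfl; simp at hw
  have hn' : (n : ℂ) ≠ 0 := by exact_mod_cast hn
  have hA := complexCov_posSemidef X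
  have hr (j : Fin n) : leaveOneOut X w j ≠ 0 := by
    intro h
    have := im_le_im_leaveOneOut X hw j
    rw [h, Complex.zero_im] at this
    linarith
  have h1 (j : Fin n) : (1 / (n : ℂ)) * resolventForm (complexCov X) w (fun i => X i j) =
      w * (1 - w * (leaveOneOut X w j)⁻¹) := by
    have h := complexCov_eq_add_rankOne X j
    have hA' := hA
    rw [h] at hA'
    have := resolventForm_add_rankOne (complexCov_posSemidef (X.updateCol j 0)) hw
      (fun i => X i j) hA' (hr j)
    rw [← h] at this
    rw [← div_eq_mul_inv, leaveOneOut, ← this]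
    push_cast
    rfl
  have h2 : ∑ j, (1 / (n : ℂ)) * resolventForm (complexCov X) w (fun i => X i j) =
      (complexCov X * symResolvent (complexCov X) w).trace := by
    simp only [resolventForm, Matrix.trace, Matrix.diag, Matrix.mul_apply, dotProduct,
      Matrix.mulVec, complexCov_apply, Finset.mul_sum, Finset.sum_mul]
    have hsymm : ∀ i k, symResolvent (complexCov X) w i k = symResolvent (complexCov X) w k i :=
      fun i k => (symResolvent_isSymm (complexCov_isSymm X) w).apply k i
    rw [Finset.sum_comm]
    refine Finset.sum_congr rfl fun i _ => ?_
    rw [Finset.sum_comm]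
    refine Finset.sum_congr rfl fun k _ => Finset.sum_congr rfl fun j _ => ?_
    rw [hsymm i k]
    ring
  have h3 : complexCov X * symResolvent (complexCov X) w =
      w • (1 : Matrix (Fin p) (Fin p) ℂ) + w ^ 2 • symResolvent (complexCov X) w := by
    have := Matrix.mul_nonsing_inv _ (isUnit_det_sub_sq hA hw)
    rw [Matrix.sub_mul, sub_eq_iff_eq_add] at this
    rw [symResolvent, Matrix.mul_smul, this, smul_add, Matrix.smul_mul, Matrix.one_mul]
    congr 1
    rw [smul_smul, smul_smul, mul_comm]
  have h4 : ∑ j : Fin n, w * (1 - w * (leaveOneOut X w j)⁻¹) =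
      w * p + w ^ 2 * (symResolvent (complexCov X) w).trace := by
    rw [← Finset.sum_congr rfl fun j _ => h1 j, h2, h3]
    simp [Matrix.trace_add, Matrix.trace_smul]
  rw [← Finset.mul_sum, Finset.sum_sub_distrib, ← Finset.mul_sum] at h4
  simp only [Finset.sum_const, Finset.card_univ, Fintype.card_fin, nsmul_eq_mul, mul_one] at h4
  have h5 : w * ((n : ℂ) - w * ∑ j, (leaveOneOut X w j)⁻¹) =
    w * (p + w * (symResolvent (complexCov X) w).trace) := by rw [h4]; ring
  have h6 := mul_left_cancel₀ hw0 h5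
  rw [meanResolvent]
  generalize ∑ j, (leaveOneOut X w j)⁻¹ = S at h6 ⊢
  field_simp
  linear_combination -h6

theorem trace_symResolvent_complexCov (X : Matrix (Fin p) (Fin n) ℝ) {w : ℂ} (hw : 0 < w.im) :
    (symResolvent (complexCov X) w).trace =
      ∑ k, w / (((sampleCov_isHermitian X).eigenvalues k : ℂ) - w ^ 2) := by
  set hH := sampleCov_isHermitian X
  set U : Matrix (Fin p) (Fin p) ℝ := (hH.eigenvectorUnitary : Matrix (Fin p) (Fin p) ℝ) with hU
  have hUU : star U * U = 1 := Unitary.coe_star_mul_self hH.eigenvectorUnitary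
  have hUU' : U * star U = 1 := Unitary.coe_mul_star_self hH.eigenvectorUnitary
  have hspec : sampleCov X = U * Matrix.diagonal hH.eigenvalues * star U := by
    have := hH.spectral_theorem
    rw [Unitary.conjStarAlgAut_apply] at this
    simpa using this
  set V : Matrix (Fin p) (Fin p) ℂ := U.map Complex.ofRealHom with hV
  set V' : Matrix (Fin p) (Fin p) ℂ := (star U).map Complex.ofRealHom with hV'
  have e1 : V' * V = 1 := by
    rw [hV, hV', ← Matrix.map_mul, hUU]; ext i j; simp [Matrix.one_apply, apply_ite]
  have e2 : V * V' = 1 := by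
    rw [hV, hV', ← Matrix.map_mul, hUU']; ext i j; simp [Matrix.one_apply, apply_ite]
  have e3 : complexCov X = V * Matrix.diagonal (fun k => (hH.eigenvalues k : ℂ)) * V' := by
    have : complexCov X = (sampleCov X).map Complex.ofRealHom := rfl
    rw [this]
    have h := congrArg (fun M => M.map Complex.ofRealHom) hspec
    simp only [Matrix.map_mul] at h
    rw [Matrix.diagonal_map (by simp)] at h
    exact h
  have e4 : complexCov X - w ^ 2 • (1 : Matrix (Fin p) (Fin p) ℂ) =
      V * Matrix.diagonal (fun k => (hH.eigenvalues k : ℂ) - w ^ 2) * V' := by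
    have : Matrix.diagonal (fun k => (hH.eigenvalues k : ℂ) - w ^ 2) =
        Matrix.diagonal (fun k => (hH.eigenvalues k : ℂ)) - w ^ 2 • 1 := by
      rw [Matrix.smul_one_eq_diagonal, Matrix.diagonal_sub]
    rw [this, Matrix.mul_sub, Matrix.sub_mul, ← e3, Matrix.mul_smul, Matrix.smul_mul,
      Matrix.mul_one, e2]
  have hdet := isUnit_det_sub_sq (complexCov_posSemidef X) hw
  have hne (k : Fin p) : (hH.eigenvalues k : ℂ) - w ^ 2 ≠ 0 := by
    intro h
    rw [e4, Matrix.det_mul, Matrix.det_mul, Matrix.det_diagonal,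
      Finset.prod_eq_zero (Finset.mem_univ k) h] at hdet
    simp at hdet
  have e5 : (complexCov X - w ^ 2 • (1 : Matrix (Fin p) (Fin p) ℂ))⁻¹ =
      V * Matrix.diagonal (fun k => ((hH.eigenvalues k : ℂ) - w ^ 2)⁻¹) * V' := by
    apply Matrix.inv_eq_left_inv
    rw [e4]
    calc _ = V * (Matrix.diagonal (fun k => ((hH.eigenvalues k : ℂ) - w ^ 2)⁻¹) * (V' * V) *
          Matrix.diagonal (fun k => (hH.eigenvalues k : ℂ) - w ^ 2)) * V' := by
          simp only [Matrix.mul_assoc]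
      _ = 1 := by
        rw [e1, Matrix.mul_one, Matrix.diagonal_mul_diagonal]
        simp only [inv_mul_cancel₀ (hne _), Matrix.diagonal_one, Matrix.mul_one, e2]
  rw [symResolvent, e5, Matrix.trace_smul, Matrix.trace_mul_comm, ← Matrix.mul_assoc, e1,
    Matrix.one_mul, Matrix.trace_diagonal, Finset.smul_sum]
  simp [div_eq_mul_inv]

end SampleCovResolvent

/-! ### Stability of the self-consistent equation -/

section Stability

/-- Data of an approximate solution `γ` of the equation `(g - β) (w + g) = -1`, where
`γ - β = -n⁻¹ ∑ 1 / r_j`, together with an exact solution `g` in the upper half plane. -/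
structure ApproxSolution {n : ℕ} (w β γ g : ℂ) (r : Fin n → ℂ) : Prop where
  n_ne : n ≠ 0
  w_im : 0 < w.im
  r_im : ∀ j, w.im ≤ (r j).im
  avg : γ - β = -((1 / (n : ℂ)) * ∑ j, (r j)⁻¹)
  exact_eq : (g - β) * (w + g) = -1
  g_im : 0 ≤ g.im
  γ_im : 0 ≤ γ.im
  β_im : β.im ≤ 0

namespace ApproxSolution

variable {n : ℕ} {w β γ g : ℂ} {r : Fin n → ℂ}

/-- The denominator controlling the stability of the equation. -/
def den (w β γ g : ℂ) : ℝ := w.im + g.im + γ.im - β.im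

theorem le_den (h : ApproxSolution w β γ g r) : w.im ≤ den w β γ g := by
  have := h.g_im; have := h.γ_im; have := h.β_im
  unfold den; linarith

theorem den_pos (h : ApproxSolution w β γ g r) : 0 < den w β γ g := h.w_im.trans_le h.le_den

theorem r_ne (h : ApproxSolution w β γ g r) (j : Fin n) : r j ≠ 0 := by
  intro h0
  have := h.r_im j
  rw [h0, Complex.zero_im] at this
  linarith [h.w_im]

theorem norm_inv_le (h : ApproxSolution w β γ g r) (j : Fin n) : ‖(r j)⁻¹‖ ≤ 1 / w.im := by
  rw [norm_inv, ← one_div]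
  exact one_div_le_one_div_of_le h.w_im
    ((h.r_im j).trans ((le_abs_self _).trans (Complex.abs_im_le_norm _)))

/-- Subtracting the exact equation from the approximate one factors out `γ - g`; the cofactor `w + g
+ γ - β` has imaginary part `den`, which bounds its modulus from below. -/
theorem den_mul_norm_le (h : ApproxSolution w β γ g r) :
    den w β γ g * ‖γ - g‖ ≤ (1 / (n : ℝ)) * ∑ j, ‖(r j)⁻¹‖ * ‖r j - w - γ‖ := by
  have hn : (n : ℂ) ≠ 0 := by exact_mod_cast h.n_ne
  have h1 : (γ - g) * (w + g + γ - β) = (1 / (n : ℂ)) * ∑ j, (r j)⁻¹ * (r j - w - γ) := by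
    have e1 (j : Fin n) : (r j)⁻¹ * (r j - w - γ) = 1 - (w + γ) * (r j)⁻¹ := by
      have := h.r_ne j
      field_simp
      ring
    rw [Finset.sum_congr rfl fun j _ => e1 j, Finset.sum_sub_distrib, ← Finset.mul_sum]
    have e2 : (1 / (n : ℂ)) * ∑ j, (r j)⁻¹ = β - γ := by
      linear_combination h.avg
    simp only [Finset.sum_const, Finset.card_univ, Fintype.card_fin, nsmul_eq_mul, mul_one]
    have e3 : (1 / (n : ℂ)) * n = 1 := by field_simp
    linear_combination -h.exact_eq - e3 + (w + γ) * e2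
  have h2 : den w β γ g ≤ ‖w + g + γ - β‖ := by
    refine le_trans ?_ ((le_abs_self _).trans (Complex.abs_im_le_norm _))
    simp [den]
  calc den w β γ g * ‖γ - g‖ ≤ ‖γ - g‖ * ‖w + g + γ - β‖ := by
        rw [mul_comm]; gcongr
    _ = ‖(1 / (n : ℂ)) * ∑ j, (r j)⁻¹ * (r j - w - γ)‖ := by rw [← norm_mul, h1]
    _ ≤ _ := by
      rw [norm_mul]
      have : ‖(1 / (n : ℂ))‖ = 1 / n := by simp
      rw [this]
      gcongr
      refine (norm_sum_le _ _).trans (Finset.sum_le_sum fun j _ => ?_)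
      rw [norm_mul]

/-- Pointwise `v |1/r_j|² ≤ -Im (1/r_j)` because `Im r_j ≥ v`, and the right side averages to `Im (γ
- β)`, which is part of `den`. -/
theorem avg_norm_inv_sq_le (h : ApproxSolution w β γ g r) :
    (1 / (n : ℝ)) * ∑ j, ‖(r j)⁻¹‖ ^ 2 ≤ den w β γ g / w.im := by
  rw [le_div_iff₀ h.w_im]
  have h1 : (1 / (n : ℝ)) * ∑ j, (-(r j)⁻¹.im) = (γ - β).im := by
    rw [h.avg, Complex.neg_im]
    have : (1 / (n : ℂ)) = ((1 / (n : ℝ) : ℝ) : ℂ) := by push_cast; rfl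
    rw [this, Complex.im_ofReal_mul, Complex.im_sum, Finset.sum_neg_distrib, mul_neg]
  have h2 (j : Fin n) : ‖(r j)⁻¹‖ ^ 2 * w.im ≤ -(r j)⁻¹.im := by
    rw [Complex.inv_im, norm_inv, inv_pow, ← Complex.normSq_eq_norm_sq, neg_div, neg_neg,
      inv_mul_eq_div]
    exact div_le_div_of_nonneg_right (h.r_im j) (Complex.normSq_nonneg _)
  calc (1 / (n : ℝ)) * (∑ j, ‖(r j)⁻¹‖ ^ 2) * w.im
      = (1 / (n : ℝ)) * ∑ j, ‖(r j)⁻¹‖ ^ 2 * w.im := by rw [mul_assoc, Finset.sum_mul]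
    _ ≤ (1 / (n : ℝ)) * ∑ j, (-(r j)⁻¹.im) := by
      gcongr with j; exact h2 j
    _ ≤ den w β γ g := by
      rw [h1, Complex.sub_im]
      have := h.g_im; have := h.w_im
      unfold den; linarith

/-- The normalized mean square error. -/
noncomputable def sqErr (w β γ g : ℂ) (r : Fin n → ℂ) : ℝ :=
  (1 / (n : ℝ)) * ∑ j, ‖r j - w - γ‖ ^ 2 / den w β γ g

/-- Cauchy–Schwarz splits the error average into the mean of `|1/r_j|²` and the mean of the squared
errors. Each carries one factor `den`, matching the square of `den` on the left, so all of them
cancel. -/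
theorem norm_sub_sq_le (h : ApproxSolution w β γ g r) :
    ‖γ - g‖ ^ 2 ≤ sqErr w β γ g r / w.im := by
  have hD := h.den_pos
  have hn : (0 : ℝ) < n := by exact_mod_cast Nat.pos_of_ne_zero h.n_ne
  have h1 := h.den_mul_norm_le
  have h2 := Finset.sum_mul_sq_le_sq_mul_sq Finset.univ (fun j => ‖(r j)⁻¹‖)
    (fun j => ‖r j - w - γ‖)
  have h3 := h.avg_norm_inv_sq_le
  have h4 : (1 / (n : ℝ)) * ∑ j, ‖r j - w - γ‖ ^ 2 = sqErr w β γ g r * den w β γ g := by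
    rw [sqErr, ← Finset.sum_div]
    field_simp
  have h5 : (den w β γ g * ‖γ - g‖) ^ 2 ≤
      (den w β γ g / w.im) * (sqErr w β γ g r * den w β γ g) := by
    calc _ ≤ ((1 / (n : ℝ)) * ∑ j, ‖(r j)⁻¹‖ * ‖r j - w - γ‖) ^ 2 := by gcongr
      _ ≤ (1 / (n : ℝ)) ^ 2 * ((∑ j, ‖(r j)⁻¹‖ ^ 2) * ∑ j, ‖r j - w - γ‖ ^ 2) := by
        rw [mul_pow]; gcongr
      _ = ((1 / (n : ℝ)) * ∑ j, ‖(r j)⁻¹‖ ^ 2) * ((1 / (n : ℝ)) * ∑ j, ‖r j - w - γ‖ ^ 2) := by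
        ring
      _ ≤ _ := by
        rw [← h4]
        gcongr
  have h6 : den w β γ g / w.im * (sqErr w β γ g r * den w β γ g) =
      den w β γ g ^ 2 * (sqErr w β γ g r / w.im) := by ring
  rw [mul_pow, h6] at h5
  exact le_of_mul_le_mul_left h5 (by positivity)

/-- Young's inequality with a free parameter `t`. A factor `den` is exposed on the right so that it
later cancels the one on the left of the stability estimate, leaving only the deterministic lower
bound `D`. -/
theorem avg_norm_le (h : ApproxSolution w β γ g r) {D t : ℝ} (ht : 0 < t) (hD : 0 < D)
    (hDle : D ≤ w.im + g.im - β.im) :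
    (1 / (n : ℝ)) * ∑ j, ‖r j - w - γ‖ ≤
      den w β γ g * (t * sqErr w β γ g r + 1 / (t * D)) := by
  have hd := h.den_pos
  have hDd : D ≤ den w β γ g := by have := h.γ_im; unfold den; linarith
  have hn : (0 : ℝ) < n := by exact_mod_cast Nat.pos_of_ne_zero h.n_ne
  have h1 (j : Fin n) : ‖r j - w - γ‖ ≤
      den w β γ g * (t * (‖r j - w - γ‖ ^ 2 / den w β γ g) + 1 / (t * D)) := by
    set e := ‖r j - w - γ‖
    have e1 : den w β γ g * (t * (e ^ 2 / den w β γ g) + 1 / (t * D)) =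
        t * e ^ 2 + (1 / t) * (den w β γ g / D) := by field_simp
    have e2 : 1 ≤ den w β γ g / D := by rwa [one_le_div hD]
    have e3 : (1 / t) * 1 ≤ (1 / t) * (den w β γ g / D) := by gcongr
    have e4 : e ≤ t * e ^ 2 + 1 / t := by
      have : t * e ^ 2 + 1 / t - e = (1 / t) * ((t * e - 1 / 2) ^ 2 + 3 / 4) := by
        field_simp; ring
      have : 0 ≤ (1 / t) * ((t * e - 1 / 2) ^ 2 + 3 / 4) := by positivity
      linarith
    rw [e1]; linarith
  calc (1 / (n : ℝ)) * ∑ j, ‖r j - w - γ‖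
      ≤ (1 / (n : ℝ)) * ∑ j,
        den w β γ g * (t * (‖r j - w - γ‖ ^ 2 / den w β γ g) + 1 / (t * D)) := by
        gcongr with j; exact h1 j
    _ = _ := by
      rw [← Finset.mul_sum, Finset.sum_add_distrib, ← Finset.mul_sum]
      simp only [Finset.sum_const, Finset.card_univ, Fintype.card_fin, nsmul_eq_mul]
      rw [sqErr]
      field_simp

/-- Uses only the crude bound `|1/r_j| ≤ 1/v`; this is adequate at large heights. -/
theorem norm_sub_le_far (h : ApproxSolution w β γ g r) {D t : ℝ} (ht : 0 < t) (hD : 0 < D)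
    (hDle : D ≤ w.im + g.im - β.im) :
    ‖γ - g‖ ≤ (1 / w.im) * (t * sqErr w β γ g r + 1 / (t * D)) := by
  have hd := h.den_pos
  have h1 := h.den_mul_norm_le
  have h2 := h.avg_norm_le ht hD hDle
  have hw := h.w_im
  have h3 : (1 / (n : ℝ)) * ∑ j, ‖(r j)⁻¹‖ * ‖r j - w - γ‖ ≤
      (1 / w.im) * ((1 / (n : ℝ)) * ∑ j, ‖r j - w - γ‖) := by
    rw [mul_left_comm, Finset.mul_sum _ _ (1 / w.im)]
    refine mul_le_mul_of_nonneg_left (Finset.sum_le_sum fun j _ => ?_) (by positivity)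
    exact mul_le_mul_of_nonneg_right (h.norm_inv_le j) (norm_nonneg _)
  have h4 : (1 / w.im) * ((1 / (n : ℝ)) * ∑ j, ‖r j - w - γ‖) ≤
      (1 / w.im) * (den w β γ g * (t * sqErr w β γ g r + 1 / (t * D))) := by gcongr
  rw [mul_left_comm (1 / w.im) (den w β γ g)] at h4
  exact le_of_mul_le_mul_left (h1.trans (h3.trans h4)) hd

/-- Either `ρ` is close to `θ`, and then `|ρ| ≥ T/2`, or the error exceeds `T/2`, and then the loss
`1/v` can be paid for by squaring the error. -/
theorem norm_inv_mul_norm_le {v T : ℝ} {ρ θ : ℂ} (hv : 0 < v) (hT : 0 < T) (hρ : v ≤ ρ.im)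
    (hθ : T ≤ ‖θ‖) : ‖ρ⁻¹‖ * ‖ρ - θ‖ ≤ (2 / T) * (‖ρ - θ‖ + ‖ρ - θ‖ ^ 2 / v) := by
  have hρ' : v ≤ ‖ρ‖ := hρ.trans ((le_abs_self _).trans (Complex.abs_im_le_norm _))
  have hρ0 : 0 < ‖ρ‖ := hv.trans_le hρ'
  rw [norm_inv]
  rcases le_or_gt (‖ρ - θ‖) (T / 2) with hc | hc
  · have h1 : T / 2 ≤ ‖ρ‖ := by
      have := norm_sub_norm_le θ ρ
      rw [norm_sub_rev] at this
      linarith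
    have h2 : ‖ρ‖⁻¹ ≤ 2 / T := by
      rw [inv_le_comm₀ hρ0 (by positivity), inv_div]; exact h1
    calc _ ≤ (2 / T) * ‖ρ - θ‖ := by gcongr
      _ ≤ _ := by gcongr; exact le_add_of_nonneg_right (by positivity)
  · have h2 : ‖ρ‖⁻¹ ≤ 1 / v := by rw [one_div]; gcongr
    have h3 : ‖ρ - θ‖ ≤ (2 / T) * ‖ρ - θ‖ ^ 2 := by
      rw [div_mul_eq_mul_div, le_div_iff₀ hT]
      nlinarith [norm_nonneg (ρ - θ)]
    calc _ ≤ (1 / v) * ((2 / T) * ‖ρ - θ‖ ^ 2) := by gcongr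
      _ = (2 / T) * (‖ρ - θ‖ ^ 2 / v) := by ring
      _ ≤ _ := by gcongr; exact le_add_of_nonneg_left (by positivity)

theorem sqErr_nonneg (h : ApproxSolution w β γ g r) : 0 ≤ sqErr w β γ g r := by
  have := h.den_pos
  unfold sqErr; positivity

/-- If `|γ - g| ≤ c/2`, then `w + γ` inherits the lower bound of `w + g`, so `1/r_j` is bounded up
to a quadratic error. If not, `|γ - g|` is dominated by its square, for which `norm_sub_sq_le`
suffices. Only the quadratic term is thus divided by `v`. -/
theorem norm_sub_le_near (h : ApproxSolution w β γ g r) {D t c : ℝ} (ht : 0 < t) (hD : 0 < D)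
    (hDle : D ≤ w.im + g.im - β.im) (hc : 0 < c) (hcg : c ≤ ‖w + g‖) :
    ‖γ - g‖ ≤ (4 / c) * (t * sqErr w β γ g r + 1 / (t * D) + sqErr w β γ g r / w.im) := by
  have hd := h.den_pos
  have hw := h.w_im
  have hS := h.sqErr_nonneg
  have hn : (0 : ℝ) < n := by exact_mod_cast Nat.pos_of_ne_zero h.n_ne
  rcases le_or_gt (‖γ - g‖) (c / 2) with hc' | hc'
  · have hT : c / 2 ≤ ‖w + γ‖ := by
      have := norm_sub_norm_le (w + g) (w + γ)
      rw [show w + g - (w + γ) = -(γ - g) by ring, norm_neg] at this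
      linarith
    have h1 := h.den_mul_norm_le
    have h2 := h.avg_norm_le ht hD hDle
    have h3 (j : Fin n) : ‖(r j)⁻¹‖ * ‖r j - w - γ‖ ≤
        (4 / c) * (‖r j - w - γ‖ + ‖r j - w - γ‖ ^ 2 / w.im) := by
      have := norm_inv_mul_norm_le hw (by positivity) (h.r_im j) hT
      rw [show (2 / (c / 2)) = 4 / c by field_simp; norm_num, ← sub_sub] at this
      exact this
    have h4 : (1 / (n : ℝ)) * ∑ j, ‖(r j)⁻¹‖ * ‖r j - w - γ‖ ≤
        (1 / (n : ℝ)) * ∑ j, (4 / c) * (‖r j - w - γ‖ + ‖r j - w - γ‖ ^ 2 / w.im) := by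
      exact mul_le_mul_of_nonneg_left (Finset.sum_le_sum fun j _ => h3 j) (by positivity)
    have h5 : (1 / (n : ℝ)) * ∑ j, (4 / c) * (‖r j - w - γ‖ + ‖r j - w - γ‖ ^ 2 / w.im) =
        (4 / c) * ((1 / (n : ℝ)) * ∑ j, ‖r j - w - γ‖ +
          den w β γ g * (sqErr w β γ g r / w.im)) := by
      rw [← Finset.mul_sum, Finset.sum_add_distrib, sqErr, ← Finset.sum_div, ← Finset.sum_div]
      field_simp
    have h6 : (4 / c) * ((1 / (n : ℝ)) * ∑ j, ‖r j - w - γ‖ +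
          den w β γ g * (sqErr w β γ g r / w.im)) ≤
        (4 / c) * (den w β γ g * (t * sqErr w β γ g r + 1 / (t * D)) +
          den w β γ g * (sqErr w β γ g r / w.im)) := by gcongr
    rw [← mul_add, mul_left_comm] at h6
    exact le_of_mul_le_mul_left (h1.trans (h4.trans (h5.le.trans h6))) hd
  · have h1 := h.norm_sub_sq_le
    have h2 : ‖γ - g‖ ≤ (4 / c) * ‖γ - g‖ ^ 2 := by
      rw [div_mul_eq_mul_div, le_div_iff₀ hc]
      nlinarith [norm_nonneg (γ - g)]
    calc _ ≤ (4 / c) * ‖γ - g‖ ^ 2 := h2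
      _ ≤ (4 / c) * (sqErr w β γ g r / w.im) := by gcongr
      _ ≤ _ := by
        gcongr
        exact le_add_of_nonneg_left (by positivity)

/-- Here `γ'_j` stands for the mean resolvent without column `j`, which is independent of that
column. Replacing `γ` by it costs at most `1/(nv)`, and `n v² ≥ 1` makes this at most `v`, so the
denominator changes by at most a factor two. -/
theorem sqErr_le (h : ApproxSolution w β γ g r) {γ' : Fin n → ℂ}
    (hγ' : ∀ j, ‖γ - γ' j‖ ≤ 1 / (n * w.im)) (hγ0 : ∀ j, 0 ≤ (γ' j).im)
    (hnv : 1 ≤ n * w.im ^ 2) :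
    sqErr w β γ g r ≤ 2 / (n * w.im) +
      (4 / (n : ℝ)) * ∑ j, ‖r j - w - γ' j‖ ^ 2 / (w.im + (γ' j).im) := by
  have hd := h.den_pos
  have hw := h.w_im
  have hn : (0 : ℝ) < n := by exact_mod_cast Nat.pos_of_ne_zero h.n_ne
  have hv : 1 / (n * w.im) ≤ w.im := by
    rw [div_le_iff₀ (by positivity)]; nlinarith
  have h1 (j : Fin n) : ‖r j - w - γ‖ ^ 2 / den w β γ g ≤
      2 / (n * w.im) + 4 * (‖r j - w - γ' j‖ ^ 2 / (w.im + (γ' j).im)) := by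
    have hdj : 0 < w.im + (γ' j).im := by linarith [hγ0 j]
    have e1 : w.im + (γ' j).im ≤ 2 * den w β γ g := by
      have a1 : (γ' j).im - γ.im ≤ 1 / (n * w.im) := by
        refine le_trans ?_ (hγ' j)
        rw [norm_sub_rev, ← Complex.sub_im]
        exact (le_abs_self _).trans (Complex.abs_im_le_norm _)
      have := h.g_im; have := h.β_im; have := h.γ_im
      unfold den; linarith
    have e2 : ‖r j - w - γ‖ ^ 2 ≤ 2 * (1 / (n * w.im)) ^ 2 + 2 * ‖r j - w - γ' j‖ ^ 2 := by
      have a1 : ‖r j - w - γ‖ ≤ ‖r j - w - γ' j‖ + ‖γ - γ' j‖ := by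
        have := norm_sub_le (r j - w - γ' j) (γ - γ' j)
        rwa [show r j - w - γ' j - (γ - γ' j) = r j - w - γ by ring] at this
      have a2 := hγ' j
      have a3 : ‖r j - w - γ‖ ≤ ‖r j - w - γ' j‖ + 1 / (n * w.im) := by linarith
      have a4 : ‖r j - w - γ‖ ^ 2 ≤ (‖r j - w - γ' j‖ + 1 / (n * w.im)) ^ 2 := by gcongr
      nlinarith [sq_nonneg (‖r j - w - γ' j‖ - 1 / (n * w.im))]
    calc ‖r j - w - γ‖ ^ 2 / den w β γ g
        ≤ (2 * (1 / (n * w.im)) ^ 2 + 2 * ‖r j - w - γ' j‖ ^ 2) / den w β γ g := by gcongr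
      _ = 2 * ((1 / (n * w.im)) ^ 2 / den w β γ g) + 2 * (‖r j - w - γ' j‖ ^ 2 / den w β γ g) := by
        ring
      _ ≤ 2 * ((1 / (n * w.im)) * w.im / w.im) +
          2 * (‖r j - w - γ' j‖ ^ 2 / ((w.im + (γ' j).im) / 2)) := by
        rw [sq]
        gcongr
        · exact h.le_den
        · linarith
      _ = _ := by
        field_simp
        ring
  calc sqErr w β γ g r ≤ (1 / (n : ℝ)) * ∑ j : Fin n,
        (2 / (n * w.im) + 4 * (‖r j - w - γ' j‖ ^ 2 / (w.im + (γ' j).im))) := by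
        unfold sqErr
        gcongr with j
        exact h1 j
    _ = _ := by
      rw [Finset.sum_add_distrib, ← Finset.mul_sum]
      simp only [Finset.sum_const, Finset.card_univ, Fintype.card_fin, nsmul_eq_mul]
      field_simp

end ApproxSolution

end Stability

/-! ### Variance of quadratic forms in independent variables -/

section QuadraticForm

set_option linter.unusedSectionVars false

variable {Ω ι : Type*} [MeasurableSpace Ω] [DecidableEq ι]

/-- The centred product `ξ_k ξ_l - δ_{kl}`. -/
def centredProd (ξ : ι → Ω → ℝ) (α : ι × ι) (ω : Ω) : ℝ :=
  ξ α.1 ω * ξ α.2 ω - if α.1 = α.2 then 1 else 0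

/-- Independent standardized variables with fourth moments bounded by `M`. -/
structure StdIndep (P : Measure Ω) (ξ : ι → Ω → ℝ) (M : ℝ) : Prop where
  meas : ∀ i, Measurable (ξ i)
  indep : iIndepFun ξ P
  mean : ∀ i, ∫ ω, ξ i ω ∂P = 0
  var : ∀ i, ∫ ω, |ξ i ω| ^ 2 ∂P = 1
  int4 : ∀ i, Integrable (fun ω => |ξ i ω| ^ 4) P
  le4 : ∀ i, ∫ ω, |ξ i ω| ^ 4 ∂P ≤ M

variable {P : Measure Ω} [IsProbabilityMeasure P] {ξ : ι → Ω → ℝ} {M : ℝ}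

namespace StdIndep

theorem integrable_sq (h : StdIndep P ξ M) (i : ι) : Integrable (fun ω => |ξ i ω| ^ 2) P := by
  refine ((h.int4 i).add (integrable_const 1)).mono'
    ((h.meas i).norm.pow_const 2).aestronglyMeasurable (Filter.Eventually.of_forall fun ω => ?_)
  simp only [Pi.add_apply]
  rw [Real.norm_of_nonneg (by positivity)]
  nlinarith [sq_nonneg (|ξ i ω| ^ 2 - 1)]

/-- From `(ξ² - 1)² ≥ 0` and unit variance. It allows deterministic errors to be absorbed into `M`.
-/
theorem one_le (h : StdIndep P ξ M) (i : ι) : 1 ≤ M := by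
  refine le_trans ?_ (h.le4 i)
  have h1 : ∫ ω, (2 * |ξ i ω| ^ 2 - 1) ∂P = 1 := by
    rw [integral_sub ((h.integrable_sq i).const_mul 2) (integrable_const 1),
      integral_const_mul, h.var i]
    norm_num
  rw [← h1]
  refine integral_mono (((h.integrable_sq i).const_mul 2).sub (integrable_const 1)) (h.int4 i)
    fun ω => ?_
  simp only
  nlinarith [sq_nonneg (|ξ i ω| ^ 2 - 1)]

theorem measurable_centredProd (h : StdIndep P ξ M) (α : ι × ι) :
    Measurable (centredProd ξ α) :=
  ((h.meas _).mul (h.meas _)).sub measurable_const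

theorem integral_mul_eq_zero_of_notMem [Fintype ι] (h : StdIndep P ξ M) (i : ι) {φ : ℝ → ℝ}
    (hφ : Measurable φ) (h0 : ∫ ω, φ (ξ i ω) ∂P = 0)
    {Φ : ({j // j ∈ Finset.univ.erase i} → ℝ) → ℝ} (hΦ : Measurable Φ) :
    ∫ ω, φ (ξ i ω) * Φ (fun j => ξ j ω) ∂P = 0 := by
  have hind := h.indep.indepFun_finset {i} (Finset.univ.erase i)
    (by simp) h.meas
  have h2 : IndepFun (fun ω => φ (ξ i ω))
      (fun ω => Φ (fun j : {j // j ∈ Finset.univ.erase i} => ξ j ω)) P :=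
    hind.comp (φ := fun z : ({j // j ∈ ({i} : Finset ι)} → ℝ) =>
      φ (z ⟨i, Finset.mem_singleton_self i⟩))
      (ψ := Φ) (hφ.comp (measurable_pi_apply _)) hΦ
  rw [h2.integral_fun_mul_eq_mul_integral (hφ.comp (h.meas i)).aestronglyMeasurable
    (hΦ.comp (measurable_pi_lambda _ fun j => h.meas _)).aestronglyMeasurable, h0, zero_mul]

theorem integral_centredProd_mul_eq_zero_of_notMem [Fintype ι] (h : StdIndep P ξ M)
    {α β : ι × ι} (h1 : α.1 ≠ β.1) (h2 : α.1 ≠ β.2) :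
    ∫ ω, centredProd ξ α ω * centredProd ξ β ω ∂P = 0 := by
  obtain ⟨k, l⟩ := α
  obtain ⟨k', l'⟩ := β
  simp only at h1 h2
  set F : Finset ι := Finset.univ.erase k with hF
  let a : F := ⟨k', by simp [hF, h1.symm]⟩
  let b : F := ⟨l', by simp [hF, h2.symm]⟩
  by_cases hkl : k = l
  · subst hkl
    have h0 : ∫ ω, ((fun x : ℝ => x ^ 2 - 1) (ξ k ω)) ∂P = 0 := by
      have := h.var k
      simp only [sq_abs] at this
      have hi := h.integrable_sq k
      simp only [sq_abs] at hi
      rw [integral_sub hi (integrable_const 1), this]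
      simp
    have := h.integral_mul_eq_zero_of_notMem k (φ := fun x => x ^ 2 - 1) (by fun_prop) h0
      (Φ := fun z => z a * z b - if k' = l' then 1 else 0)
      (by fun_prop)
    rw [← this]
    refine integral_congr_ae (Filter.Eventually.of_forall fun ω => ?_)
    simp only [centredProd, a, b, if_true]
    ring
  · let c : F := ⟨l, by simp [hF, Ne.symm hkl]⟩
    have := h.integral_mul_eq_zero_of_notMem k (φ := fun x => x) measurable_id (h.mean k)
      (Φ := fun z => z c * (z a * z b - if k' = l' then 1 else 0))
      (by fun_prop)
    rw [← this]
    refine integral_congr_ae (Filter.Eventually.of_forall fun ω => ?_)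
    simp only [centredProd, a, b, c, if_neg hkl]
    ring

theorem centredProd_swap (ξ : ι → Ω → ℝ) (α : ι × ι) :
    centredProd ξ α.swap = centredProd ξ α := by
  ext ω
  simp only [centredProd, Prod.fst_swap, Prod.snd_swap, mul_comm, eq_comm]

/-- Unless the two index pairs agree up to order, some index of one pair is absent from the other;
the corresponding factor is centred and independent of the rest. This covers diagonal pairs too,
thanks to the subtraction of `δ_kl`. -/
theorem integral_centredProd_mul_eq_zero [Fintype ι] (h : StdIndep P ξ M)
    {α β : ι × ι} (h1 : β ≠ α) (h2 : β ≠ α.swap) :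
    ∫ ω, centredProd ξ α ω * centredProd ξ β ω ∂P = 0 := by
  by_cases c1 : α.1 ≠ β.1 ∧ α.1 ≠ β.2
  · exact h.integral_centredProd_mul_eq_zero_of_notMem c1.1 c1.2
  by_cases c2 : α.2 ≠ β.1 ∧ α.2 ≠ β.2
  · rw [← centredProd_swap ξ α]
    exact h.integral_centredProd_mul_eq_zero_of_notMem (α := α.swap) c2.1 c2.2
  by_cases c3 : β.1 ≠ α.1 ∧ β.1 ≠ α.2
  · simp_rw [mul_comm (centredProd ξ α _)]
    exact h.integral_centredProd_mul_eq_zero_of_notMem c3.1 c3.2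
  by_cases c4 : β.2 ≠ α.1 ∧ β.2 ≠ α.2
  · simp_rw [mul_comm (centredProd ξ α _)]
    rw [← centredProd_swap ξ β]
    exact h.integral_centredProd_mul_eq_zero_of_notMem (α := β.swap) c4.1 c4.2
  exfalso
  rw [Ne, Prod.ext_iff] at h1 h2
  simp only [Prod.fst_swap, Prod.snd_swap] at h2
  grind

theorem centredProd_sq_le (ξ : ι → Ω → ℝ) (α : ι × ι) (ω : Ω) :
    centredProd ξ α ω ^ 2 ≤ |ξ α.1 ω| ^ 4 + |ξ α.2 ω| ^ 4 + 1 := by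
  rw [centredProd, Even.pow_abs (by decide), Even.pow_abs (by decide)]
  split_ifs with h
  · rw [h]
    nlinarith [sq_nonneg (ξ α.2 ω ^ 2), sq_nonneg (ξ α.2 ω)]
  · nlinarith [sq_nonneg (ξ α.1 ω ^ 2 - ξ α.2 ω ^ 2), sq_nonneg (ξ α.1 ω ^ 2 + ξ α.2 ω ^ 2)]

theorem integrable_centredProd_mul (h : StdIndep P ξ M) (α β : ι × ι) :
    Integrable (fun ω => centredProd ξ α ω * centredProd ξ β ω) P := by
  refine (((((h.int4 α.1).add (h.int4 α.2)).add (integrable_const 1))).add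
    ((((h.int4 β.1).add (h.int4 β.2)).add (integrable_const 1)))).mono'
    ((h.measurable_centredProd α).mul (h.measurable_centredProd β)).aestronglyMeasurable
    (Filter.Eventually.of_forall fun ω => ?_)
  have h1 := centredProd_sq_le ξ α ω
  have h2 := centredProd_sq_le ξ β ω
  simp only [Pi.add_apply]
  rw [Real.norm_eq_abs, abs_le]
  constructor <;> nlinarith [sq_nonneg (centredProd ξ α ω - centredProd ξ β ω),
    sq_nonneg (centredProd ξ α ω + centredProd ξ β ω)]

theorem integral_centredProd_sq_le (h : StdIndep P ξ M) (α : ι × ι) :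
    ∫ ω, centredProd ξ α ω * centredProd ξ α ω ∂P ≤ M := by
  obtain ⟨k, l⟩ := α
  have i4 := h.int4
  simp only [Even.pow_abs (show Even 4 by decide)] at i4
  have l4 := h.le4
  simp only [Even.pow_abs (show Even 4 by decide)] at l4
  have i2 := h.integrable_sq
  have v2 := h.var
  simp only [sq_abs] at i2 v2
  by_cases hkl : k = l
  · subst hkl
    have e : ∀ ω, centredProd ξ (k, k) ω * centredProd ξ (k, k) ω =
        ξ k ω ^ 4 - 2 * ξ k ω ^ 2 + 1 := by
      intro ω; simp only [centredProd, if_true]; ring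
    simp_rw [e]
    have i1 : Integrable (fun ω => ξ k ω ^ 4 - 2 * ξ k ω ^ 2) P := (i4 k).sub ((i2 k).const_mul 2)
    rw [integral_add i1 (integrable_const 1), integral_sub (i4 k) ((i2 k).const_mul 2),
      integral_const_mul, v2 k]
    have := l4 k
    simp only [integral_const, probReal_univ, smul_eq_mul]
    linarith
  · have : ∫ ω, centredProd ξ (k, l) ω * centredProd ξ (k, l) ω ∂P ≤
        ∫ ω, (1 / 2) * (ξ k ω ^ 4 + ξ l ω ^ 4) ∂P := by
      refine integral_mono (h.integrable_centredProd_mul _ _)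
        (((i4 k).add (i4 l)).const_mul _) fun ω => ?_
      simp only [centredProd, if_neg hkl]
      nlinarith [sq_nonneg (ξ k ω ^ 2 - ξ l ω ^ 2)]
    rw [integral_const_mul, integral_add (i4 k) (i4 l)] at this
    linarith [l4 k, l4 l]

theorem sum_abs_integral_centredProd_mul_le [Fintype ι] (h : StdIndep P ξ M) (α : ι × ι) :
    ∑ β, |∫ ω, centredProd ξ α ω * centredProd ξ β ω ∂P| ≤ 2 * M := by
  have hM : 0 ≤ M := zero_le_one.trans (h.one_le α.1)
  have hself : |∫ ω, centredProd ξ α ω * centredProd ξ α ω ∂P| ≤ M := by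
    rw [abs_of_nonneg (integral_nonneg fun ω => mul_self_nonneg _)]
    exact h.integral_centredProd_sq_le α
  calc _ ≤ ∑ β, ((if β = α then M else 0) + if β = α.swap then M else 0) := by
        refine Finset.sum_le_sum fun β _ => ?_
        by_cases h1 : β = α
        · rw [if_pos h1, h1]
          exact hself.trans (le_add_of_nonneg_right (by split_ifs <;> simp [hM]))
        by_cases h2 : β = α.swap
        · rw [if_neg h1, if_pos h2, h2, centredProd_swap, zero_add]
          exact hself
        · rw [if_neg h1, if_neg h2, h.integral_centredProd_mul_eq_zero h1 h2]
          simp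
    _ = 2 * M := by
      rw [Finset.sum_add_distrib]
      simp
      ring

/-- Schur's test for the covariance matrix of the centred products: each row has absolute sum at
most `2M`, since only a pair and its transpose correlate. -/
theorem integral_sum_sq_le [Fintype ι] (h : StdIndep P ξ M) (a : ι × ι → ℝ) :
    ∫ ω, (∑ α, a α * centredProd ξ α ω) ^ 2 ∂P ≤ 2 * M * ∑ α, a α ^ 2 := by
  set c : ι × ι → ι × ι → ℝ := fun α β => ∫ ω, centredProd ξ α ω * centredProd ξ β ω ∂P with hc
  have hsymm : ∀ α β, c α β = c β α := fun α β => by simp only [hc, mul_comm]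
  have h1 : ∫ ω, (∑ α, a α * centredProd ξ α ω) ^ 2 ∂P = ∑ α, ∑ β, a α * a β * c α β := by
    have e (ω : Ω) : (∑ α, a α * centredProd ξ α ω) ^ 2 =
        ∑ α, ∑ β, a α * a β * (centredProd ξ α ω * centredProd ξ β ω) := by
      rw [sq, Finset.sum_mul_sum]
      exact Finset.sum_congr rfl fun α _ => Finset.sum_congr rfl fun β _ => by ring
    simp_rw [e]
    rw [integral_finsetSum _ fun α _ => integrable_finsetSum _ fun β _ =>
      (h.integrable_centredProd_mul α β).const_mul _]
    refine Finset.sum_congr rfl fun α _ => ?_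
    rw [integral_finsetSum _ fun β _ => (h.integrable_centredProd_mul α β).const_mul _]
    exact Finset.sum_congr rfl fun β _ => integral_const_mul _ _
  have h2 (α β) : a α * a β * c α β ≤ (1 / 2) * (a α ^ 2 * |c α β| + a β ^ 2 * |c α β|) := by
    have h3 : a α * a β * c α β ≤ |a α * a β| * |c α β| := by
      rw [← abs_mul]; exact le_abs_self _
    have h4 : |a α * a β| ≤ (1 / 2) * (a α ^ 2 + a β ^ 2) := by
      rw [abs_le]
      constructor <;> nlinarith [sq_nonneg (a α - a β), sq_nonneg (a α + a β)]
    nlinarith [mul_le_mul_of_nonneg_right h4 (abs_nonneg (c α β))]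
  rw [h1]
  calc _ ≤ ∑ α, ∑ β, (1 / 2) * (a α ^ 2 * |c α β| + a β ^ 2 * |c α β|) :=
        Finset.sum_le_sum fun α _ => Finset.sum_le_sum fun β _ => h2 α β
    _ = ∑ α, ∑ β, a α ^ 2 * |c α β| := by
      simp_rw [mul_add, Finset.sum_add_distrib]
      rw [Finset.sum_comm (f := fun α β => (1 / 2) * (a β ^ 2 * |c α β|))]
      simp_rw [fun α β => hsymm β α, ← Finset.sum_add_distrib]
      exact Finset.sum_congr rfl fun α _ => Finset.sum_congr rfl fun β _ => by ring
    _ = ∑ α, a α ^ 2 * ∑ β, |c α β| := by simp_rw [Finset.mul_sum]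
    _ ≤ ∑ α, a α ^ 2 * (2 * M) := by
      gcongr with α
      exact h.sum_abs_integral_centredProd_mul_le α
    _ = _ := by rw [← Finset.sum_mul]; ring

theorem lintegral_norm_sum_sq_le [Fintype ι] (h : StdIndep P ξ M) (A : Matrix ι ι ℂ) :
    ∫⁻ ω, ENNReal.ofReal (‖∑ k, ∑ l, A k l * (centredProd ξ (k, l) ω : ℂ)‖ ^ 2) ∂P ≤
      ENNReal.ofReal (2 * M * ∑ k, ∑ l, ‖A k l‖ ^ 2) := by
  have e (ω : Ω) : ‖∑ k, ∑ l, A k l * (centredProd ξ (k, l) ω : ℂ)‖ ^ 2 =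
      (∑ α : ι × ι, (A α.1 α.2).re * centredProd ξ α ω) ^ 2 +
      (∑ α : ι × ι, (A α.1 α.2).im * centredProd ξ α ω) ^ 2 := by
    rw [← Complex.normSq_eq_norm_sq, Complex.normSq_apply, ← sq, ← sq,
      Fintype.sum_prod_type, Fintype.sum_prod_type]
    simp only [Complex.re_sum, Complex.im_sum, Complex.re_mul_ofReal, Complex.im_mul_ofReal]
  have hint (a : ι × ι → ℝ) : Integrable (fun ω => (∑ α, a α * centredProd ξ α ω) ^ 2) P := by
    simp_rw [sq, Finset.sum_mul_sum]
    refine integrable_finsetSum _ fun α _ => integrable_finsetSum _ fun β _ => ?_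
    refine ((h.integrable_centredProd_mul α β).const_mul (a α * a β)).congr
      (Filter.Eventually.of_forall fun ω => ?_)
    simp only
    ring
  simp_rw [e]
  have hint2 : Integrable (fun ω => (∑ α : ι × ι, (A α.1 α.2).re * centredProd ξ α ω) ^ 2 +
      (∑ α : ι × ι, (A α.1 α.2).im * centredProd ξ α ω) ^ 2) P := (hint _).add (hint _)
  rw [← ofReal_integral_eq_lintegral_ofReal hint2
    (Filter.Eventually.of_forall fun ω => by
      simp only [Pi.zero_apply]; exact add_nonneg (sq_nonneg _) (sq_nonneg _))]
  refine ENNReal.ofReal_le_ofReal ?_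
  rw [integral_add (hint _) (hint _)]
  refine (add_le_add (h.integral_sum_sq_le _) (h.integral_sum_sq_le _)).trans_eq ?_
  rw [← mul_add, ← Finset.sum_add_distrib, Fintype.sum_prod_type]
  congr 1
  refine Finset.sum_congr rfl fun k _ => Finset.sum_congr rfl fun l _ => ?_
  rw [← Complex.normSq_eq_norm_sq, Complex.normSq_apply]
  ring

end StdIndep

end QuadraticForm

/-! ### Leave-one-out fluctuations and the mean error of the resolvent -/

section LeaveOneOut

set_option linter.unusedSectionVars false

open Matrix

variable {p n : ℕ}

theorem continuous_complexCov :
    Continuous fun Y : Fin p → Fin n → ℝ => complexCov (Matrix.of Y) := by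
  refine continuous_pi fun k => continuous_pi fun l => ?_
  simp only [complexCov_apply, Matrix.of_apply]
  fun_prop

theorem measurable_symResolvent_apply (w : ℂ) (k l : Fin p) :
    Measurable fun Y : Fin p → Fin n → ℝ => symResolvent (complexCov (Matrix.of Y)) w k l := by
  have hc : Continuous fun Y : Fin p → Fin n → ℝ =>
      complexCov (Matrix.of Y) - w ^ 2 • (1 : Matrix (Fin p) (Fin p) ℂ) :=
    continuous_complexCov.sub continuous_const
  simp only [symResolvent, Matrix.smul_apply, Matrix.inv_def, Ring.inverse_eq_inv', smul_eq_mul]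
  exact measurable_const.mul (hc.matrix_det.measurable.inv.mul
    (hc.matrix_adjugate.matrix_elem k l).measurable)

theorem measurable_trace_symResolvent (w : ℂ) :
    Measurable fun Y : Fin p → Fin n → ℝ => (symResolvent (complexCov (Matrix.of Y)) w).trace := by
  simp only [Matrix.trace, Matrix.diag]
  exact Finset.measurable_sum _ fun k _ => measurable_symResolvent_apply w k k

theorem measurable_meanResolvent (w : ℂ) :
    Measurable fun Y : Fin p → Fin n → ℝ => meanResolvent (Matrix.of Y) w :=
  measurable_const.mul (measurable_trace_symResolvent w)

theorem measurable_resolventForm (w : ℂ) :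
    Measurable fun z : (Fin p → ℝ) × (Fin p → Fin n → ℝ) =>
      resolventForm (complexCov (Matrix.of z.2)) w z.1 := by
  simp only [resolventForm, dotProduct, Matrix.mulVec]
  refine Finset.measurable_sum _ fun k _ => Measurable.mul (by fun_prop) ?_
  refine Finset.measurable_sum _ fun l _ => Measurable.mul ?_ (by fun_prop)
  exact (measurable_symResolvent_apply w k l).comp measurable_snd

/-- The normalized squared fluctuation of a quadratic form of the symmetrized resolvent. -/
noncomputable def formFluct (w : ℂ) (c : Fin p → ℝ) (Y : Fin p → Fin n → ℝ) : ℝ :=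
  ‖((1 / (n : ℝ) : ℝ) : ℂ) * resolventForm (complexCov (Matrix.of Y)) w c -
    meanResolvent (Matrix.of Y) w‖ ^ 2 / (w.im + (meanResolvent (Matrix.of Y) w).im)

theorem measurable_formFluct (w : ℂ) :
    Measurable fun z : (Fin p → ℝ) × (Fin p → Fin n → ℝ) => formFluct w z.1 z.2 := by
  have h := (measurable_meanResolvent (p := p) (n := n) w).comp
    (measurable_snd : Measurable (Prod.snd : (Fin p → ℝ) × (Fin p → Fin n → ℝ) → _))
  unfold formFluct
  exact (((measurable_const.mul (measurable_resolventForm w)).sub h).norm.pow_const 2).div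
    (measurable_const.add (Complex.measurable_im.comp h))

variable {Ω : Type*} [MeasurableSpace Ω] {P : Measure Ω} [IsProbabilityMeasure P] {M : ℝ}

/-- The variance bound produces the squared Frobenius norm of the resolvent, which the Ward
inequality controls by `n D / v`, where `D` is exactly the normalizing denominator. Hence no trace
of `Y` remains in the estimate. -/
theorem lintegral_formFluct_le {ξ : Fin p → Ω → ℝ} (h : StdIndep P ξ M) (hM : 0 ≤ M) {w : ℂ}
    (hw : 0 < w.im) (hn : n ≠ 0) (Y : Fin p → Fin n → ℝ) :
    ∫⁻ ω, ENNReal.ofReal (formFluct w (fun i => ξ i ω) Y) ∂P ≤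
      ENNReal.ofReal (2 * M / (n * w.im)) := by
  set A := complexCov (Matrix.of Y) with hA
  set B := symResolvent A w with hB
  set D := w.im + (meanResolvent (Matrix.of Y) w).im with hD
  have hn' : (0 : ℝ) < n := by exact_mod_cast Nat.pos_of_ne_zero hn
  have hD0 : 0 < D := by
    have := meanResolvent_im_nonneg (Matrix.of Y) hw
    linarith
  have e (ω : Ω) : formFluct w (fun i => ξ i ω) Y = (1 / ((n : ℝ) ^ 2 * D)) *
      ‖∑ k, ∑ l, B k l * (centredProd ξ (k, l) ω : ℂ)‖ ^ 2 := by
    have e1 : ((1 / (n : ℝ) : ℝ) : ℂ) * resolventForm A w (fun i => ξ i ω) -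
        meanResolvent (Matrix.of Y) w =
        (1 / (n : ℂ)) * ∑ k, ∑ l, B k l * (centredProd ξ (k, l) ω : ℂ) := by
      rw [meanResolvent, ← hA, ← hB, resolventForm, ← hB]
      push_cast
      rw [← mul_sub]
      congr 1
      simp only [dotProduct, Matrix.mulVec, Matrix.trace, Matrix.diag, centredProd]
      rw [← Finset.sum_sub_distrib]
      refine Finset.sum_congr rfl fun k _ => ?_
      have : B k k = ∑ l, if k = l then B k l else 0 := by simp
      rw [this, Finset.mul_sum, ← Finset.sum_sub_distrib]
      refine Finset.sum_congr rfl fun l _ => ?_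
      split_ifs <;> push_cast <;> ring
    rw [formFluct, e1, norm_mul, mul_pow]
    have : ‖(1 / (n : ℂ))‖ = 1 / n := by simp
    rw [this, ← hD]
    field_simp
  simp_rw [e]
  have hc : 0 ≤ 1 / ((n : ℝ) ^ 2 * D) := by positivity
  simp_rw [ENNReal.ofReal_mul hc]
  rw [lintegral_const_mul' _ _ ENNReal.ofReal_ne_top]
  refine (mul_le_mul_right (h.lintegral_norm_sum_sq_le B) _).trans ?_
  rw [← ENNReal.ofReal_mul hc]
  refine ENNReal.ofReal_le_ofReal ?_
  have h1 : w.im * ∑ k, ∑ l, ‖B k l‖ ^ 2 ≤ n * D := by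
    refine (im_mul_sum_norm_sq_symResolvent_le (complexCov_posSemidef (Matrix.of Y)) hw).trans ?_
    have : (symResolvent (complexCov (Matrix.of Y)) w).trace =
        ((n : ℝ) : ℂ) * meanResolvent (Matrix.of Y) w := by
      rw [meanResolvent]
      have : (n : ℂ) ≠ 0 := by exact_mod_cast hn
      push_cast
      field_simp
    rw [this, Complex.im_ofReal_mul]
    gcongr
    linarith
  rw [div_mul_eq_mul_div, one_mul, div_le_div_iff₀ (by positivity) (by positivity)]
  have := mul_le_mul_of_nonneg_left h1 (by positivity : 0 ≤ 2 * M * n)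
  nlinarith

/-- The column `j` of a random matrix. -/
def colVec (X : Fin p → Fin n → Ω → ℝ) (j : Fin n) (ω : Ω) : Fin p → ℝ := fun i => X i j ω

/-- A random matrix with its column `j` replaced by zero. -/
def zeroedCol (X : Fin p → Fin n → Ω → ℝ) (j : Fin n) (ω : Ω) : Fin p → Fin n → ℝ :=
  fun i k => if k = j then 0 else X i k ω

/-- Conditioning on `Y` in the form of Tonelli for the product law: a bound valid for each frozen
value survives averaging. -/
theorem lintegral_le_of_indepFun {α β : Type*} [MeasurableSpace α] [MeasurableSpace β]
    {u : Ω → α} {Y : Ω → β} (hu : Measurable u) (hY : Measurable Y) (hind : IndepFun u Y P)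
    {F : α × β → ℝ≥0∞} (hF : Measurable F) {K : ℝ≥0∞}
    (hK : ∀ r, ∫⁻ ω, F (u ω, r) ∂P ≤ K) : ∫⁻ ω, F (u ω, Y ω) ∂P ≤ K := by
  have : IsProbabilityMeasure (P.map Y) := Measure.isProbabilityMeasure_map hY.aemeasurable
  rw [← lintegral_map hF (hu.prodMk hY),
    (indepFun_iff_map_prod_eq_prod_map_map hu.aemeasurable hY.aemeasurable).1 hind,
    lintegral_prod_symm _ hF.aemeasurable]
  refine (lintegral_mono fun r => ?_).trans_eq
    ((lintegral_const _).trans (by rw [measure_univ, mul_one]))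
  exact (lintegral_map (hF.comp measurable_prodMk_right) hu).trans_le (hK r)

theorem stdIndep_col {X : Fin p → Fin n → Ω → ℝ}
    (h : StdIndep P (fun ij : Fin p × Fin n => X ij.1 ij.2) M) (j : Fin n) :
    StdIndep P (fun i => X i j) M where
  meas i := h.meas (i, j)
  indep := h.indep.precomp (g := fun i : Fin p => (i, j)) fun _ _ hab => (Prod.ext_iff.1 hab).1
  mean i := h.mean (i, j)
  var i := h.var (i, j)
  int4 i := h.int4 (i, j)
  le4 i := h.le4 (i, j)

theorem indepFun_col_updateCol {X : Fin p → Fin n → Ω → ℝ}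
    (h : StdIndep P (fun ij : Fin p × Fin n => X ij.1 ij.2) M) (j : Fin n) :
    IndepFun (colVec X j) (zeroedCol X j) P := by
  classical
  have hST : Disjoint (Finset.univ.filter fun ij : Fin p × Fin n => ij.2 = j)
      (Finset.univ.filter fun ij : Fin p × Fin n => ij.2 ≠ j) := by
    rw [Finset.disjoint_filter]; simp
  have hind := h.indep.indepFun_finset _ _ hST h.meas
  have hφ : Measurable fun (z : {ij // ij ∈ Finset.univ.filter
      fun ij : Fin p × Fin n => ij.2 = j} → ℝ) (i : Fin p) => z ⟨(i, j), by simp⟩ := by fun_prop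
  have hψ : Measurable fun (z : {ij // ij ∈ Finset.univ.filter
      fun ij : Fin p × Fin n => ij.2 ≠ j} → ℝ) (i : Fin p) (k : Fin n) =>
      if hk : k = j then 0 else z ⟨(i, k), by simp [hk]⟩ := by
    refine measurable_pi_lambda _ fun i => measurable_pi_lambda _ fun k => ?_
    by_cases hk : k = j
    · simp only [hk, dif_pos]; exact measurable_const
    · simp only [hk, dif_neg, not_false_eq_true]; fun_prop
  have := hind.comp hφ hψ
  have e : zeroedCol X j = (fun (z : {ij // ij ∈ Finset.univ.filter
      fun ij : Fin p × Fin n => ij.2 ≠ j} → ℝ) (i : Fin p) (k : Fin n) =>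
      if hk : k = j then 0 else z ⟨(i, k), by simp [hk]⟩) ∘ fun ω ij => X ij.1.1 ij.1.2 ω := by
    funext ω i k
    simp only [Function.comp_apply, dite_eq_ite, zeroedCol]
  rw [e]
  exact this

theorem measurable_colVec {X : Fin p → Fin n → Ω → ℝ}
    (h : StdIndep P (fun ij : Fin p × Fin n => X ij.1 ij.2) M) (j : Fin n) :
    Measurable (colVec X j) :=
  measurable_pi_lambda _ fun i => h.meas (i, j)

theorem measurable_zeroedCol {X : Fin p → Fin n → Ω → ℝ}
    (h : StdIndep P (fun ij : Fin p × Fin n => X ij.1 ij.2) M) (j : Fin n) :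
    Measurable (zeroedCol X j) := by
  refine measurable_pi_lambda _ fun i => measurable_pi_lambda _ fun k => ?_
  unfold zeroedCol
  split_ifs
  · exact measurable_const
  · exact h.meas (i, k)

theorem lintegral_formFluct_updateCol_le {X : Fin p → Fin n → Ω → ℝ}
    (h : StdIndep P (fun ij : Fin p × Fin n => X ij.1 ij.2) M) (hM : 0 ≤ M) {w : ℂ}
    (hw : 0 < w.im) (j : Fin n) :
    ∫⁻ ω, ENNReal.ofReal (formFluct w (colVec X j ω) (zeroedCol X j ω)) ∂P ≤
      ENNReal.ofReal (2 * M / (n * w.im)) := by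
  have hn : n ≠ 0 := by have := j.isLt; omega
  exact lintegral_le_of_indepFun (measurable_colVec (X := X) h j) (measurable_zeroedCol (X := X) h j)
    (indepFun_col_updateCol (X := X) h j) (F := fun z => ENNReal.ofReal (formFluct w z.1 z.2))
    (measurable_formFluct w).ennreal_ofReal
    fun r => lintegral_formFluct_le (stdIndep_col (X := X) h j) hM hw hn r

theorem formFluct_nonneg {w : ℂ} (hw : 0 < w.im) (c : Fin p → ℝ) (Y : Fin p → Fin n → ℝ) :
    0 ≤ formFluct w c Y :=
  div_nonneg (sq_nonneg _) (add_nonneg hw.le (meanResolvent_im_nonneg _ hw))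

theorem approxSolution (X : Matrix (Fin p) (Fin n) ℝ) {w g : ℂ} (hw : 0 < w.im) (hn : n ≠ 0)
    (hpn : (p : ℝ) / n ≤ 1) (hg : (g - (1 - (p : ℂ) / n) / w) * (w + g) = -1) (hg0 : 0 ≤ g.im) :
    ApproxSolution w ((1 - (p : ℂ) / n) / w) (meanResolvent X w) g (leaveOneOut X w) where
  n_ne := hn
  w_im := hw
  r_im := im_le_im_leaveOneOut X hw
  avg := meanResolvent_sub_eq X hw hn
  exact_eq := hg
  g_im := hg0
  γ_im := meanResolvent_im_nonneg X hw
  β_im := by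
    have : (1 - (p : ℂ) / n) / w = ((1 - (p : ℝ) / n : ℝ) : ℂ) * w⁻¹ := by
      push_cast; rw [div_eq_mul_inv]
    rw [this, Complex.im_ofReal_mul, Complex.inv_im]
    refine mul_nonpos_of_nonneg_of_nonpos (by linarith) ?_
    exact div_nonpos_of_nonpos_of_nonneg (by linarith) (Complex.normSq_nonneg _)

/-- A random majorant of the normalized mean square error. -/
noncomputable def errBound (X : Fin p → Fin n → Ω → ℝ) (w : ℂ) (ω : Ω) : ℝ :=
  2 / (n * w.im) + (4 / (n : ℝ)) * ∑ j, formFluct w (colVec X j ω) (zeroedCol X j ω)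

theorem sqErr_le_errBound (X : Fin p → Fin n → Ω → ℝ) {w g : ℂ} (hw : 0 < w.im) (hn : n ≠ 0)
    (hpn : (p : ℝ) / n ≤ 1) (hg : (g - (1 - (p : ℂ) / n) / w) * (w + g) = -1) (hg0 : 0 ≤ g.im)
    (hnv : 1 ≤ n * w.im ^ 2) (ω : Ω) :
    ApproxSolution.sqErr w ((1 - (p : ℂ) / n) / w)
      (meanResolvent (Matrix.of fun i j => X i j ω) w) g
      (leaveOneOut (Matrix.of fun i j => X i j ω) w) ≤ errBound X w ω := by
  set Y : Matrix (Fin p) (Fin n) ℝ := Matrix.of fun i j => X i j ω with hY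
  refine ((approxSolution Y hw hn hpn hg hg0).sqErr_le
    (norm_meanResolvent_sub_le Y hw) (fun j => meanResolvent_im_nonneg _ hw) hnv).trans_eq ?_
  rw [errBound]
  congr 2
  refine Finset.sum_congr rfl fun j _ => ?_
  have : Y.updateCol j 0 = Matrix.of (zeroedCol X j ω) := by
    ext i k
    simp [Matrix.updateCol_apply, hY, zeroedCol]
  rw [leaveOneOut, this, formFluct, sub_sub, add_sub_add_left_eq_sub]
  rfl

theorem integrable_formFluct {X : Fin p → Fin n → Ω → ℝ}
    (h : StdIndep P (fun ij : Fin p × Fin n => X ij.1 ij.2) M) (hM : 0 ≤ M) {w : ℂ}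
    (hw : 0 < w.im) (j : Fin n) :
    Integrable (fun ω => formFluct w (colVec X j ω) (zeroedCol X j ω)) P ∧
    ∫ ω, formFluct w (colVec X j ω) (zeroedCol X j ω) ∂P ≤
      2 * M / (n * w.im) := by
  have hm : Measurable fun ω => formFluct w (colVec X j ω) (zeroedCol X j ω) := by
    have hu := (measurable_colVec (X := X) h j).prodMk (measurable_zeroedCol (X := X) h j)
    have := Measurable.comp (g := fun z : (Fin p → ℝ) × (Fin p → Fin n → ℝ) =>
      formFluct w z.1 z.2) (measurable_formFluct w) hu
    simpa only [Function.comp_def] using this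
  have hnn : 0 ≤ᵐ[P] fun ω => formFluct w (colVec X j ω) (zeroedCol X j ω) :=
    Filter.Eventually.of_forall fun ω => formFluct_nonneg hw _ _
  have hle := lintegral_formFluct_updateCol_le (X := X) h hM hw j
  refine ⟨⟨hm.aestronglyMeasurable, ?_⟩, ?_⟩
  · rw [hasFiniteIntegral_iff_ofReal hnn]
    exact hle.trans_lt ENNReal.ofReal_lt_top
  · rw [integral_eq_lintegral_of_nonneg_ae hnn hm.aestronglyMeasurable]
    exact ENNReal.toReal_le_of_le_ofReal (by positivity) hle

theorem integrable_errBound {X : Fin p → Fin n → Ω → ℝ}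
    (h : StdIndep P (fun ij : Fin p × Fin n => X ij.1 ij.2) M) (hM : 1 ≤ M) {w : ℂ}
    (hw : 0 < w.im) (hn : n ≠ 0) :
    Integrable (errBound X w) P ∧ ∫ ω, errBound X w ω ∂P ≤ 10 * M / (n * w.im) := by
  have hM0 : 0 ≤ M := zero_le_one.trans hM
  have hi (j : Fin n) := integrable_formFluct (X := X) h hM0 hw j
  have hn' : (0 : ℝ) < n := by exact_mod_cast Nat.pos_of_ne_zero hn
  have hs := integrable_finsetSum Finset.univ fun j _ => (hi j).1
  refine ⟨(integrable_const _).add (hs.const_mul _), ?_⟩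
  unfold errBound
  rw [integral_add (integrable_const _) (hs.const_mul _), integral_const_mul,
    integral_finsetSum _ fun j _ => (hi j).1]
  have h1 : ∑ j, ∫ ω, formFluct w (colVec X j ω) (zeroedCol X j ω) ∂P ≤
      ∑ _j : Fin n, 2 * M / (n * w.im) :=
    Finset.sum_le_sum fun j _ => (hi j).2
  simp only [Finset.sum_const, Finset.card_univ, Fintype.card_fin, nsmul_eq_mul] at h1
  simp only [integral_const, probReal_univ, smul_eq_mul, one_mul]
  -- The constant `10` is `2 + 8`: the removal of a column contributes `2`, the fluctuations `8 M`,
  -- and `M ≥ 1` merges them.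
  calc _ ≤ 2 / (n * w.im) + 4 / (n : ℝ) * (n * (2 * M / (n * w.im))) := by gcongr
    _ = (2 + 8 * M) / (n * w.im) := by field_simp; ring
    _ ≤ _ := by gcongr; linarith

/-- The stability bounds hold pointwise with the same deterministic `D` and `t`, so they can be
integrated; only the mean of the error majorant enters. -/
theorem integral_norm_meanResolvent_sub_le {X : Fin p → Fin n → Ω → ℝ}
    (h : StdIndep P (fun ij : Fin p × Fin n => X ij.1 ij.2) M) (hM : 1 ≤ M) {w g : ℂ}
    (hw : 0 < w.im) (hn : n ≠ 0)
    (hpn : (p : ℝ) / n ≤ 1) (hg : (g - (1 - (p : ℂ) / n) / w) * (w + g) = -1) (hg0 : 0 ≤ g.im)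
    (hnv : 1 ≤ n * w.im ^ 2) {D : ℝ} (hD : 0 < D)
    (hDle : D ≤ w.im + g.im - ((1 - (p : ℂ) / n) / w).im) :
    (∫ ω, ‖meanResolvent (Matrix.of fun i j => X i j ω) w - g‖ ∂P ≤
      (2 / w.im) * √(10 * M / (n * w.im) / D)) ∧
    ∀ c : ℝ, 0 < c → c ≤ ‖w + g‖ →
      ∫ ω, ‖meanResolvent (Matrix.of fun i j => X i j ω) w - g‖ ∂P ≤
        (4 / c) * (2 * √(10 * M / (n * w.im) / D) + 10 * M / (n * w.im) / w.im) := by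
  have hn' : (0 : ℝ) < n := by exact_mod_cast Nat.pos_of_ne_zero hn
  have hM0 : 0 < M := zero_lt_one.trans_le hM
  obtain ⟨hi, hle⟩ := integrable_errBound (X := X) h hM hw hn
  set κ := 10 * M / (n * w.im) with hκ
  have hκ0 : 0 < κ := by positivity
  -- This choice balances the two terms of Young's inequality: `t κ = 1/(t D) = √(κ/D)`.
  set t := 1 / √(κ * D) with ht
  have ht0 : 0 < t := by positivity
  have hsq : √(κ * D) ^ 2 = κ * D := Real.sq_sqrt (by positivity)
  have hs0 : 0 < √(κ * D) := by positivity
  have e1 : √(κ / D) = √(κ * D) / D := by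
    rw [← Real.sqrt_sq hD.le, ← Real.sqrt_div (by positivity), Real.sqrt_sq hD.le]
    congr 1
    field_simp
  have e2 : t * κ = √(κ / D) := by
    rw [e1, ht]; field_simp; rw [hsq]
  have e3 : 1 / (t * D) = √(κ / D) := by
    rw [e1, ht]; field_simp
  have hle' : t * ∫ ω, errBound X w ω ∂P ≤ √(κ / D) := by rw [← e2]; gcongr
  have happ (ω : Ω) := approxSolution (Matrix.of fun i j => X i j ω) hw hn hpn hg hg0
  have hsq (ω : Ω) := sqErr_le_errBound X hw hn hpn hg hg0 hnv ω
  constructor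
  · have hpt (ω : Ω) : ‖meanResolvent (Matrix.of fun i j => X i j ω) w - g‖ ≤
        (1 / w.im) * (t * errBound X w ω + 1 / (t * D)) := by
      refine ((happ ω).norm_sub_le_far ht0 hD hDle).trans ?_
      gcongr
      exact hsq ω
    refine (integral_mono_of_nonneg (Filter.Eventually.of_forall fun ω => norm_nonneg _)
      (((hi.const_mul t).add (integrable_const _)).const_mul _)
      (Filter.Eventually.of_forall hpt)).trans ?_
    simp only [Pi.add_apply]
    rw [integral_const_mul, integral_add (hi.const_mul t) (integrable_const _),
      integral_const_mul]
    simp only [integral_const, probReal_univ, smul_eq_mul, one_mul]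
    rw [e3]
    calc _ ≤ (1 / w.im) * (√(κ / D) + √(κ / D)) := by gcongr
      _ = _ := by ring
  · intro c hc hcg
    have hpt (ω : Ω) : ‖meanResolvent (Matrix.of fun i j => X i j ω) w - g‖ ≤
        (4 / c) * (t * errBound X w ω + 1 / (t * D) + (1 / w.im) * errBound X w ω) := by
      refine ((happ ω).norm_sub_le_near ht0 hD hDle hc hcg).trans ?_
      rw [div_eq_mul_one_div _ w.im, mul_comm _ (1 / w.im)]
      gcongr
      · exact hsq ω
      · exact hsq ω
    refine (integral_mono_of_nonneg (Filter.Eventually.of_forall fun ω => norm_nonneg _)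
      ((((hi.const_mul t).add (integrable_const _)).add (hi.const_mul _)).const_mul _)
      (Filter.Eventually.of_forall hpt)).trans ?_
    have hi1 : Integrable (fun ω => t * errBound X w ω + 1 / (t * D)) P :=
      (hi.const_mul t).add (integrable_const _)
    simp only [Pi.add_apply]
    rw [integral_const_mul, integral_add hi1 (hi.const_mul _),
      integral_add (hi.const_mul t) (integrable_const _),
      integral_const_mul, integral_const_mul]
    simp only [integral_const, probReal_univ, smul_eq_mul, one_mul]
    rw [e3]
    have : 1 / w.im * ∫ ω, errBound X w ω ∂P ≤ κ / w.im := by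
      rw [one_div_mul_eq_div]; gcongr
    calc _ ≤ (4 / c) * (√(κ / D) + √(κ / D) + κ / w.im) := by gcongr
      _ = _ := by ring

end LeaveOneOut

/-! ### Measurability of eigenvalues and the expected spectral measure -/

section EigenvalueMeasurability

set_option linter.unusedSectionVars false

open Matrix Filter Topology

variable {p n : ℕ}

/-- The eigenvalues of the sample covariance matrix as functions of the entries. -/
noncomputable def covEigenvalue (k : Fin p) (Y : Fin p → Fin n → ℝ) : ℝ :=
  (sampleCov_isHermitian (Matrix.of Y)).eigenvalues k

theorem covEigenvalue_nonneg (k : Fin p) (Y : Fin p → Fin n → ℝ) : 0 ≤ covEigenvalue k Y := by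
  have h : (sampleCov (Matrix.of Y)).PosSemidef := by
    have : sampleCov (Matrix.of Y) = (1 / (n : ℝ)) • (Matrix.of Y * (Matrix.of Y)ᴴ) := by
      rw [sampleCov, Matrix.conjTranspose_eq_transpose_of_trivial]
    rw [this]
    exact (Matrix.posSemidef_self_mul_conjTranspose _).smul (by positivity)
  exact h.eigenvalues_nonneg k

/-- Power sums are polynomial in the matrix entries, although individual eigenvalues are not;
measurability is bootstrapped from here. -/
theorem sum_covEigenvalue_pow (m : ℕ) (Y : Fin p → Fin n → ℝ) :
    ∑ k, covEigenvalue k Y ^ m = (sampleCov (Matrix.of Y) ^ m).trace := by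
  set hH := sampleCov_isHermitian (Matrix.of Y)
  set U : Matrix (Fin p) (Fin p) ℝ := (hH.eigenvectorUnitary : Matrix (Fin p) (Fin p) ℝ) with hU
  have hUU : star U * U = 1 := Unitary.coe_star_mul_self hH.eigenvectorUnitary
  have hUU' : U * star U = 1 := Unitary.coe_mul_star_self hH.eigenvectorUnitary
  have hspec : sampleCov (Matrix.of Y) = U * Matrix.diagonal hH.eigenvalues * star U := by
    have := hH.spectral_theorem
    rw [Unitary.conjStarAlgAut_apply] at this
    simpa using this
  have hpow (m : ℕ) : sampleCov (Matrix.of Y) ^ m =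
      U * Matrix.diagonal (fun k => hH.eigenvalues k ^ m) * star U := by
    induction m with
    | zero => simp [hUU']
    | succ m ih =>
      rw [pow_succ, ih]
      nth_rewrite 2 [hspec]
      calc _ = U * (Matrix.diagonal (fun k => hH.eigenvalues k ^ m) * (star U * U) *
            Matrix.diagonal hH.eigenvalues) * star U := by simp only [Matrix.mul_assoc]
        _ = _ := by rw [hUU, Matrix.mul_one, Matrix.diagonal_mul_diagonal]; simp only [pow_succ]
  rw [hpow, Matrix.trace_mul_comm, ← Matrix.mul_assoc, hUU, Matrix.one_mul, Matrix.trace_diagonal]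
  rfl

/-- A linear statistic of the eigenvalues. -/
noncomputable def linStat (f : ℝ → ℝ) (Y : Fin p → Fin n → ℝ) : ℝ :=
  ∑ k, f (covEigenvalue k Y)

theorem measurable_linStat_polynomial (q : Polynomial ℝ) :
    Measurable (linStat (p := p) (n := n) fun x => q.eval x) := by
  have h : (linStat (p := p) (n := n) fun x => q.eval x) = fun Y =>
      ∑ i ∈ Finset.range (q.natDegree + 1), q.coeff i * (sampleCov (Matrix.of Y) ^ i).trace := by
    funext Y
    simp only [linStat, Polynomial.eval_eq_sum_range]
    rw [Finset.sum_comm]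
    simp only [← Finset.mul_sum, sum_covEigenvalue_pow]
  rw [h]
  have hc : Continuous fun Y : Fin p → Fin n → ℝ => sampleCov (Matrix.of Y) := by
    refine continuous_pi fun k => continuous_pi fun l => ?_
    simp only [sampleCov, Matrix.smul_apply, Matrix.mul_apply, Matrix.of_apply,
      Matrix.transpose_apply]
    fun_prop
  exact Finset.measurable_sum _ fun i _ =>
    measurable_const.mul (hc.pow i).matrix_trace.measurable

theorem measurable_linStat_of_tendsto {F : ℕ → ℝ → ℝ} {f : ℝ → ℝ}
    (hF : ∀ m, Measurable (linStat (p := p) (n := n) (F m)))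
    (h : ∀ x, Tendsto (fun m => F m x) atTop (𝓝 (f x))) :
    Measurable (linStat (p := p) (n := n) f) :=
  measurable_of_tendsto_metrizable hF
    (tendsto_pi_nhds.2 fun _ => tendsto_finsetSum _ fun _ _ => h _)

/-- Weierstrass approximation on `[-m, m]` with error `1/(m + 1)` gives pointwise convergence on the
whole line. -/
theorem measurable_linStat_of_continuous {f : ℝ → ℝ} (hf : Continuous f) :
    Measurable (linStat (p := p) (n := n) f) := by
  have h (m : ℕ) := exists_polynomial_near_of_continuousOn (-m) m f hf.continuousOn
    (1 / ((m : ℝ) + 1)) (by positivity)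
  choose q hq using h
  refine measurable_linStat_of_tendsto (fun m => measurable_linStat_polynomial (q m)) fun x => ?_
  rw [tendsto_iff_norm_sub_tendsto_zero]
  obtain ⟨m₀, hm₀⟩ := exists_nat_ge |x|
  refine squeeze_zero' (Eventually.of_forall fun _ => norm_nonneg _) ?_
    (tendsto_one_div_add_atTop_nhds_zero_nat (𝕜 := ℝ))
  filter_upwards [eventually_ge_atTop m₀] with m hm
  have : |x| ≤ m := hm₀.trans (by exact_mod_cast hm)
  exact (hq m x (abs_le.1 this)).le

theorem measurable_linStat_indicator (t : ℝ) :
    Measurable (linStat (p := p) (n := n) fun x => if x ≤ t then 1 else 0) := by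
  refine measurable_linStat_of_tendsto (F := fun m x => max 0 (1 - (m : ℝ) * max 0 (x - t)))
    (fun m => measurable_linStat_of_continuous (by fun_prop)) fun x => ?_
  split_ifs with h
  · simp [max_eq_left (sub_nonpos.2 h)]
  · push Not at h
    obtain ⟨m₀, hm₀⟩ := exists_nat_ge (1 / (x - t))
    refine tendsto_const_nhds.congr' ?_
    filter_upwards [eventually_ge_atTop m₀] with m hm
    have h1 : 1 / (x - t) ≤ m := hm₀.trans (by exact_mod_cast hm)
    have h2 : 0 < x - t := sub_pos.2 h
    rw [div_le_iff₀ h2] at h1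
    rw [max_eq_right h2.le, max_eq_left (by linarith)]

/-- The eigenvalues are listed in decreasing order, so the one at position `i` is at most `t`
exactly when at least as many eigenvalues are at most `t` as there are positions from `i` on. The
counting function is a measurable linear statistic. -/
theorem measurable_covEigenvalue (k : Fin p) : Measurable (covEigenvalue (n := n) k) := by
  refine measurable_of_Iic fun t => ?_
  set e : Fin (Fintype.card (Fin p)) ≃ Fin p := Fintype.equivOfCardEq (Fintype.card_fin _) with he
  set i := e.symm k with hi
  have hset : covEigenvalue (n := n) k ⁻¹' Set.Iic t =
      {Y | ((Finset.Ici i).card : ℝ) ≤ linStat (fun x => if x ≤ t then 1 else 0) Y} := by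
    ext Y
    set μ := (sampleCov_isHermitian (Matrix.of Y)).eigenvalues₀ with hμ
    have hanti : Antitone μ := (sampleCov_isHermitian (Matrix.of Y)).eigenvalues₀_antitone
    have hcount : linStat (fun x => if x ≤ t then 1 else 0) Y =
        ((Finset.univ.filter fun j => μ j ≤ t).card : ℝ) := by
      rw [linStat, ← e.sum_comp, ← Finset.sum_boole]
      refine Finset.sum_congr rfl fun j _ => ?_
      have : covEigenvalue (e j) Y = μ j := by
        rw [covEigenvalue, Matrix.IsHermitian.eigenvalues, ← hμ, ← he, Equiv.symm_apply_apply]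
      rw [this]
    have hk : covEigenvalue k Y = μ i := rfl
    rw [Set.mem_preimage, Set.mem_Iic, hk, Set.mem_ofPred_eq, hcount, Nat.cast_le]
    constructor
    · intro h
      refine Finset.card_le_card fun j hj => ?_
      rw [Finset.mem_Ici] at hj
      simpa using (hanti hj).trans h
    · intro h
      by_contra hc
      push Not at hc
      have : (Finset.univ.filter fun j => μ j ≤ t) ⊂ Finset.Ici i := by
        rw [Finset.ssubset_iff_of_subset]
        · exact ⟨i, by simp, by simpa using hc⟩
        · intro j hj
          rw [Finset.mem_Ici]
          by_contra hji
          push Not at hji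
          have h1 := hanti hji.le
          have h2 : μ j ≤ t := by simpa using hj
          linarith
      exact absurd (Finset.card_lt_card this) (not_lt.2 h)
  rw [hset]
  exact measurableSet_le measurable_const (measurable_linStat_indicator t)

variable {Ω : Type*} [MeasurableSpace Ω]

/-- The expected empirical spectral measure of a random sample covariance matrix. -/
noncomputable def expectedSpectralMeasure (P : Measure Ω) (X : Fin p → Fin n → Ω → ℝ) :
    Measure ℝ :=
  (p : ℝ≥0∞)⁻¹ • ∑ k, P.map fun ω => covEigenvalue k fun i j => X i j ω

variable {P : Measure Ω} [IsProbabilityMeasure P] {X : Fin p → Fin n → Ω → ℝ}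

theorem measurable_covEigenvalue_comp (hX : ∀ i j, Measurable (X i j)) (k : Fin p) :
    Measurable fun ω => covEigenvalue k fun i j => X i j ω :=
  (measurable_covEigenvalue k).comp
    (measurable_pi_lambda _ fun i => measurable_pi_lambda _ fun j => hX i j)

theorem isProbabilityMeasure_expectedSpectralMeasure (hX : ∀ i j, Measurable (X i j))
    (hp : p ≠ 0) : IsProbabilityMeasure (expectedSpectralMeasure P X) := by
  constructor
  rw [expectedSpectralMeasure, Measure.smul_apply, Measure.finsetSum_apply]
  have (k : Fin p) : (P.map fun ω => covEigenvalue k fun i j => X i j ω) Set.univ = 1 := by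
    have := Measure.isProbabilityMeasure_map (μ := P)
      (measurable_covEigenvalue_comp hX k).aemeasurable
    exact measure_univ
  simp only [this, Finset.sum_const, Finset.card_univ, Fintype.card_fin, nsmul_eq_mul, mul_one,
    smul_eq_mul]
  exact ENNReal.inv_mul_cancel (by exact_mod_cast hp) (ENNReal.natCast_ne_top p)

theorem expectedSpectralMeasure_Iio_zero (hX : ∀ i j, Measurable (X i j)) :
    expectedSpectralMeasure P X (Set.Iio 0) = 0 := by
  rw [expectedSpectralMeasure, Measure.smul_apply, Measure.finsetSum_apply]
  have (k : Fin p) : (P.map fun ω => covEigenvalue k fun i j => X i j ω) (Set.Iio 0) = 0 := by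
    rw [Measure.map_apply (measurable_covEigenvalue_comp hX k) measurableSet_Iio]
    convert measure_empty (μ := P)
    ext ω
    simpa using covEigenvalue_nonneg k fun i j => X i j ω
  simp [this]

theorem integral_expectedSpectralMeasure (hX : ∀ i j, Measurable (X i j)) {f : ℝ → ℂ}
    (hf : Measurable f) {K : ℝ} (hK : ∀ x, 0 ≤ x → ‖f x‖ ≤ K) :
    ∫ x, f x ∂(expectedSpectralMeasure P X) =
      (1 / (p : ℂ)) * ∫ ω, ∑ k, f (covEigenvalue k fun i j => X i j ω) ∂P := by
  have hi (k : Fin p) : Integrable (fun ω => f (covEigenvalue k fun i j => X i j ω)) P :=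
    Integrable.of_bound (hf.comp (measurable_covEigenvalue_comp hX k)).aestronglyMeasurable K
      (Eventually.of_forall fun ω => hK _ (covEigenvalue_nonneg _ _))
  rw [expectedSpectralMeasure, integral_smul_measure, integral_finsetSum_measure,
    integral_finsetSum _ fun k _ => hi k]
  · have : ((p : ℝ≥0∞)⁻¹).toReal = (p : ℝ)⁻¹ := by simp
    rw [this, Complex.real_smul]
    push_cast
    rw [one_div]
    congr 1
    refine Finset.sum_congr rfl fun k _ => ?_
    exact integral_map (measurable_covEigenvalue_comp hX k).aemeasurable hf.aestronglyMeasurable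
  · intro k _
    rw [integrable_map_measure hf.aestronglyMeasurable
      (measurable_covEigenvalue_comp hX k).aemeasurable]
    exact hi k

theorem expectedSpectralCDF_eq (hX : ∀ i j, Measurable (X i j)) (t : ℝ) :
    expectedSpectralCDF P X t = (expectedSpectralMeasure P X).real (Set.Iic t) := by
  have h1 (k : Fin p) : ∫ ω, (if (covEigenvalue k fun i j => X i j ω) ≤ t then (1 : ℝ) else 0) ∂P =
      (P.map fun ω => covEigenvalue k fun i j => X i j ω).real (Set.Iic t) := by
    rw [map_measureReal_apply (measurable_covEigenvalue_comp hX k) measurableSet_Iic,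
      ← integral_indicator_one ((measurable_covEigenvalue_comp hX k) measurableSet_Iic)]
    rfl
  have h2 (k : Fin p) : Integrable
      (fun ω => if (covEigenvalue k fun i j => X i j ω) ≤ t then (1 : ℝ) else 0) P := by
    refine Integrable.of_bound (Measurable.ite ((measurable_covEigenvalue_comp hX k)
      measurableSet_Iic) measurable_const measurable_const).aestronglyMeasurable 1
      (Eventually.of_forall fun ω => ?_)
    split_ifs <;> simp
  have h3 : expectedSpectralCDF P X t = ∫ ω, (1 / (p : ℝ)) *
      ∑ k, (if (covEigenvalue k fun i j => X i j ω) ≤ t then (1 : ℝ) else 0) ∂P := rfl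
  rw [h3, integral_const_mul, integral_finsetSum _ fun k _ => h2 k]
  simp only [h1]
  have (k : Fin p) := Measure.isProbabilityMeasure_map (μ := P)
      (measurable_covEigenvalue_comp hX k).aemeasurable
  rw [expectedSpectralMeasure, measureReal_ennreal_smul_apply, measureReal_def,
    Measure.finsetSum_apply, ENNReal.toReal_sum fun k _ => measure_ne_top _ _]
  simp [measureReal_def]

end EigenvalueMeasurability

/-! ### Smoothing by the Cauchy kernel and its link to Stieltjes transforms -/

section CauchySmoothing

open Filter Topology

/-- The density of the standard Cauchy law. -/
noncomputable def cauchyDensity (r : ℝ) : ℝ := Real.pi⁻¹ * (1 + r ^ 2)⁻¹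

theorem cauchyDensity_nonneg (r : ℝ) : 0 ≤ cauchyDensity r := by
  unfold cauchyDensity; positivity

theorem integrable_cauchyDensity : Integrable cauchyDensity :=
  integrable_inv_one_add_sq.const_mul _

theorem integral_cauchyDensity : ∫ r, cauchyDensity r = 1 := by
  unfold cauchyDensity
  rw [integral_const_mul, integral_univ_inv_one_add_sq, inv_mul_cancel₀ Real.pi_ne_zero]

/-- The half width of the symmetric interval of standard Cauchy mass `3 / 4`. -/
noncomputable def cauchyWidth : ℝ := Real.tan (3 * Real.pi / 8)

theorem arctan_cauchyWidth : Real.arctan cauchyWidth = 3 * Real.pi / 8 := by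
  have := Real.pi_pos
  exact Real.arctan_tan (by linarith) (by linarith)

theorem cauchyWidth_pos : 0 < cauchyWidth := by
  have := Real.pi_pos
  exact Real.tan_pos_of_pos_of_lt_pi_div_two (by positivity) (by linarith)

theorem integral_cauchyDensity_Icc :
    ∫ r in Set.Icc (-cauchyWidth) cauchyWidth, cauchyDensity r = 3 / 4 := by
  rw [integral_Icc_eq_integral_Ioc, ← intervalIntegral.integral_of_le
    (by linarith [cauchyWidth_pos])]
  unfold cauchyDensity
  rw [intervalIntegral.integral_const_mul, integral_inv_one_add_sq, Real.arctan_neg,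
    arctan_cauchyWidth]
  have := Real.pi_ne_zero
  field_simp
  norm_num

theorem integrable_mul_cauchyDensity {f : ℝ → ℝ} (hf : Measurable f) {δ : ℝ}
    (hb : ∀ r, |f r| ≤ δ) : Integrable fun r => f r * cauchyDensity r :=
  integrable_cauchyDensity.bdd_mul hf.aestronglyMeasurable (Eventually.of_forall hb)

/-- A lower bound for a Cauchy average. -/
theorem le_integral_mul_cauchyDensity {f : ℝ → ℝ} (hf : Measurable f) {δ c : ℝ}
    (hb : ∀ r, |f r| ≤ δ) (hc : ∀ r ∈ Set.Icc (-cauchyWidth) cauchyWidth, c ≤ f r) :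
    3 / 4 * c - 1 / 4 * δ ≤ ∫ r, f r * cauchyDensity r := by
  -- The function is minorized by `c` on the central interval of mass `3/4` and by `-δ` outside,
  -- that is by `(c + δ) 1_I - δ`.
  have hi := (integrable_cauchyDensity.indicator
    (measurableSet_Icc (a := -cauchyWidth) (b := cauchyWidth))).const_mul (c + δ)
  have h1 : ∫ r, ((c + δ) * (Set.Icc (-cauchyWidth) cauchyWidth).indicator cauchyDensity r -
      δ * cauchyDensity r) = 3 / 4 * c - 1 / 4 * δ := by
    rw [integral_sub hi (integrable_cauchyDensity.const_mul δ), integral_const_mul,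
      integral_const_mul, integral_indicator measurableSet_Icc, integral_cauchyDensity_Icc,
      integral_cauchyDensity]
    ring
  rw [← h1]
  refine integral_mono (hi.sub (integrable_cauchyDensity.const_mul δ))
    (integrable_mul_cauchyDensity hf hb) fun r => ?_
  have hk := cauchyDensity_nonneg r
  simp only
  by_cases hr : r ∈ Set.Icc (-cauchyWidth) cauchyWidth
  · rw [Set.indicator_of_mem hr]
    nlinarith [mul_le_mul_of_nonneg_right (hc r hr) hk]
  · rw [Set.indicator_of_notMem hr]
    nlinarith [mul_le_mul_of_nonneg_right (abs_le.1 (hb r)).1 hk]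

/-- The kernel is centred at `x + cauchyWidth * v`, so its central window lies to the right of `x`.
There `F` is at least `F x` and `G` exceeds `G x` by at most `2 L cauchyWidth v`. Mass `3/4` in the
window leaves the factor `1/3 < 1` on `δ`, which can later be absorbed. -/
theorem sub_le_of_smoothed_le {F G : ℝ → ℝ} (hF : Monotone F) (hG : Monotone G) {L δ η v x : ℝ}
    (hL : ∀ s t, s ≤ t → G t - G s ≤ L * (t - s)) (hL0 : 0 ≤ L) (hδ : ∀ s, |F s - G s| ≤ δ)
    (hv : 0 < v)
    (hη : |∫ r, (F (x + cauchyWidth * v + v * r) - G (x + cauchyWidth * v + v * r)) *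
      cauchyDensity r| ≤ η) :
    F x - G x ≤ 4 / 3 * η + 1 / 3 * δ + 2 * L * cauchyWidth * v := by
  have hm : Measurable fun r => F (x + cauchyWidth * v + v * r) -
      G (x + cauchyWidth * v + v * r) :=
    (hF.measurable.comp (by fun_prop)).sub (hG.measurable.comp (by fun_prop))
  have := le_integral_mul_cauchyDensity hm (fun r => hδ _)
    (c := F x - G x - L * (2 * cauchyWidth * v)) (fun r hr => by
      have h1 : 0 ≤ cauchyWidth * v + v * r := by nlinarith [hr.1]
      have h2 : cauchyWidth * v + v * r ≤ 2 * cauchyWidth * v := by nlinarith [hr.2]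
      have h3 := hF (show x ≤ x + cauchyWidth * v + v * r by linarith)
      have h4 := hL x (x + cauchyWidth * v + v * r) (by linarith)
      have h5 := mul_le_mul_of_nonneg_left h2 hL0
      nlinarith)
  have h6 := (abs_le.1 hη).2
  nlinarith

theorem neg_sub_le_of_smoothed_le {F G : ℝ → ℝ} (hF : Monotone F) (hG : Monotone G)
    {L δ η v x : ℝ} (hL : ∀ s t, s ≤ t → G t - G s ≤ L * (t - s)) (hL0 : 0 ≤ L)
    (hδ : ∀ s, |F s - G s| ≤ δ) (hv : 0 < v)
    (hη : |∫ r, (F (x - cauchyWidth * v + v * r) - G (x - cauchyWidth * v + v * r)) *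
      cauchyDensity r| ≤ η) :
    G x - F x ≤ 4 / 3 * η + 1 / 3 * δ + 2 * L * cauchyWidth * v := by
  have hm : Measurable fun r => -(F (x - cauchyWidth * v + v * r) -
      G (x - cauchyWidth * v + v * r)) :=
    ((hF.measurable.comp (by fun_prop)).sub (hG.measurable.comp (by fun_prop))).neg
  have := le_integral_mul_cauchyDensity hm (fun r => by rw [abs_neg]; exact hδ _)
    (c := G x - F x - L * (2 * cauchyWidth * v)) (fun r hr => by
      have h1 : 0 ≤ cauchyWidth * v - v * r := by nlinarith [hr.2]
      have h2 : cauchyWidth * v - v * r ≤ 2 * cauchyWidth * v := by nlinarith [hr.1]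
      have h3 := hF (show x - cauchyWidth * v + v * r ≤ x by linarith)
      have h4 := hL (x - cauchyWidth * v + v * r) x (by linarith)
      have h5 := mul_le_mul_of_nonneg_left h2 hL0
      nlinarith)
  simp only [neg_mul, integral_neg] at this
  have h6 := (abs_le.1 hη).1
  nlinarith

/-- The Cauchy-smoothed indicator of `u ≤ x` at scale `v`. -/
noncomputable def smoothStep (x v u : ℝ) : ℝ := 1 / 2 + Real.pi⁻¹ * Real.arctan ((x - u) / v)

theorem smoothStep_mem (x v u : ℝ) : |smoothStep x v u| ≤ 1 := by
  have h1 := Real.neg_pi_div_two_lt_arctan ((x - u) / v)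
  have h2 := Real.arctan_lt_pi_div_two ((x - u) / v)
  have hp := Real.pi_pos
  have h3 : Real.pi⁻¹ * Real.arctan ((x - u) / v) ≤ 1 / 2 := by
    rw [inv_mul_le_iff₀ hp]; linarith
  have h4 : -(1 / 2) ≤ Real.pi⁻¹ * Real.arctan ((x - u) / v) := by
    rw [le_inv_mul_iff₀ hp]; linarith
  rw [smoothStep, abs_le]
  constructor <;> linarith

theorem measurable_smoothStep (x v : ℝ) : Measurable (smoothStep x v) := by
  unfold smoothStep
  exact measurable_const.add (measurable_const.mul
    (Real.continuous_arctan.measurable.comp (by fun_prop)))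

theorem integral_Ici_cauchyDensity (c : ℝ) :
    ∫ r in Set.Ici c, cauchyDensity r = 1 / 2 - Real.pi⁻¹ * Real.arctan c := by
  have h := integral_add_compl (measurableSet_Iic (a := c)) integrable_cauchyDensity
  rw [Set.compl_Iic, integral_cauchyDensity] at h
  rw [integral_Ici_eq_integral_Ioi]
  have h2 : ∫ r in Set.Iic c, cauchyDensity r = Real.pi⁻¹ * (Real.arctan c + Real.pi / 2) := by
    unfold cauchyDensity
    rw [integral_const_mul, integral_Iic_inv_one_add_sq]
  have h3 : Real.pi⁻¹ * Real.pi = 1 := inv_mul_cancel₀ Real.pi_ne_zero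
  rw [h2] at h
  linarith

/-- Fubini for the indicator of `u ≤ x + v r`. -/
theorem integral_cdf_mul_cauchyDensity (μ : Measure ℝ) [IsProbabilityMeasure μ] {x v : ℝ}
    (hv : 0 < v) :
    ∫ r, μ.real (Set.Iic (x + v * r)) * cauchyDensity r = ∫ u, smoothStep x v u ∂μ := by
  set S : Set (ℝ × ℝ) := {z | z.2 ≤ x + v * z.1} with hS
  have hSm : MeasurableSet S := measurableSet_le (by fun_prop) (by fun_prop)
  have h1 (r : ℝ) : μ.real (Set.Iic (x + v * r)) * cauchyDensity r =
      ∫ u, S.indicator (fun z => cauchyDensity z.1) (r, u) ∂μ := by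
    have : (fun u => S.indicator (fun z => cauchyDensity z.1) (r, u)) =
        (Set.Iic (x + v * r)).indicator fun _ => cauchyDensity r := by
      ext u
      by_cases hu : u ≤ x + v * r
      · rw [Set.indicator_of_mem (show (r, u) ∈ S from hu), Set.indicator_of_mem (Set.mem_Iic.2 hu)]
      · rw [Set.indicator_of_notMem (show (r, u) ∉ S from hu), 
          Set.indicator_of_notMem fun h => hu (Set.mem_Iic.1 h)]
    rw [this, integral_indicator measurableSet_Iic, setIntegral_const, smul_eq_mul]
  have h2 (u : ℝ) : ∫ r, S.indicator (fun z => cauchyDensity z.1) (r, u) = smoothStep x v u := by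
    have : (fun r => S.indicator (fun z => cauchyDensity z.1) (r, u)) =
        (Set.Ici ((u - x) / v)).indicator cauchyDensity := by
      ext r
      have hiff : (r, u) ∈ S ↔ r ∈ Set.Ici ((u - x) / v) := by
        change u ≤ x + v * r ↔ (u - x) / v ≤ r
        rw [div_le_iff₀ hv, mul_comm r v, sub_le_iff_le_add']
      by_cases hr : r ∈ Set.Ici ((u - x) / v)
      · rw [Set.indicator_of_mem (hiff.2 hr), Set.indicator_of_mem hr]
      · rw [Set.indicator_of_notMem fun h => hr (hiff.1 h), Set.indicator_of_notMem hr]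
    rw [this, integral_indicator measurableSet_Ici, integral_Ici_cauchyDensity, smoothStep,
      show (x - u) / v = -((u - x) / v) by ring, Real.arctan_neg]
    ring
  simp_rw [h1]
  rw [integral_integral_swap]
  · simp_rw [h2]
  · refine Integrable.indicator ?_ hSm
    have := integrable_cauchyDensity.mul_prod (integrable_const (μ := μ) (1 : ℝ))
    simpa using this

/-- The Stieltjes transform of a measure on the real line. -/
noncomputable def stieltjes (μ : Measure ℝ) (w : ℂ) : ℂ := ∫ u, ((u : ℂ) - w)⁻¹ ∂μ

theorem norm_inv_sub_le {w : ℂ} (hw : 0 < w.im) (u : ℝ) : ‖((u : ℂ) - w)⁻¹‖ ≤ 1 / w.im := by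
  rw [norm_inv, ← one_div]
  refine one_div_le_one_div_of_le hw ?_
  refine le_trans ?_ (Complex.abs_im_le_norm _)
  rw [Complex.sub_im, Complex.ofReal_im, zero_sub, abs_neg]
  exact le_abs_self _

theorem integrable_inv_sub (μ : Measure ℝ) [IsFiniteMeasure μ] {w : ℂ} (hw : 0 < w.im) :
    Integrable (fun u : ℝ => ((u : ℂ) - w)⁻¹) μ :=
  Integrable.of_bound (by fun_prop) (1 / w.im) (Eventually.of_forall (norm_inv_sub_le hw))

/-- Differentiating the arctangent in the height gives `(u - x)/((u - x)² + v²)`, the real part of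
the Cauchy kernel. This is why integration along a vertical line replaces the usual horizontal
integral of the Stieltjes transform. -/
theorem hasDerivAt_smoothStep (x u : ℝ) {v : ℝ} (hv : 0 < v) :
    HasDerivAt (fun v => smoothStep x v u)
      (Real.pi⁻¹ * ((u : ℂ) - (x + v * Complex.I))⁻¹.re) v := by
  have h1 : HasDerivAt (fun v : ℝ => (x - u) / v) (-(x - u) / v ^ 2) v := by
    refine ((hasDerivAt_inv hv.ne').const_mul (x - u)).congr_deriv ?_
    ring
  refine (((h1.arctan).const_mul Real.pi⁻¹).const_add (1 / 2)).congr_deriv ?_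
  congr 1
  rw [Complex.inv_re, Complex.normSq_apply]
  have hd : 0 < (u - x) * (u - x) + v * v := by nlinarith [mul_pos hv hv, mul_self_nonneg (u - x)]
  have hd' : 0 < 1 + ((x - u) / v) ^ 2 := by positivity
  simp
  have hd2 : (u - x) * (u - x) + v * v ≠ 0 := hd.ne'
  have hd3 : v ^ 2 + (x - u) ^ 2 ≠ 0 := by nlinarith
  field_simp
  ring

theorem hasDerivAt_integral_smoothStep (μ : Measure ℝ) [IsProbabilityMeasure μ] (x : ℝ) {v : ℝ}
    (hv : 0 < v) :
    HasDerivAt (fun v => ∫ u, smoothStep x v u ∂μ)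
      (Real.pi⁻¹ * (stieltjes μ (x + v * Complex.I)).re) v := by
  have hw (v : ℝ) : ((x : ℂ) + v * Complex.I).im = v := by simp
  have h := (hasDerivAt_integral_of_dominated_loc_of_deriv_le (μ := μ)
    (F := fun v u => smoothStep x v u)
    (F' := fun v u => Real.pi⁻¹ * ((u : ℂ) - (x + v * Complex.I))⁻¹.re)
    (bound := fun _ => Real.pi⁻¹ * (2 / v)) (x₀ := v) (s := Set.Ioi (v / 2))
    (Ioi_mem_nhds (by linarith))
    (Eventually.of_forall fun v => (measurable_smoothStep x v).aestronglyMeasurable)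
    (Integrable.of_bound (measurable_smoothStep x v).aestronglyMeasurable 1
      (Eventually.of_forall fun u => smoothStep_mem x v u))
    (by fun_prop)
    (Eventually.of_forall fun u v' hv' => by
      have hv'' : v / 2 < v' := hv'
      have := norm_inv_sub_le (w := x + v' * Complex.I) (by rw [hw]; linarith) u
      rw [hw] at this
      rw [norm_mul, Real.norm_of_nonneg (by positivity)]
      gcongr
      refine (Complex.abs_re_le_norm _).trans (this.trans ?_)
      rw [div_le_div_iff₀ (by linarith) hv]
      linarith)
    (integrable_const _)
    (Eventually.of_forall fun u v' hv' => hasDerivAt_smoothStep x u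
      (by have hv'' : v / 2 < v' := hv'; linarith))).2
  refine h.congr_deriv ?_
  rw [integral_const_mul, stieltjes]
  congr 1
  exact integral_re (integrable_inv_sub μ (by rw [hw]; exact hv))

theorem tendsto_integral_smoothStep (μ : Measure ℝ) [IsProbabilityMeasure μ] (x : ℝ) :
    Tendsto (fun v => ∫ u, smoothStep x v u ∂μ) atTop (𝓝 (1 / 2)) := by
  have h := tendsto_integral_filter_of_dominated_convergence (μ := μ) (l := atTop)
    (F := fun v u => smoothStep x v u) (f := fun _ => 1 / 2) (fun _ => 1)
    (Eventually.of_forall fun v => (measurable_smoothStep x v).aestronglyMeasurable)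
    (Eventually.of_forall fun v => Eventually.of_forall fun u => smoothStep_mem x v u)
    (integrable_const _)
    (Eventually.of_forall fun u => by
      have h1 : Tendsto (fun v : ℝ => (x - u) / v) atTop (𝓝 0) :=
        tendsto_const_nhds.div_atTop tendsto_id
      have h2 := ((Real.continuous_arctan.tendsto 0).comp h1).const_mul Real.pi⁻¹
      have h3 := h2.const_add (1 / 2)
      rw [Real.arctan_zero, mul_zero, add_zero] at h3
      exact h3)
  simpa using h

/-- The difference of the smoothed distribution functions of two measures. -/
noncomputable def smoothDiff (μ ν : Measure ℝ) (x v : ℝ) : ℝ :=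
  ∫ u, smoothStep x v u ∂μ - ∫ u, smoothStep x v u ∂ν

/-- Mean value inequality along the vertical line, with `Φ` a primitive of the bound on the
Stieltjes difference; the factor `π⁻¹` is simply discarded. -/
theorem abs_smoothDiff_le {μ ν : Measure ℝ} [IsProbabilityMeasure μ] [IsProbabilityMeasure ν]
    {x a b : ℝ} (ha : 0 < a) (hab : a ≤ b) {φ Φ : ℝ → ℝ}
    (hΦ : ∀ v, 0 < v → HasDerivAt Φ (φ v) v)
    (hle : ∀ v, a ≤ v → v ≤ b →
      ‖stieltjes μ (x + v * Complex.I) - stieltjes ν (x + v * Complex.I)‖ ≤ φ v) :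
    |smoothDiff μ ν x a| ≤ |smoothDiff μ ν x b| + (Φ b - Φ a) := by
  have hd (v : ℝ) (hv : 0 < v) : HasDerivAt (smoothDiff μ ν x)
      (Real.pi⁻¹ * (stieltjes μ (x + v * Complex.I) - stieltjes ν (x + v * Complex.I)).re) v := by
    have := (hasDerivAt_integral_smoothStep μ x hv).sub (hasDerivAt_integral_smoothStep ν x hv)
    rwa [← mul_sub, ← Complex.sub_re] at this
  have hpi : Real.pi⁻¹ ≤ 1 := inv_le_one_of_one_le₀ (by linarith [Real.pi_gt_three])
  have key := image_norm_le_of_norm_deriv_right_le_deriv_boundary' (a := a) (b := b)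
    (f := fun v => smoothDiff μ ν x v - smoothDiff μ ν x a)
    (f' := fun v => Real.pi⁻¹ *
      (stieltjes μ (x + v * Complex.I) - stieltjes ν (x + v * Complex.I)).re)
    (B := fun v => Φ v - Φ a) (B' := φ)
    (fun v hv => ((hd v (ha.trans_le hv.1)).continuousAt.sub
      continuousAt_const).continuousWithinAt)
    (fun v hv => ((hd v (ha.trans_le hv.1)).sub_const _).hasDerivWithinAt)
    (by simp)
    (fun v hv => ((hΦ v (ha.trans_le hv.1)).continuousAt.sub
      continuousAt_const).continuousWithinAt)
    (fun v hv => ((hΦ v (ha.trans_le hv.1)).sub_const _).hasDerivWithinAt)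
    (fun v hv => by
      have h1 := hle v hv.1 hv.2.le
      have h2 := Complex.abs_re_le_norm
        (stieltjes μ (x + v * Complex.I) - stieltjes ν (x + v * Complex.I))
      rw [norm_mul, Real.norm_of_nonneg (by positivity)]
      calc _ ≤ 1 * ‖(stieltjes μ (x + v * Complex.I) - stieltjes ν (x + v * Complex.I)).re‖ := by
            gcongr
        _ ≤ φ v := by rw [one_mul]; exact h2.trans h1)
  have := key (Set.right_mem_Icc.2 hab)
  rw [Real.norm_eq_abs, abs_le] at this
  have h3 := abs_le.1 (le_refl |smoothDiff μ ν x b|)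
  rw [abs_le]
  constructor <;> linarith

theorem tendsto_smoothDiff (μ ν : Measure ℝ) [IsProbabilityMeasure μ] [IsProbabilityMeasure ν]
    (x : ℝ) : Tendsto (fun v => |smoothDiff μ ν x v|) atTop (𝓝 0) := by
  have := ((tendsto_integral_smoothStep μ x).sub (tendsto_integral_smoothStep ν x)).abs
  simpa [smoothDiff] using this

theorem integral_cdf_sub_mul_cauchyDensity (μ ν : Measure ℝ) [IsProbabilityMeasure μ]
    [IsProbabilityMeasure ν] {x v : ℝ} (hv : 0 < v) :
    ∫ r, (μ.real (Set.Iic (x + v * r)) - ν.real (Set.Iic (x + v * r))) * cauchyDensity r =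
      smoothDiff μ ν x v := by
  have hi (μ : Measure ℝ) [IsProbabilityMeasure μ] :
      Integrable fun r => μ.real (Set.Iic (x + v * r)) * cauchyDensity r := by
    refine integrable_mul_cauchyDensity ?_ (δ := 1) fun r => ?_
    · have : Monotone fun t => μ.real (Set.Iic t) := fun s t h =>
        measureReal_mono (Set.Iic_subset_Iic.2 h)
      exact this.measurable.comp (by fun_prop)
    · rw [abs_of_nonneg measureReal_nonneg]
      exact measureReal_le_one
  simp_rw [sub_mul]
  rw [integral_sub (hi μ) (hi ν), integral_cdf_mul_cauchyDensity μ hv,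
    integral_cdf_mul_cauchyDensity ν hv, smoothDiff]

end CauchySmoothing

/-! ### The trigonometric integral behind the semicircle law -/

section TrigIntegral

/-- The quadratic `1 + q² - 2 q cos θ = (1 - q e^{iθ}) (1 - q e^{-iθ})`. -/
noncomputable def poissonDenom (q : ℂ) (θ : ℝ) : ℂ := 1 + q ^ 2 - 2 * q * (Real.cos θ : ℂ)

theorem circleMap_zero_one (θ : ℝ) :
    circleMap 0 1 θ = (Real.cos θ : ℂ) + (Real.sin θ : ℂ) * Complex.I := by
  rw [circleMap, zero_add, Complex.ofReal_one, one_mul, Complex.exp_mul_I, Complex.ofReal_cos,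
    Complex.ofReal_sin]

theorem cos_sq_add_sin_sq_complex (θ : ℝ) :
    (Real.cos θ : ℂ) ^ 2 + (Real.sin θ : ℂ) ^ 2 = 1 := by
  exact_mod_cast Real.cos_sq_add_sin_sq θ

theorem circleMap_mul_poissonDenom (q : ℂ) (θ : ℝ) :
    circleMap 0 1 θ * poissonDenom q θ =
      (circleMap 0 1 θ - q) * (1 - q * circleMap 0 1 θ) := by
  rw [circleMap_zero_one, poissonDenom]
  linear_combination (-q) * cos_sq_add_sin_sq_complex θ + q * (Real.sin θ : ℂ) ^ 2 * Complex.I_sq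

theorem norm_circleMap_zero_one (θ : ℝ) : ‖circleMap 0 1 θ‖ = 1 := by simp

theorem one_sub_mul_ne_zero {q z : ℂ} (hq : ‖q‖ < 1) (hz : ‖z‖ ≤ 1) : 1 - q * z ≠ 0 := by
  intro h
  have : ‖q * z‖ = 1 := by rw [← sub_eq_zero.1 h, norm_one]
  rw [norm_mul] at this
  nlinarith [norm_nonneg q, norm_nonneg z]

theorem poissonDenom_ne_zero {q : ℂ} (hq : ‖q‖ < 1) (θ : ℝ) : poissonDenom q θ ≠ 0 := by
  intro h
  have := circleMap_mul_poissonDenom q θ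
  rw [h, mul_zero, eq_comm, mul_eq_zero] at this
  have hn := norm_circleMap_zero_one θ
  rcases this with h1 | h1
  · rw [sub_eq_zero.1 h1] at hn
    linarith
  · exact one_sub_mul_ne_zero hq hn.le h1

theorem continuous_poissonDenom (q : ℂ) : Continuous (poissonDenom q) := by
  unfold poissonDenom
  have := Complex.continuous_ofReal.comp Real.continuous_cos
  simp only [Function.comp_def] at this
  fun_prop

/-- Cauchy's formula on the unit circle for `(1 - z²)/(1 - q z)` at `z = q`, where the value is `1`.
-/
theorem integral_cauchy_poissonDenom {q : ℂ} (hq : ‖q‖ < 1) :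
    ∫ θ in (0 : ℝ)..2 * Real.pi, (2 * (Real.sin θ : ℂ) ^ 2 -
      2 * (Real.sin θ : ℂ) * (Real.cos θ : ℂ) * Complex.I) / poissonDenom q θ =
      2 * (Real.pi : ℂ) := by
  have hd : DiffContOnCl ℂ (fun z => (1 - z ^ 2) / (1 - q * z)) (Metric.ball 0 1) := by
    have : DifferentiableOn ℂ (fun z => (1 - z ^ 2) / (1 - q * z)) (Metric.closedBall 0 1) := by
      refine DifferentiableOn.div (by fun_prop) (by fun_prop) fun z hz => ?_
      exact one_sub_mul_ne_zero hq (by simpa using hz)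
    exact (this.mono Metric.closure_ball_subset_closedBall).diffContOnCl
  have h := hd.circleIntegral_sub_inv_smul (w := q) (by simpa using hq)
  have hq2 : 1 - q * q ≠ 0 := one_sub_mul_ne_zero hq hq.le
  rw [circleIntegral, show (1 - q ^ 2) / (1 - q * q) = 1 by rw [← sq, div_self (by rwa [sq])],
    smul_eq_mul, mul_one] at h
  have e (θ : ℝ) : deriv (circleMap 0 1) θ • (circleMap 0 1 θ - q)⁻¹ •
      ((1 - circleMap 0 1 θ ^ 2) / (1 - q * circleMap 0 1 θ)) = Complex.I *
      ((2 * (Real.sin θ : ℂ) ^ 2 -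
      2 * (Real.sin θ : ℂ) * (Real.cos θ : ℂ) * Complex.I) / poissonDenom q θ) := by
    have h1 := poissonDenom_ne_zero hq θ
    have hn := norm_circleMap_zero_one θ
    have h2 : circleMap 0 1 θ - q ≠ 0 := by
      intro h0; rw [sub_eq_zero.1 h0] at hn; linarith
    have h3 := one_sub_mul_ne_zero hq hn.le
    have h4 : 1 - circleMap 0 1 θ ^ 2 = 2 * (Real.sin θ : ℂ) ^ 2 -
        2 * (Real.sin θ : ℂ) * (Real.cos θ : ℂ) * Complex.I := by
      rw [circleMap_zero_one]
      linear_combination (-1) * cos_sq_add_sin_sq_complex θ -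
        (Real.sin θ : ℂ) ^ 2 * Complex.I_sq
    have h5 := circleMap_mul_poissonDenom q θ
    rw [h4, deriv_circleMap, smul_eq_mul, smul_eq_mul]
    generalize 2 * (Real.sin θ : ℂ) ^ 2 -
        2 * (Real.sin θ : ℂ) * (Real.cos θ : ℂ) * Complex.I = N
    generalize 1 - q * circleMap 0 1 θ = A at h3 h5 ⊢
    generalize circleMap 0 1 θ - q = B at h2 h5 ⊢
    rw [← mul_div_assoc, ← mul_div_assoc, ← mul_div_assoc, div_eq_div_iff h3 h1]
    have hB : B⁻¹ * B = 1 := inv_mul_cancel₀ h2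
    linear_combination (B⁻¹ * N * Complex.I) * h5 + (A * N * Complex.I) * hB
  simp_rw [e] at h
  rw [intervalIntegral.integral_const_mul] at h
  have := mul_left_cancel₀ Complex.I_ne_zero (h.trans (by ring :
    2 * (Real.pi : ℂ) * Complex.I = Complex.I * (2 * Real.pi)))
  exact this

/-- The Stieltjes transform of the semicircle law in trigonometric form. -/
theorem integral_sin_sq_div_poissonDenom {q : ℂ} (hq : ‖q‖ < 1) :
    ∫ θ in (0 : ℝ)..Real.pi, (Real.sin θ : ℂ) ^ 2 / poissonDenom q θ =
      (Real.pi : ℂ) / 2 := by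
  set h : ℝ → ℂ := fun θ => (2 * (Real.sin θ : ℂ) ^ 2 -
      2 * (Real.sin θ : ℂ) * (Real.cos θ : ℂ) * Complex.I) / poissonDenom q θ with hh
  have hc : Continuous h := by
    refine Continuous.div ?_ (continuous_poissonDenom q) (poissonDenom_ne_zero hq)
    have h1 : Continuous fun θ => (Real.sin θ : ℂ) := by fun_prop
    have h2 : Continuous fun θ => (Real.cos θ : ℂ) := by fun_prop
    fun_prop
  have h1 := integral_cauchy_poissonDenom hq
  rw [← intervalIntegral.integral_add_adjacent_intervals (b := Real.pi)
    (hc.intervalIntegrable _ _) (hc.intervalIntegrable _ _)] at h1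
  -- Folding the circle by `θ ↦ 2π - θ` cancels the odd term `sin θ cos θ` and doubles the `sin²`
  -- term.
  have h2 : ∫ θ in Real.pi..2 * Real.pi, h θ = ∫ θ in (0 : ℝ)..Real.pi, h (2 * Real.pi - θ) := by
    rw [intervalIntegral.integral_comp_sub_left (fun θ => h θ)]
    congr 1 <;> ring
  change (∫ θ in (0 : ℝ)..Real.pi, h θ) + ∫ θ in Real.pi..2 * Real.pi, h θ = _ at h1
  have hc2 : Continuous fun θ : ℝ => h (2 * Real.pi - θ) := hc.comp (by fun_prop)
  rw [h2, ← intervalIntegral.integral_add (hc.intervalIntegrable _ _)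
    (hc2.intervalIntegrable _ _)] at h1
  have e (θ : ℝ) : h θ + h (2 * Real.pi - θ) =
      4 * ((Real.sin θ : ℂ) ^ 2 / poissonDenom q θ) := by
    simp only [hh, poissonDenom, Real.sin_two_pi_sub, Real.cos_two_pi_sub]
    push_cast
    ring
  simp_rw [e] at h1
  rw [intervalIntegral.integral_const_mul] at h1
  linear_combination h1 / 4

end TrigIntegral

/-! ### The Marchenko–Pastur law and its self-consistent equation -/

section MarchenkoPastur

variable {y : ℝ}

theorem measurable_mpDensity (y : ℝ) : Measurable (mpDensity y) := by
  unfold mpDensity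
  exact Measurable.indicator (by fun_prop) measurableSet_Icc

theorem mpLaw_eq (hy1 : y ≤ 1) :
    mpLaw y = volume.withDensity fun x => ENNReal.ofReal (mpDensity y x) := by
  unfold mpLaw
  split_ifs with h
  · rw [le_antisymm hy1 h]; simp
  · simp

theorem mpDensity_nonneg (hy : 0 < y) (x : ℝ) : 0 ≤ mpDensity y x := by
  unfold mpDensity
  refine Set.indicator_nonneg (fun t ht => ?_) x
  have : 0 ≤ t := (sq_nonneg _).trans ht.1
  positivity

theorem mpDensity_eq_zero_of_le {x : ℝ} (hx : x ≤ (1 - √y) ^ 2) : mpDensity y x = 0 := by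
  unfold mpDensity
  rcases hx.lt_or_eq with h | h
  · exact Set.indicator_of_notMem (fun h' => absurd h'.1 (not_le.2 h)) _
  · by_cases h' : x ∈ Set.Icc ((1 - √y) ^ 2) ((1 + √y) ^ 2)
    · rw [Set.indicator_of_mem h', h]; simp
    · exact Set.indicator_of_notMem h' _

theorem mpDensity_eq_zero_of_ge {x : ℝ} (hx : (1 + √y) ^ 2 ≤ x) : mpDensity y x = 0 := by
  unfold mpDensity
  rcases hx.lt_or_eq with h | h
  · exact Set.indicator_of_notMem (fun h' => absurd h'.2 (not_le.2 h)) _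
  · by_cases h' : x ∈ Set.Icc ((1 - √y) ^ 2) ((1 + √y) ^ 2)
    · rw [Set.indicator_of_mem h', ← h]; simp
    · exact Set.indicator_of_notMem h' _

/-- The trigonometric parametrization of the support of the Marchenko–Pastur law. -/
noncomputable def mpParam (y θ : ℝ) : ℝ := 1 + y - 2 * √y * Real.cos θ

theorem mpParam_sub (hy : 0 ≤ y) (θ : ℝ) :
    mpParam y θ - (1 - √y) ^ 2 = 2 * √y * (1 - Real.cos θ) := by
  have := Real.sq_sqrt hy
  rw [mpParam]; linear_combination -this

theorem sub_mpParam (hy : 0 ≤ y) (θ : ℝ) :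
    (1 + √y) ^ 2 - mpParam y θ = 2 * √y * (1 + Real.cos θ) := by
  have := Real.sq_sqrt hy
  rw [mpParam]; linear_combination this

theorem hasDerivAt_mpParam (y θ : ℝ) :
    HasDerivAt (mpParam y) (2 * √y * Real.sin θ) θ := by
  have := ((Real.hasDerivAt_cos θ).const_mul (2 * √y)).const_sub (1 + y)
  refine this.congr_deriv ?_
  ring

theorem strictMonoOn_mpParam (hy : 0 < y) : StrictMonoOn (mpParam y) (Set.Icc 0 Real.pi) := by
  intro s hs t ht hst
  have h1 := Real.strictAntiOn_cos hs ht hst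
  have h2 : 0 < √y := Real.sqrt_pos.2 hy
  unfold mpParam
  nlinarith

theorem image_mpParam (hy : 0 < y) :
    mpParam y '' Set.Ioo 0 Real.pi = Set.Ioo ((1 - √y) ^ 2) ((1 + √y) ^ 2) := by
  have h0 : mpParam y 0 = (1 - √y) ^ 2 := by
    have := mpParam_sub hy.le 0
    rw [Real.cos_zero] at this; linarith
  have h1 : mpParam y Real.pi = (1 + √y) ^ 2 := by
    have := sub_mpParam hy.le Real.pi
    rw [Real.cos_pi] at this; linarith
  have hc : ContinuousOn (mpParam y) (Set.Icc 0 Real.pi) := fun θ _ =>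
    (hasDerivAt_mpParam y θ).continuousAt.continuousWithinAt
  apply subset_antisymm
  · rintro _ ⟨θ, hθ, rfl⟩
    have hm := strictMonoOn_mpParam hy
    rw [← h0, ← h1]
    exact ⟨hm (Set.left_mem_Icc.2 Real.pi_pos.le) (Set.Ioo_subset_Icc_self hθ) hθ.1,
      hm (Set.Ioo_subset_Icc_self hθ) (Set.right_mem_Icc.2 Real.pi_pos.le) hθ.2⟩
  · rw [← h0, ← h1]
    exact intermediate_value_Ioo Real.pi_pos.le hc

theorem mpParam_pos (hy : 0 < y) {θ : ℝ} (hθ : θ ∈ Set.Ioo 0 Real.pi) : 0 < mpParam y θ := by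
  have := (image_mpParam hy).subset (Set.mem_image_of_mem _ hθ)
  exact (sq_nonneg _).trans_lt this.1

/-- Under `x = 1 + y - 2√y cos θ` both the square root in the density and the Jacobian equal `2√y
sin θ`; their product cancels the `y` in the denominator. -/
theorem integral_mpLaw (hy : 0 < y) (hy1 : y ≤ 1) (F : ℝ → ℂ) :
    ∫ x, F x ∂(mpLaw y) = (2 / (Real.pi : ℂ)) * ∫ θ in (0 : ℝ)..Real.pi,
      (Real.sin θ : ℂ) ^ 2 / (mpParam y θ : ℂ) * F (mpParam y θ) := by
  have hm : Measurable fun x => ENNReal.ofReal (mpDensity y x) :=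
    (measurable_mpDensity y).ennreal_ofReal
  rw [mpLaw_eq hy1, integral_withDensity_eq_integral_toReal_smul hm
    (Filter.Eventually.of_forall fun x => ENNReal.ofReal_lt_top)]
  simp_rw [ENNReal.toReal_ofReal (mpDensity_nonneg hy _)]
  have h1 : ∫ x, mpDensity y x • F x =
      ∫ x in Set.Ioo ((1 - √y) ^ 2) ((1 + √y) ^ 2), mpDensity y x • F x := by
    refine (setIntegral_eq_integral_of_forall_compl_eq_zero fun x hx => ?_).symm
    rw [Set.mem_Ioo, not_and_or, not_lt, not_lt] at hx
    rcases hx with hx | hx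
    · rw [mpDensity_eq_zero_of_le hx, zero_smul]
    · rw [mpDensity_eq_zero_of_ge hx, zero_smul]
  rw [h1, ← image_mpParam hy, integral_image_eq_integral_abs_deriv_smul measurableSet_Ioo
    (fun θ _ => (hasDerivAt_mpParam y θ).hasDerivWithinAt)
    ((strictMonoOn_mpParam hy).injOn.mono Set.Ioo_subset_Icc_self),
    intervalIntegral.integral_of_le Real.pi_pos.le, integral_Ioc_eq_integral_Ioo,
    ← integral_const_mul]
  refine setIntegral_congr_fun measurableSet_Ioo fun θ hθ => ?_
  have hs : 0 < Real.sin θ := Real.sin_pos_of_pos_of_lt_pi hθ.1 hθ.2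
  have ht := mpParam_pos hy hθ
  have hmem := Set.Ioo_subset_Icc_self ((image_mpParam hy).subset (Set.mem_image_of_mem _ hθ))
  have hq : 0 < √y := Real.sqrt_pos.2 hy
  have hsq : √(((1 + √y) ^ 2 - mpParam y θ) * (mpParam y θ - (1 - √y) ^ 2)) =
      2 * √y * Real.sin θ := by
    rw [Real.sqrt_eq_iff_mul_self_eq_of_pos (by positivity), sub_mpParam hy.le, mpParam_sub hy.le]
    have := Real.sin_sq_add_cos_sq θ
    linear_combination (4 * √y ^ 2) * this
  have hd : |2 * √y * Real.sin θ| * mpDensity y (mpParam y θ) =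
      2 / Real.pi * (Real.sin θ ^ 2 / mpParam y θ) := by
    rw [abs_of_pos (by positivity), mpDensity, Set.indicator_of_mem hmem, hsq]
    have hyy : √y ^ 2 = y := Real.sq_sqrt hy.le
    field_simp
    rw [hyy]
  rw [smul_smul, hd, Complex.real_smul]
  push_cast
  ring

theorem mpParam_eq_poissonDenom (hy : 0 ≤ y) (θ : ℝ) :
    (mpParam y θ : ℂ) = poissonDenom (√y : ℂ) θ := by
  have : ((√y : ℝ) : ℂ) ^ 2 = y := by exact_mod_cast Real.sq_sqrt hy
  rw [mpParam, poissonDenom, this]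
  push_cast
  ring

/-- For `y < 1` this is the semicircle integral at `q = √y`. At `y = 1` that point lies on the unit
circle, but the integrand collapses to `(1 + cos θ)/2`. -/
theorem integral_sin_sq_div_mpParam (hy : 0 < y) (hy1 : y ≤ 1) :
    ∫ θ in (0 : ℝ)..Real.pi, (Real.sin θ : ℂ) ^ 2 / (mpParam y θ : ℂ) = (Real.pi : ℂ) / 2 := by
  rcases hy1.lt_or_eq with h | h
  · simp_rw [mpParam_eq_poissonDenom hy.le]
    refine integral_sin_sq_div_poissonDenom ?_
    rw [Complex.norm_real, Real.norm_of_nonneg (Real.sqrt_nonneg _)]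
    rw [Real.sqrt_lt' one_pos]
    simpa using h
  · subst h
    have e : ∫ θ in (0 : ℝ)..Real.pi, (Real.sin θ : ℂ) ^ 2 / (mpParam 1 θ : ℂ) =
        ∫ θ in (0 : ℝ)..Real.pi, (((1 + Real.cos θ) / 2 : ℝ) : ℂ) := by
      rw [intervalIntegral.integral_of_le Real.pi_pos.le,
        intervalIntegral.integral_of_le Real.pi_pos.le, integral_Ioc_eq_integral_Ioo,
        integral_Ioc_eq_integral_Ioo]
      refine setIntegral_congr_fun measurableSet_Ioo fun θ hθ => ?_
      have ht := mpParam_pos hy hθ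
      have : Real.sin θ ^ 2 / mpParam 1 θ = (1 + Real.cos θ) / 2 := by
        rw [div_eq_div_iff ht.ne' two_ne_zero, mpParam, Real.sqrt_one]
        linear_combination 2 * Real.sin_sq_add_cos_sq θ
      rw [← this]
      push_cast
      rfl
    rw [e, intervalIntegral.integral_ofReal, intervalIntegral.integral_div,
      intervalIntegral.integral_add (by simp) (Real.continuous_cos.intervalIntegrable _ _),
      integral_cos]
    simp

theorem isProbabilityMeasure_mpLaw (hy : 0 < y) (hy1 : y ≤ 1) :
    IsProbabilityMeasure (mpLaw y) := by
  have h := integral_mpLaw hy hy1 fun _ => 1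
  simp only [mul_one] at h
  have hpi : (Real.pi : ℂ) ≠ 0 := by exact_mod_cast Real.pi_ne_zero
  rw [integral_sin_sq_div_mpParam hy hy1, integral_const, Complex.real_smul, mul_one] at h
  have h2 : (mpLaw y).real Set.univ = 1 := by
    have : (((mpLaw y).real Set.univ : ℝ) : ℂ) = 1 := by
      rw [h]; field_simp
    exact_mod_cast this
  constructor
  rw [measureReal_def] at h2
  rw [← ENNReal.toReal_eq_one_iff]
  exact h2

/-- The roots of `q² - κ q + 1` are inverse to each other; if they had modulus one, they would be
conjugate and `κ = 2 Re q` would lie in `[-2, 2]`. -/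
theorem exists_norm_lt_one_add_inv {κ : ℂ} (h : ∀ r : ℝ, |r| ≤ 2 → κ ≠ r) :
    ∃ q : ℂ, q ≠ 0 ∧ ‖q‖ < 1 ∧ q + q⁻¹ = κ := by
  obtain ⟨s, hs⟩ := IsAlgClosed.exists_pow_nat_eq (κ ^ 2 - 4) two_pos
  set q := (κ + s) / 2 with hq
  have hprod : q * (κ - q) = 1 := by rw [hq]; linear_combination (-1 / 4) * hs
  have hq0 : q ≠ 0 := by rintro h0; rw [h0, zero_mul] at hprod; exact zero_ne_one hprod
  have hinv : q⁻¹ = κ - q := inv_eq_of_mul_eq_one_right hprod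
  have hnorm : ‖q‖ ≠ 1 := by
    intro h1
    have : q⁻¹ = (starRingEnd ℂ) q := by
      rw [Complex.inv_def, Complex.normSq_eq_norm_sq, h1]; simp
    have hκ : κ = ((2 * q.re : ℝ) : ℂ) := by
      rw [← Complex.add_conj, ← this, hinv]; ring
    refine h _ ?_ hκ
    rw [abs_mul, abs_two]
    have := Complex.abs_re_le_norm q
    rw [h1] at this
    linarith
  rcases lt_or_gt_of_ne hnorm with h1 | h1
  · exact ⟨q, hq0, h1, by rw [hinv]; ring⟩
  · refine ⟨q⁻¹, inv_ne_zero hq0, ?_, by rw [inv_inv, hinv]; ring⟩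
    rw [norm_inv]
    exact inv_lt_one_of_one_lt₀ h1

theorem sq_ne_ofReal_of_nonneg {w : ℂ} (hw : 0 < w.im) {r : ℝ} (hr : 0 ≤ r) : w ^ 2 ≠ r := by
  intro h
  have h1 := congrArg Complex.re h
  have h2 := congrArg Complex.im h
  simp only [sq, Complex.mul_re, Complex.mul_im, Complex.ofReal_re, Complex.ofReal_im] at h1 h2
  have h3 : w.re = 0 := by
    have : w.re * w.im = 0 := by linarith
    rcases mul_eq_zero.1 this with h | h
    · exact h
    · linarith
  rw [h3] at h1
  nlinarith

/-- The symmetrized Stieltjes transform of the Marchenko–Pastur law solves the self-consistent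
equation. -/
theorem mp_selfConsistent (hy : 0 < y) (hy1 : y ≤ 1) {w : ℂ} (hw : 0 < w.im) :
    ((y : ℂ) * ∫ x, w / ((x : ℂ) - w ^ 2) ∂(mpLaw y) - (1 - (y : ℂ)) / w) *
      (w + (y : ℂ) * ∫ x, w / ((x : ℂ) - w ^ 2) ∂(mpLaw y)) = -1 := by
  have hw0 : w ≠ 0 := by rintro rfl; simp at hw
  have hq0 : 0 < √y := Real.sqrt_pos.2 hy
  set s : ℂ := ((√y : ℝ) : ℂ) with hs
  have hs0 : s ≠ 0 := by rw [hs]; exact_mod_cast hq0.ne'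
  have hsy : s ^ 2 = y := by rw [hs]; exact_mod_cast Real.sq_sqrt hy.le
  have hpi : (Real.pi : ℂ) ≠ 0 := by exact_mod_cast Real.pi_ne_zero
  -- With this `κ`, the shifted support point `x - w²` becomes a multiple of `poissonDenom q θ`. The
  -- excluded case would make `w²` a real number that is at least `(1 - √y)²`.
  obtain ⟨q, hq, hq1, hqκ⟩ := exists_norm_lt_one_add_inv (κ := (1 + y - w ^ 2) / s) (by
    intro r hr h
    rw [div_eq_iff hs0] at h
    refine sq_ne_ofReal_of_nonneg hw (r := 1 + y - r * √y) ?_ ?_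
    · have := abs_le.1 hr
      nlinarith [Real.sq_sqrt hy.le, sq_nonneg (1 - √y)]
    · push_cast
      rw [← hs]
      linear_combination -h)
  rw [eq_div_iff hs0] at hqκ
  have hζ : w ^ 2 = 1 + y - s * (q + q⁻¹) := by linear_combination hqκ
  have hqi : q * q⁻¹ = 1 := mul_inv_cancel₀ hq
  have hsub (θ : ℝ) : (mpParam y θ : ℂ) - w ^ 2 = s * q⁻¹ * poissonDenom q θ := by
    rw [mpParam, poissonDenom, hζ]
    push_cast
    rw [← hs]
    linear_combination (2 * s * Complex.cos θ - s * q) * hqi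
  have hint : ∫ x, w / ((x : ℂ) - w ^ 2) ∂(mpLaw y) = (q / s - 1) / w := by
    rw [integral_mpLaw hy hy1]
    -- Partial fractions: `w/(x (x - w²)) = w⁻¹ (1/(x - w²) - 1/x)`, and both pieces have known
    -- integrals.
    have e : ∫ θ in (0 : ℝ)..Real.pi, (Real.sin θ : ℂ) ^ 2 / (mpParam y θ : ℂ) *
        (w / ((mpParam y θ : ℂ) - w ^ 2)) = ∫ θ in (0 : ℝ)..Real.pi,
        (q / s / w * ((Real.sin θ : ℂ) ^ 2 / poissonDenom q θ) -
          1 / w * ((Real.sin θ : ℂ) ^ 2 / (mpParam y θ : ℂ))) := by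
      rw [intervalIntegral.integral_of_le Real.pi_pos.le,
        intervalIntegral.integral_of_le Real.pi_pos.le, integral_Ioc_eq_integral_Ioo,
        integral_Ioc_eq_integral_Ioo]
      refine setIntegral_congr_fun measurableSet_Ioo fun θ hθ => ?_
      have ht : (mpParam y θ : ℂ) ≠ 0 := by exact_mod_cast (mpParam_pos hy hθ).ne'
      have hD := poissonDenom_ne_zero hq1 θ
      have h1 := hsub θ
      have h2 : (mpParam y θ : ℂ) - w ^ 2 ≠ 0 := by
        rw [h1]; exact mul_ne_zero (mul_ne_zero hs0 (inv_ne_zero hq)) hD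
      have h3 : q / s / w * ((Real.sin θ : ℂ) ^ 2 / poissonDenom q θ) =
          1 / w * ((Real.sin θ : ℂ) ^ 2 / ((mpParam y θ : ℂ) - w ^ 2)) := by
        rw [h1]; field_simp
      rw [h3]
      field_simp
      ring
    have hi1 : IntervalIntegrable (fun θ : ℝ => q / s / w *
        ((Real.sin θ : ℂ) ^ 2 / poissonDenom q θ)) volume 0 Real.pi := by
      have h1 : Continuous fun θ => (Real.sin θ : ℂ) := by fun_prop
      exact (continuous_const.mul ((h1.pow 2).div (continuous_poissonDenom q)
        (poissonDenom_ne_zero hq1))).intervalIntegrable _ _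
    have hi2 : IntervalIntegrable (fun θ : ℝ => 1 / w *
        ((Real.sin θ : ℂ) ^ 2 / (mpParam y θ : ℂ))) volume 0 Real.pi := by
      refine IntervalIntegrable.const_mul ?_ _
      -- The integral is already known to be `π/2`; without integrability its default value would be
      -- `0`.
      by_contra hc
      have := integral_sin_sq_div_mpParam hy hy1
      rw [intervalIntegral.integral_undef hc] at this
      apply hpi
      linear_combination -2 * this
    rw [e, intervalIntegral.integral_sub hi1 hi2, intervalIntegral.integral_const_mul,
      intervalIntegral.integral_const_mul, integral_sin_sq_div_poissonDenom hq1,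
      integral_sin_sq_div_mpParam hy hy1]
    field_simp
  rw [hint]
  have h1 : (y : ℂ) * ((q / s - 1) / w) = s * (q - s) / w := by
    rw [← hsy]; field_simp
  have e1 : s * (q - s) / w - (1 - (y : ℂ)) / w = (s * q - 1) / w := by
    rw [← hsy]; ring
  have e2 : w + s * (q - s) / w = (1 - s * q⁻¹) / w := by
    rw [eq_div_iff hw0, add_mul, div_mul_cancel₀ _ hw0, ← sq, hζ, ← hsy]; ring
  have hw2 : w ^ 2 ≠ 0 := pow_ne_zero _ hw0
  rw [h1, e1, e2, div_mul_div_comm, ← sq, div_eq_iff hw2, hζ, ← hsy]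
  linear_combination (-(s ^ 2)) * hqi

end MarchenkoPastur

/-! ### Symmetrized laws and reduction of the Kolmogorov distance -/

section Symmetrization

open Filter Topology

/-- The law of `±√x` with a fair random sign, where `x` has law `μ`. -/
noncomputable def symmLaw (μ : Measure ℝ) : Measure ℝ :=
  (2⁻¹ : ℝ≥0∞) • (μ.map (fun x => √x) + μ.map (fun x => -√x))

variable {μ ν : Measure ℝ} [IsProbabilityMeasure μ] [IsProbabilityMeasure ν]

theorem measurable_neg_sqrt : Measurable fun x : ℝ => -√x := by fun_prop

instance isProbabilityMeasure_symmLaw : IsProbabilityMeasure (symmLaw μ) := by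
  have h1 := Measure.isProbabilityMeasure_map (μ := μ) (f := fun x => √x) (by fun_prop)
  have h2 := Measure.isProbabilityMeasure_map (μ := μ) (f := fun x => -√x) (by fun_prop)
  constructor
  rw [symmLaw, Measure.smul_apply, Measure.add_apply, measure_univ, measure_univ,
    one_add_one_eq_two, smul_eq_mul]
  exact ENNReal.inv_mul_cancel (by simp) (by simp)

theorem symmLaw_real_apply {s : Set ℝ} (hs : MeasurableSet s) :
    (symmLaw μ).real s = (1 / 2) * (μ.real {x | √x ∈ s} + μ.real {x | -√x ∈ s}) := by
  have h1 := Measure.isProbabilityMeasure_map (μ := μ) (f := fun x => √x) (by fun_prop)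
  have h2 := Measure.isProbabilityMeasure_map (μ := μ) (f := fun x => -√x) (by fun_prop)
  rw [symmLaw, measureReal_ennreal_smul_apply, measureReal_add_apply,
    map_measureReal_apply (by fun_prop) hs, map_measureReal_apply (by fun_prop) hs]
  simp
  rfl

theorem symmLaw_real_Iic_of_nonneg {s : ℝ} (hs : 0 ≤ s) :
    (symmLaw μ).real (Set.Iic s) = (1 / 2) * (μ.real (Set.Iic (s ^ 2)) + 1) := by
  rw [symmLaw_real_apply measurableSet_Iic]
  have h1 : {x : ℝ | √x ∈ Set.Iic s} = Set.Iic (s ^ 2) := by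
    ext x
    simp [Real.sqrt_le_left hs]
  have h2 : {x : ℝ | -√x ∈ Set.Iic s} = Set.univ := by
    ext x
    have := Real.sqrt_nonneg x
    simp; linarith
  rw [h1, h2, probReal_univ]

theorem symmLaw_real_Iic_of_neg {s : ℝ} (hs : s < 0) :
    (symmLaw μ).real (Set.Iic s) = (1 / 2) * (1 - μ.real (Set.Iio (s ^ 2))) := by
  rw [symmLaw_real_apply measurableSet_Iic]
  have h1 : {x : ℝ | √x ∈ Set.Iic s} = ∅ := by
    ext x
    have := Real.sqrt_nonneg x
    simp; linarith
  have h2 : {x : ℝ | -√x ∈ Set.Iic s} = (Set.Iio (s ^ 2))ᶜ := by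
    ext x
    have : -√x ≤ s ↔ -s ≤ √x := by constructor <;> intro h <;> linarith
    simp only [Set.mem_Iic, Set.compl_Iio, Set.mem_Ici]
    change -√x ≤ s ↔ _
    rw [this, Real.le_sqrt' (by linarith), neg_sq]
  rw [h1, h2, measureReal_compl measurableSet_Iio, probReal_univ, measureReal_empty, zero_add]

theorem monotone_real_Iic (μ : Measure ℝ) [IsFiniteMeasure μ] :
    Monotone fun t => μ.real (Set.Iic t) :=
  fun _ _ h => measureReal_mono (Set.Iic_subset_Iic.2 h)

theorem abs_real_Iio_sub_le {δ : ℝ} (h : ∀ t, |μ.real (Set.Iic t) - ν.real (Set.Iic t)| ≤ δ)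
    (t : ℝ) : |μ.real (Set.Iio t) - ν.real (Set.Iio t)| ≤ δ := by
  obtain ⟨u, hu, hut, hlim⟩ := exists_seq_strictMono_tendsto t
  have hU : ⋃ k, Set.Iic (u k) = Set.Iio t := iUnion_Iic_eq_Iio_of_lt_of_tendsto hut hlim
  have hT (ρ : Measure ℝ) [IsProbabilityMeasure ρ] :
      Tendsto (fun k => ρ.real (Set.Iic (u k))) atTop (𝓝 (ρ.real (Set.Iio t))) := by
    have := tendsto_measure_iUnion_atTop (μ := ρ) (s := fun k => Set.Iic (u k))
      (fun i j hij => Set.Iic_subset_Iic.2 (hu.monotone hij))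
    rw [hU] at this
    exact (ENNReal.tendsto_toReal (measure_ne_top _ _)).comp this
  exact le_of_tendsto ((hT μ).sub (hT ν)).abs (Eventually.of_forall fun k => h (u k))

/-- Each half line carries half of the mass. On the negative side open half lines appear, for which
the bound follows by approximation from the left. -/
theorem abs_symmLaw_real_Iic_sub_le {δ : ℝ}
    (h : ∀ t, |μ.real (Set.Iic t) - ν.real (Set.Iic t)| ≤ δ) (s : ℝ) :
    |(symmLaw μ).real (Set.Iic s) - (symmLaw ν).real (Set.Iic s)| ≤ δ / 2 := by
  rcases le_or_gt 0 s with hs | hs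
  · rw [symmLaw_real_Iic_of_nonneg hs, symmLaw_real_Iic_of_nonneg hs]
    have := abs_le.1 (h (s ^ 2))
    rw [abs_le]; constructor <;> linarith
  · rw [symmLaw_real_Iic_of_neg hs, symmLaw_real_Iic_of_neg hs]
    have := abs_le.1 (abs_real_Iio_sub_le h (s ^ 2))
    rw [abs_le]; constructor <;> linarith

theorem symmLaw_real_Iic_sub_le [NullSingletonClass ν] {L : ℝ} (hL0 : 0 ≤ L)
    (hL : ∀ s t, 0 ≤ s → s ≤ t →
      ν.real (Set.Iic (t ^ 2)) - ν.real (Set.Iic (s ^ 2)) ≤ L * (t - s))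
    (h0 : ν.real (Set.Iic 0) = 0) (s t : ℝ) (hst : s ≤ t) :
    (symmLaw ν).real (Set.Iic t) - (symmLaw ν).real (Set.Iic s) ≤ L * (t - s) := by
  have hIio (r : ℝ) : ν.real (Set.Iio r) = ν.real (Set.Iic r) := measureReal_congr Iio_ae_eq_Iic
  have hnn : 0 ≤ L * (t - s) := mul_nonneg hL0 (by linarith)
  rcases le_or_gt 0 s with hs | hs
  · rw [symmLaw_real_Iic_of_nonneg hs, symmLaw_real_Iic_of_nonneg (hs.trans hst)]
    have := hL s t hs hst
    linarith
  · rcases le_or_gt 0 t with ht | ht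
    · rw [symmLaw_real_Iic_of_nonneg ht, symmLaw_real_Iic_of_neg hs, hIio]
      have h1 := hL 0 t le_rfl ht
      have h2 := hL 0 (-s) le_rfl (by linarith)
      rw [neg_sq] at h2
      rw [zero_pow two_ne_zero, h0] at h1 h2
      linarith
    · rw [symmLaw_real_Iic_of_neg ht, symmLaw_real_Iic_of_neg hs, hIio, hIio]
      have := hL (-t) (-s) (by linarith) (by linarith)
      rw [neg_sq, neg_sq] at this
      linarith

theorem integral_symmLaw {f : ℝ → ℂ} (hf : Measurable f) {K : ℝ} (hK : ∀ x, ‖f x‖ ≤ K) :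
    ∫ u, f u ∂(symmLaw μ) = ∫ x, (1 / 2) * (f (√x) + f (-√x)) ∂μ := by
  have h1 := Measure.isProbabilityMeasure_map (μ := μ) (f := fun x => √x) (by fun_prop)
  have h2 := Measure.isProbabilityMeasure_map (μ := μ) (f := fun x => -√x) (by fun_prop)
  have hi (ρ : Measure ℝ) [IsProbabilityMeasure ρ] : Integrable f ρ :=
    Integrable.of_bound hf.aestronglyMeasurable K (Eventually.of_forall hK)
  have hi1 : Integrable (fun x => f (√x)) μ :=
    Integrable.of_bound (hf.comp (by fun_prop)).aestronglyMeasurable K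
      (Eventually.of_forall fun x => hK _)
  have hi2 : Integrable (fun x => f (-√x)) μ :=
    Integrable.of_bound (hf.comp measurable_neg_sqrt).aestronglyMeasurable K
      (Eventually.of_forall fun x => hK _)
  rw [symmLaw, integral_smul_measure, integral_add_measure (hi _) (hi _),
    integral_map (by fun_prop) hf.aestronglyMeasurable,
    integral_map (by fun_prop) hf.aestronglyMeasurable, integral_const_mul,
    integral_add hi1 hi2]
  simp
  ring

/-- Partial fractions in `√x`; this identifies the symmetrized resolvent with a genuine Stieltjes
transform. -/
theorem half_mul_inv_add_inv {w : ℂ} (hw : 0 < w.im) {x : ℝ} (hx : 0 ≤ x) :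
    (1 / 2) * ((((√x : ℝ) : ℂ) - w)⁻¹ + (((-√x : ℝ) : ℂ) - w)⁻¹) = w / ((x : ℂ) - w ^ 2) := by
  have hne (u : ℝ) : (u : ℂ) - w ≠ 0 := by
    intro h
    have := congrArg Complex.im h
    simp at this
    linarith
  have h1 := hne (√x)
  have h2 := hne (-√x)
  have h3 : (x : ℂ) - w ^ 2 = -((((√x : ℝ) : ℂ) - w) * (((-√x : ℝ) : ℂ) - w)) := by
    have : ((√x : ℝ) : ℂ) ^ 2 = x := by exact_mod_cast Real.sq_sqrt hx
    rw [← this]; push_cast; ring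
  rw [h3]
  rw [eq_div_iff (neg_ne_zero.2 (mul_ne_zero h1 h2))]
  have e1 := inv_mul_cancel₀ h1
  have e2 := inv_mul_cancel₀ h2
  generalize hA : ((√x : ℝ) : ℂ) - w = A at *
  generalize hB : ((-√x : ℝ) : ℂ) - w = B at *
  have hAB : A + B = -2 * w := by rw [← hA, ← hB]; push_cast; ring
  linear_combination (-1 / 2 * B) * e1 - (1 / 2 * A) * e2 - hAB / 2

theorem stieltjes_symmLaw (hμ : μ (Set.Iio 0) = 0) {w : ℂ} (hw : 0 < w.im) :
    stieltjes (symmLaw μ) w = ∫ x, w / ((x : ℂ) - w ^ 2) ∂μ := by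
  rw [stieltjes, integral_symmLaw (by fun_prop) (norm_inv_sub_le hw)]
  refine integral_congr_ae ?_
  have : ∀ᵐ x ∂μ, x ∉ Set.Iio (0 : ℝ) := measure_eq_zero_iff_ae_notMem.1 hμ
  filter_upwards [this] with x hx
  exact half_mul_inv_add_inv hw (by simpa using hx)

theorem norm_div_sub_sq_le {w : ℂ} (hw : 0 < w.im) {x : ℝ} (hx : 0 ≤ x) :
    ‖w / ((x : ℂ) - w ^ 2)‖ ≤ 1 / w.im := by
  rw [← half_mul_inv_add_inv hw hx, norm_mul]
  have h1 := norm_inv_sub_le hw (√x)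
  have h2 := norm_inv_sub_le hw (-√x)
  have h3 := norm_add_le (((√x : ℝ) : ℂ) - w)⁻¹ (((-√x : ℝ) : ℂ) - w)⁻¹
  have h4 : ‖(1 / 2 : ℂ)‖ = 1 / 2 := by simp
  rw [h4]
  linarith

theorem stieltjes_im_nonneg (μ : Measure ℝ) [IsFiniteMeasure μ] {w : ℂ} (hw : 0 < w.im) :
    0 ≤ (stieltjes μ w).im := by
  have h : (stieltjes μ w).im = ∫ u : ℝ, (((u : ℂ) - w)⁻¹).im ∂μ :=
    (integral_im (integrable_inv_sub μ hw)).symm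
  rw [h]
  refine integral_nonneg fun u => ?_
  rw [Pi.zero_apply, Complex.inv_im]
  refine div_nonneg ?_ (Complex.normSq_nonneg _)
  simp [hw.le]

/-- Kolmogorov distance from smoothed distribution functions of symmetrized laws. -/
theorem abs_real_Iic_sub_le_of_smoothDiff [NullSingletonClass ν] {a b L η v : ℝ} (ha : 0 ≤ a)
    (hab : a ≤ b)
    (hνa : ν.real (Set.Iic a) = 0) (hνb : ν.real (Set.Iic b) = 1) (hL0 : 0 ≤ L)
    (hL : ∀ s t, 0 ≤ s → s ≤ t →
      ν.real (Set.Iic (t ^ 2)) - ν.real (Set.Iic (s ^ 2)) ≤ L * (t - s))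
    (hv : 0 < v)
    (hη : ∀ x₀ x, 0 ≤ x₀ → a ≤ x₀ ^ 2 → x₀ ^ 2 ≤ b → |x - x₀| ≤ cauchyWidth * v →
      |smoothDiff (symmLaw μ) (symmLaw ν) x v| ≤ η) (t : ℝ) :
    |μ.real (Set.Iic t) - ν.real (Set.Iic t)| ≤ 4 * η + 6 * L * cauchyWidth * v := by
  set D : ℝ → ℝ := fun t => μ.real (Set.Iic t) - ν.real (Set.Iic t) with hD
  have hmμ := monotone_real_Iic μ
  have hmν := monotone_real_Iic ν
  have hbd : BddAbove (Set.range fun t => |D t|) := by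
    refine ⟨1, ?_⟩
    rintro _ ⟨t, rfl⟩
    have h1 : μ.real (Set.Iic t) ≤ 1 := measureReal_le_one
    have h2 : ν.real (Set.Iic t) ≤ 1 := measureReal_le_one
    have h3 : 0 ≤ μ.real (Set.Iic t) := measureReal_nonneg
    have h4 : 0 ≤ ν.real (Set.Iic t) := measureReal_nonneg
    simp only [hD]
    rw [abs_le]; constructor <;> linarith
  set δ := ⨆ t, |D t| with hδ
  have hDδ (t : ℝ) : |D t| ≤ δ := le_ciSup hbd t
  have hν0 : ν.real (Set.Iic 0) = 0 :=
    le_antisymm ((hmν ha).trans_eq hνa) measureReal_nonneg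
  have hw := cauchyWidth_pos
  have hin (t : ℝ) (h1 : a ≤ t) (h2 : t ≤ b) :
      |D t| ≤ 2 * (4 / 3 * η + 1 / 3 * (δ / 2) + 2 * L * cauchyWidth * v) := by
    have ht0 : 0 ≤ t := ha.trans h1
    have hx0 := Real.sqrt_nonneg t
    have hx2 : √t ^ 2 = t := Real.sq_sqrt ht0
    have hwv : 0 ≤ cauchyWidth * v := by positivity
    have key1 := sub_le_of_smoothed_le (monotone_real_Iic (symmLaw μ))
      (monotone_real_Iic (symmLaw ν)) (x := √t) (δ := δ / 2) (η := η)
      (symmLaw_real_Iic_sub_le hL0 hL hν0) hL0 (abs_symmLaw_real_Iic_sub_le hDδ) hv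
      (by
        rw [integral_cdf_sub_mul_cauchyDensity _ _ hv]
        exact hη (√t) _ hx0 (by rw [hx2]; exact h1) (by rw [hx2]; exact h2)
          (by rw [add_sub_cancel_left, abs_of_nonneg hwv]))
    have key2 := neg_sub_le_of_smoothed_le (monotone_real_Iic (symmLaw μ))
      (monotone_real_Iic (symmLaw ν)) (x := √t) (δ := δ / 2) (η := η)
      (symmLaw_real_Iic_sub_le hL0 hL hν0) hL0 (abs_symmLaw_real_Iic_sub_le hDδ) hv
      (by
        rw [integral_cdf_sub_mul_cauchyDensity _ _ hv]
        exact hη (√t) _ hx0 (by rw [hx2]; exact h1) (by rw [hx2]; exact h2)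
          (by rw [sub_sub_cancel_left, abs_neg, abs_of_nonneg hwv]))
    rw [symmLaw_real_Iic_of_nonneg hx0, symmLaw_real_Iic_of_nonneg hx0, hx2] at key1 key2
    simp only [hD]
    rw [abs_le]; constructor <;> linarith
  -- Off the support of `ν` its distribution function is constant, so by monotonicity the
  -- discrepancy is at most that at the nearer endpoint. Hence the smoothed estimate is needed only
  -- for `x₀²` in `[a, b]`.
  have hall (t : ℝ) : |D t| ≤ 2 * (4 / 3 * η + 1 / 3 * (δ / 2) + 2 * L * cauchyWidth * v) := by
    rcases lt_or_ge t a with h1 | h1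
    · refine le_trans ?_ (hin a le_rfl hab)
      have e1 : ν.real (Set.Iic t) = 0 :=
        le_antisymm ((hmν h1.le).trans_eq hνa) measureReal_nonneg
      simp only [hD, e1, hνa, sub_zero]
      rw [abs_of_nonneg measureReal_nonneg, abs_of_nonneg measureReal_nonneg]
      exact hmμ h1.le
    rcases le_or_gt t b with h2 | h2
    · exact hin t h1 h2
    · refine le_trans ?_ (hin b hab le_rfl)
      have e1 : ν.real (Set.Iic t) = 1 :=
        le_antisymm measureReal_le_one (hνb.symm.le.trans (hmν h2.le))
      have e2 : μ.real (Set.Iic t) ≤ 1 := measureReal_le_one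
      have e3 := hmμ h2.le
      simp only at e3
      simp only [hD, e1, hνb]
      rw [abs_of_nonpos (by linarith), abs_of_nonpos (by linarith)]
      linarith
  -- The supremum appears on the right with coefficient `1/3`; solving for it produces the constants
  -- `4` and `6`.
  have hfin : δ ≤ 2 * (4 / 3 * η + 1 / 3 * (δ / 2) + 2 * L * cauchyWidth * v) := ciSup_le hall
  have := hDδ t
  linarith

end Symmetrization

/-! ### Regularity of the Marchenko–Pastur distribution function -/

section MarchenkoPasturCDF

variable {y : ℝ}

theorem nullSingletonClass_mpLaw (hy1 : y ≤ 1) : NullSingletonClass (mpLaw y) := by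
  rw [mpLaw_eq hy1]
  infer_instance

theorem mpLaw_Iic_left (hy1 : y ≤ 1) : mpLaw y (Set.Iic ((1 - √y) ^ 2)) = 0 := by
  rw [mpLaw_eq hy1, withDensity_apply _ measurableSet_Iic,
    setLIntegral_congr_fun (g := fun _ => 0) measurableSet_Iic fun x hx => by
      simp only [mpDensity_eq_zero_of_le hx, ENNReal.ofReal_zero]]
  simp

theorem mpLaw_Ioi_right (hy1 : y ≤ 1) : mpLaw y (Set.Ioi ((1 + √y) ^ 2)) = 0 := by
  rw [mpLaw_eq hy1, withDensity_apply _ measurableSet_Ioi,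
    setLIntegral_congr_fun (g := fun _ => 0) measurableSet_Ioi fun x hx => by
      simp only [mpDensity_eq_zero_of_ge (le_of_lt hx), ENNReal.ofReal_zero]]
  simp

theorem mpLaw_real_Iic_right (hy : 0 < y) (hy1 : y ≤ 1) :
    (mpLaw y).real (Set.Iic ((1 + √y) ^ 2)) = 1 := by
  have := isProbabilityMeasure_mpLaw hy hy1
  have h := measureReal_compl (μ := mpLaw y) (measurableSet_Iic (a := (1 + √y) ^ 2))
  rw [Set.compl_Iic, measureReal_def, mpLaw_Ioi_right hy1, probReal_univ] at h
  simp at h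
  linarith

/-- On the support `(b - x)(x - a) ≤ 4x`, as `b ≤ 4` and `a ≥ 0`. The bound keeps its form at `y =
1`. -/
theorem mpDensity_le (hy : 0 < y) (hy1 : y ≤ 1) {x : ℝ} (hx : 0 < x) :
    mpDensity y x ≤ 1 / (2 * y) * x ^ (-(1 / 2) : ℝ) := by
  have hr : 0 ≤ 1 / (2 * y) * x ^ (-(1 / 2) : ℝ) := by positivity
  by_cases h : x ∈ Set.Icc ((1 - √y) ^ 2) ((1 + √y) ^ 2)
  · rw [mpDensity, Set.indicator_of_mem h, Real.rpow_neg hx.le, ← Real.sqrt_eq_rpow]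
    have hq1 : √y ≤ 1 := Real.sqrt_le_one.2 hy1
    have hq0 := Real.sqrt_nonneg y
    have h1 : √(((1 + √y) ^ 2 - x) * (x - (1 - √y) ^ 2)) ≤ 2 * √x := by
      rw [Real.sqrt_le_left (by positivity), mul_pow, Real.sq_sqrt hx.le]
      have e1 : (1 + √y) ^ 2 - x ≤ 4 := by nlinarith
      have e2 : 0 ≤ (1 + √y) ^ 2 - x := by linarith [h.2]
      have e3 : x - (1 - √y) ^ 2 ≤ x := by nlinarith [sq_nonneg (1 - √y)]
      have e4 : 0 ≤ x - (1 - √y) ^ 2 := by linarith [h.1]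
      calc _ ≤ 4 * x := mul_le_mul e1 e3 e4 (by norm_num)
        _ = _ := by norm_num
    have hs : 0 < √x := Real.sqrt_pos.2 hx
    have hpi := Real.pi_gt_three
    calc √(((1 + √y) ^ 2 - x) * (x - (1 - √y) ^ 2)) / (2 * x * y * Real.pi)
        ≤ 2 * √x / (2 * x * y * 2) := by
          gcongr
          linarith
      _ = 1 / (2 * y) * (√x)⁻¹ := by
          have hxx : x = √x * √x := (Real.mul_self_sqrt hx.le).symm
          rw [show 2 * x * y * 2 = 2 * (√x * √x) * y * 2 by rw [← hxx]]
          field_simp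
  · rw [mpDensity, Set.indicator_of_notMem h]
    exact hr

/-- In the square-root variable the singular majorant `x^(-1/2)/(2y)` integrates to a linear
function. -/
theorem mpLaw_real_Iic_sub_le (hy : 0 < y) (hy1 : y ≤ 1) {s t : ℝ} (hs : 0 ≤ s) (hst : s ≤ t) :
    (mpLaw y).real (Set.Iic (t ^ 2)) - (mpLaw y).real (Set.Iic (s ^ 2)) ≤ 1 / y * (t - s) := by
  have := isProbabilityMeasure_mpLaw hy hy1
  have ht : 0 ≤ t := hs.trans hst
  have hst2 : s ^ 2 ≤ t ^ 2 := by gcongr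
  have h1 : (mpLaw y).real (Set.Iic (t ^ 2)) - (mpLaw y).real (Set.Iic (s ^ 2)) =
      (mpLaw y).real (Set.Ioc (s ^ 2) (t ^ 2)) := by
    rw [← Set.Iic_sdiff_Iic, measureReal_sdiff (Set.Iic_subset_Iic.2 hst2) measurableSet_Iic]
  have hint : IntervalIntegrable (fun x : ℝ => 1 / (2 * y) * x ^ (-(1 / 2) : ℝ)) volume
      (s ^ 2) (t ^ 2) :=
    (intervalIntegral.intervalIntegrable_rpow' (by norm_num)).const_mul _
  have hint' := (intervalIntegrable_iff_integrableOn_Ioc_of_le hst2).1 hint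
  have h2 : ∫ x in Set.Ioc (s ^ 2) (t ^ 2), 1 / (2 * y) * x ^ (-(1 / 2) : ℝ) =
      1 / y * (t - s) := by
    rw [← intervalIntegral.integral_of_le hst2, intervalIntegral.integral_const_mul,
      integral_rpow (Or.inl (by norm_num)), show (-(1 / 2) + 1 : ℝ) = 1 / 2 by norm_num,
      ← Real.sqrt_eq_rpow, ← Real.sqrt_eq_rpow, Real.sqrt_sq ht, Real.sqrt_sq hs]
    field_simp
  rw [h1, ← h2, measureReal_def, mpLaw_eq hy1, withDensity_apply _ measurableSet_Ioc]
  have hpos : ∀ x ∈ Set.Ioc (s ^ 2) (t ^ 2), 0 < x := fun x hx => (sq_nonneg s).trans_lt hx.1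
  refine ENNReal.toReal_le_of_le_ofReal (setIntegral_nonneg measurableSet_Ioc fun x hx => ?_) ?_
  · have := hpos x hx
    positivity
  · rw [ofReal_integral_eq_lintegral_ofReal hint'
      ((ae_restrict_iff' measurableSet_Ioc).2 (Filter.Eventually.of_forall fun x hx => by
        have := hpos x hx
        simp only [Pi.zero_apply]
        positivity))]
    refine setLIntegral_mono' measurableSet_Ioc fun x hx => ?_
    exact ENNReal.ofReal_le_ofReal (mpDensity_le hy hy1 (hpos x hx))

end MarchenkoPasturCDF

/-! ### Square-root behaviour for the semicircle equation -/

section SemicircleEquation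

/-- Imaginary and real parts of the equation after multiplication by the conjugate of `s`. -/
theorem normSq_mul_im_add_of_sq_add {s T : ℂ} (h : s ^ 2 + T * s + 1 = 0) :
    Complex.normSq s * (s.im + T.im) = s.im ∧
      T.re * Complex.normSq s = -(s.re * (1 + Complex.normSq s)) := by
  have hr := congrArg Complex.re h
  have hi := congrArg Complex.im h
  simp only [pow_two, Complex.add_re, Complex.mul_re, Complex.one_re, Complex.zero_re,
    Complex.add_im, Complex.mul_im, Complex.one_im, Complex.zero_im] at hr hi
  rw [Complex.normSq_apply]
  constructor
  · linear_combination s.re * hi - s.im * hr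
  · linear_combination s.re * hr + s.im * hi

theorem normSq_le_one_of_sq_add {s T : ℂ} (h : s ^ 2 + T * s + 1 = 0) (hs : 0 ≤ s.im)
    (hT : 0 < T.im) : Complex.normSq s ≤ 1 := by
  have h1 := (normSq_mul_im_add_of_sq_add h).1
  by_contra hc
  push Not at hc
  nlinarith

/-- Square root lower bound for the imaginary part of the solution of `s² + T s + 1 = 0`. -/
theorem im_le_mul_sq_of_sq_add {s T : ℂ} (h : s ^ 2 + T * s + 1 = 0) (hs : 0 ≤ s.im)
    (hT : 0 < T.im) {K : ℝ} (hK : 0 ≤ K) (hre : |T.re| ≤ 2 + K * T.im) :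
    T.im ≤ (K ^ 2 + 4 * K + 5) * (s.im + T.im) ^ 2 := by
  obtain ⟨h1, h2⟩ := normSq_mul_im_add_of_sq_add h
  have hs0 : s ≠ 0 := by rintro rfl; simp at h
  have hR : 0 < Complex.normSq s := Complex.normSq_pos.2 hs0
  have hRe : Complex.normSq s = s.re ^ 2 + s.im ^ 2 := by rw [Complex.normSq_apply]; ring
  have hT1 : T.re ^ 2 ≤ (2 + K * T.im) ^ 2 := sq_le_sq' (by linarith [(abs_le.1 hre).1])
    (abs_le.1 hre).2
  generalize Complex.normSq s = R at *
  generalize s.re = a at *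
  generalize s.im = e at *
  generalize T.re = t at *
  generalize T.im = u at *
  set S := e + u with hS
  have hS0 : 0 < S := by linarith
  have he : 0 < e := by rw [← h1]; positivity
  -- Eliminating `|s|²` from the two real identities leaves one relation between `e = Im s`, `u = Im
  -- T` and `t = Re T`. As `t² - 4` exceeds zero at most by terms of order `u` and `u²`, it forces
  -- `u` to be of order at most `S²`.
  have key : u ^ 2 = e * S * (t ^ 2 - 4 + (S + e) ^ 2) := by
    have e1 : e = R * S := h1.symm
    have e2 : t ^ 2 * R ^ 2 = (R - e ^ 2) * (1 + R) ^ 2 := by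
      rw [← mul_pow, h2, hRe]; ring
    have e3 : u = S - R * S := by linarith
    have e4 : t ^ 2 * R = (1 - R * S ^ 2) * (1 + R) ^ 2 := by
      rw [e1] at e2
      have : R * (t ^ 2 * R) = R * ((1 - R * S ^ 2) * (1 + R) ^ 2) := by linear_combination e2
      exact mul_left_cancel₀ hR.ne' this
    rw [e3, e1]
    linear_combination -S ^ 2 * e4
  by_contra hc
  push Not at hc
  have hq : 0 < S ^ 2 := by positivity
  have hU : t ^ 2 - 4 + (S + e) ^ 2 ≤ 4 * K * u + (K ^ 2 + 4) * S ^ 2 := by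
    have e1 : K ^ 2 * u ^ 2 ≤ K ^ 2 * S ^ 2 := by gcongr; linarith
    have e2 : (S + e) ^ 2 ≤ (2 * S) ^ 2 := by gcongr; linarith
    nlinarith
  have hU0 : 0 ≤ 4 * K * u + (K ^ 2 + 4) * S ^ 2 := by positivity
  have h3 : u ^ 2 ≤ S ^ 2 * (4 * K * u + (K ^ 2 + 4) * S ^ 2) := by
    rw [key]
    have : e * S ≤ S ^ 2 := by nlinarith
    calc _ ≤ e * S * (4 * K * u + (K ^ 2 + 4) * S ^ 2) := by gcongr
      _ ≤ _ := by gcongr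
  have h4 : (K ^ 2 + 4 * K + 5) * S ^ 2 * u < u ^ 2 := by nlinarith
  have h5 : S ^ 2 ≤ u := by nlinarith [mul_nonneg hK hq.le, mul_nonneg (sq_nonneg K) hq.le]
  have h6 : (K ^ 2 + 4) * S ^ 2 * S ^ 2 ≤ (K ^ 2 + 5) * S ^ 2 * u := by
    have : (K ^ 2 + 4) * S ^ 2 ≤ (K ^ 2 + 5) * S ^ 2 := by gcongr; norm_num
    calc _ ≤ (K ^ 2 + 4) * S ^ 2 * u := by gcongr
      _ ≤ _ := by gcongr
  linarith

end SemicircleEquation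

/-! ### Lower bounds for the stability denominator near the bulk -/

section SpectralEdges

/-- Real-variable form of the bound `|Re (w - (1 - y) / w)| ≤ 2 √y + K Im (w - (1 - y) / w)` near
the Marchenko–Pastur bulk; here `q = √y` and `m = (1 - y) / |w|²`. -/
theorem abs_mul_one_sub_le {q x₀ x v m A : ℝ} (hq : 0 ≤ q) (hq1 : q ≤ 1) (hA : 0 ≤ A)
    (hv : 0 < v) (h1 : 1 - q ≤ x₀) (h2 : x₀ ≤ 1 + q) (hx : |x - x₀| ≤ A * v)
    (hm : m * (x ^ 2 + v ^ 2) = 1 - q ^ 2) :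
    |x * (1 - m)| ≤ 2 * q + (A ^ 2 + A + 1) * (v * (1 + m)) := by
  have hx0 : 0 ≤ x₀ := by linarith
  have hden : 0 < x ^ 2 + v ^ 2 := by positivity
  have hm0 : 0 ≤ m := by
    by_contra hc
    push Not at hc
    nlinarith
  have hxabs : |x| ≤ x₀ + A * v := by
    calc |x| = |(x - x₀) + x₀| := by ring_nf
      _ ≤ |x - x₀| + |x₀| := abs_add_le _ _
      _ ≤ _ := by rw [abs_of_nonneg hx0]; linarith
  -- If `x₀ ≤ v`, then `|x|` is itself of order `v`. Otherwise one perturbs from height zero, where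
  -- `x₀ - (1 - q²)/x₀` lies in `[-2q, 2q]` for `x₀` in `[1 - q, 1 + q]`.
  rcases le_or_gt x₀ v with hc | hc
  · have e1 : |1 - m| ≤ 1 + m := by rw [abs_le]; constructor <;> linarith
    rw [abs_mul]
    calc |x| * |1 - m| ≤ ((A ^ 2 + A + 1) * v) * (1 + m) := by
          gcongr
          nlinarith [mul_nonneg (sq_nonneg A) hv.le]
      _ ≤ _ := by linarith
  · have hx0' : 0 < x₀ := hv.trans hc
    have hτ : |x₀ - (1 - q ^ 2) / x₀| ≤ 2 * q := by
      have e1 : (1 - q ^ 2) / x₀ ≤ 1 + q := by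
        rw [div_le_iff₀ hx0']; nlinarith
      have e2 : 1 - q ≤ (1 - q ^ 2) / x₀ := by
        rw [le_div_iff₀ hx0']; nlinarith
      rw [abs_le]; constructor <;> linarith
    have hid : x * (1 - m) = (x₀ - (1 - q ^ 2) / x₀) + (x - x₀) +
        m * ((x * (x - x₀) + v ^ 2) / x₀) := by
      rw [← hm]; field_simp; ring
    have hfr : |(x * (x - x₀) + v ^ 2) / x₀| ≤ (A ^ 2 + A + 1) * v := by
      rw [abs_div, abs_of_pos hx0', div_le_iff₀ hx0']
      have e1 : |x| ≤ (1 + A) * x₀ := by nlinarith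
      calc |x * (x - x₀) + v ^ 2| ≤ |x| * |x - x₀| + v ^ 2 := by
            rw [← abs_mul]
            exact (abs_add_le _ _).trans (by rw [abs_of_nonneg (sq_nonneg v)])
        _ ≤ ((1 + A) * x₀) * (A * v) + v * x₀ := by
            gcongr
            nlinarith
        _ = _ := by ring
    rw [hid]
    refine (abs_add_le _ _).trans ?_
    rw [abs_mul, abs_of_nonneg hm0]
    have := abs_add_le (x₀ - (1 - q ^ 2) / x₀) (x - x₀)
    have h3 : m * |(x * (x - x₀) + v ^ 2) / x₀| ≤ m * ((A ^ 2 + A + 1) * v) := by gcongr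
    nlinarith [mul_nonneg (sq_nonneg A) hv.le]

variable {y A x₀ : ℝ} {w g : ℂ}

theorem im_sub_div (y : ℝ) (w : ℂ) : (w - (1 - (y : ℂ)) / w).im =
    w.im * (1 + (1 - y) / Complex.normSq w) := by
  simp [Complex.div_im]
  ring

theorem re_sub_div (y : ℝ) (w : ℂ) : (w - (1 - (y : ℂ)) / w).re =
    w.re * (1 - (1 - y) / Complex.normSq w) := by
  simp [Complex.div_re]
  ring

/-- Quantitative bounds for the symmetrized Marchenko–Pastur Stieltjes transform `g`. -/
theorem selfConsistent_bounds (hy : 0 < y) (hy1 : y ≤ 1) (hA : 0 ≤ A) (hw : 0 < w.im)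
    (h1 : 1 - √y ≤ x₀) (h2 : x₀ ≤ 1 + √y) (hx : |w.re - x₀| ≤ A * w.im)
    (hg : (g - (1 - (y : ℂ)) / w) * (w + g) = -1) (hg0 : 0 ≤ g.im) {N : ℝ}
    (hN : N = (A ^ 2 + A + 1) ^ 2 + 4 * (A ^ 2 + A + 1) + 5) :
    √(y / N * w.im) ≤ w.im + g.im - ((1 - (y : ℂ)) / w).im ∧
      w.im ≤ w.im + g.im - ((1 - (y : ℂ)) / w).im ∧ 1 / (3 + 2 * A) ≤ ‖w + g‖ := by
  set q := √y with hq
  have hq0 : 0 < q := Real.sqrt_pos.2 hy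
  have hq1 : q ≤ 1 := Real.sqrt_le_one.2 hy1
  have hqq : q ^ 2 = y := Real.sq_sqrt hy.le
  have hqqC : (q : ℂ) ^ 2 = y := by exact_mod_cast hqq
  have hqC : (q : ℂ) ≠ 0 := by exact_mod_cast hq0.ne'
  have hw0 : w ≠ 0 := by rintro rfl; simp at hw
  have hnw : 0 < Complex.normSq w := Complex.normSq_pos.2 hw0
  set β : ℂ := (1 - (y : ℂ)) / w with hβ
  have hβw : β * w = 1 - y := by rw [hβ]; field_simp
  set m := (1 - y) / Complex.normSq w with hm
  have hm0 : 0 ≤ m := div_nonneg (by linarith) hnw.le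
  have him : (w - β).im = w.im * (1 + m) := im_sub_div y w
  have hre : (w - β).re = w.re * (1 - m) := re_sub_div y w
  have hmx : m * (w.re ^ 2 + w.im ^ 2) = 1 - q ^ 2 := by
    rw [hqq, hm, show w.re ^ 2 + w.im ^ 2 = Complex.normSq w by rw [Complex.normSq_apply]; ring]
    field_simp
  have hcrit := abs_mul_one_sub_le hq0.le hq1 hA hw h1 h2 hx hmx
  rw [← hre, ← him] at hcrit
  have hvim : w.im ≤ (w - β).im := by rw [him]; nlinarith
  -- Rescaling by `q = √y` gives the semicircle equation with `T = (w - β)/q`; then `Im s + Im T` is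
  -- the deterministic part of the denominator divided by `q`.
  have hsT : (g / q) ^ 2 + ((w - β) / q) * (g / q) + 1 = 0 := by
    field_simp
    rw [hqqC]
    linear_combination hg + hβw
  have hsim : (g / q).im = g.im / q := Complex.div_ofReal_im _ _
  have hTim : ((w - β) / q).im = (w - β).im / q := Complex.div_ofReal_im _ _
  have hTre : ((w - β) / q).re = (w - β).re / q := Complex.div_ofReal_re _ _
  have hs0 : 0 ≤ (g / q).im := by rw [hsim]; positivity
  have hT0 : 0 < ((w - β) / q).im := by rw [hTim]; exact div_pos (by linarith) hq0
  refine ⟨?_, ?_, ?_⟩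
  · have := im_le_mul_sq_of_sq_add hsT hs0 hT0 (K := A ^ 2 + A + 1) (by positivity) (by
      rw [hTre, hTim, abs_div, abs_of_pos hq0, div_le_iff₀ hq0]
      calc _ ≤ _ := hcrit
        _ = _ := by field_simp)
    rw [← hN, hsim, hTim] at this
    have hN0 : 0 < N := by rw [hN]; positivity
    have e1 : w.im ≤ N * (g.im / q + (w - β).im / q) ^ 2 := by
      refine le_trans ?_ this
      rw [le_div_iff₀ hq0]
      nlinarith
    have e2 : g.im / q + (w - β).im / q = (w.im + g.im - β.im) / q := by
      rw [Complex.sub_im]; ring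
    rw [e2, div_pow, hqq] at e1
    have hD : 0 ≤ w.im + g.im - β.im := by rw [Complex.sub_im] at hvim; linarith
    refine Real.sqrt_le_iff.2 ⟨hD, ?_⟩
    rw [div_mul_eq_mul_div, div_le_iff₀ hN0]
    calc y * w.im ≤ y * (N * ((w.im + g.im - β.im) ^ 2 / y)) := by gcongr
      _ = _ := by field_simp
  · rw [Complex.sub_im] at hvim; linarith
  · have hgn : ‖g‖ ≤ 1 := by
      have e1 := normSq_le_one_of_sq_add hsT hs0 hT0
      rw [Complex.normSq_eq_norm_sq, norm_div, Complex.norm_real, Real.norm_of_nonneg hq0.le,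
        div_pow, div_le_one (by positivity)] at e1
      have e2 : ‖g‖ ≤ q := (sq_le_sq₀ (norm_nonneg _) hq0.le).1 e1
      exact e2.trans hq1
    have hwn : 0 < ‖w‖ := norm_pos_iff.2 hw0
    have hx0w : x₀ ≤ (1 + A) * ‖w‖ := by
      have e1 := (abs_le.1 (Complex.abs_re_le_norm w)).2
      have e2 := (abs_le.1 (Complex.abs_im_le_norm w)).2
      have e3 := (abs_le.1 hx).1
      nlinarith
    -- Here `1 - y = (1 - q)(1 + q) ≤ 2 x₀`, and `x₀` is at most `(1 + A) |w|`, so `β` stays bounded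
    -- even when `w` is near zero. With `|g| ≤ 1` this gives `|g - β| ≤ 3 + 2A`, and `w + g` has the
    -- reciprocal modulus.
    have hβn : ‖β‖ ≤ 2 * (1 + A) := by
      have e1 : ‖(1 - (y : ℂ))‖ = 1 - y := by
        rw [← Complex.ofReal_one, ← Complex.ofReal_sub, Complex.norm_real,
          Real.norm_of_nonneg (by linarith)]
      rw [hβ, norm_div, e1, div_le_iff₀ hwn]
      nlinarith
    have hnorm : ‖g - β‖ * ‖w + g‖ = 1 := by rw [← norm_mul, hg, norm_neg, norm_one]
    have hgb : ‖g - β‖ ≤ 3 + 2 * A := (norm_sub_le _ _).trans (by linarith)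
    rw [div_le_iff₀ (by positivity)]
    nlinarith [norm_nonneg (w + g)]

end SpectralEdges

/-! ### Integration along vertical lines -/

section VerticalIntegration

open Filter Topology

/-- Integrating Stieltjes transform bounds along a vertical line. -/
theorem abs_smoothDiff_le_of_stieltjes {μ ν : Measure ℝ} [IsProbabilityMeasure μ]
    [IsProbabilityMeasure ν] {x v₀ a₁ a₂ a₃ : ℝ} (hv₀ : 0 < v₀) (hv₁ : v₀ ≤ 1) (h1 : 0 ≤ a₁)
    (h2 : 0 ≤ a₂) (h3 : 0 ≤ a₃)
    (hlow : ∀ v : ℝ, v₀ ≤ v → v ≤ 1 →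
      ‖stieltjes μ (x + v * Complex.I) - stieltjes ν (x + v * Complex.I)‖ ≤
        a₁ * v ^ (-(3 / 4) : ℝ) + a₂ * (v ^ 2)⁻¹)
    (hhigh : ∀ v : ℝ, 1 ≤ v →
      ‖stieltjes μ (x + v * Complex.I) - stieltjes ν (x + v * Complex.I)‖ ≤ a₃ * (v ^ 2)⁻¹) :
    |smoothDiff μ ν x v₀| ≤ 4 * a₁ + a₂ / v₀ + a₃ := by
  have hinv (c v : ℝ) (hv : 0 < v) : HasDerivAt (fun v => -c * v⁻¹) (c * (v ^ 2)⁻¹) v := by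
    exact ((hasDerivAt_inv hv.ne').const_mul (-c)).congr_deriv (by ring)
  have hroot (c v : ℝ) (hv : 0 < v) :
      HasDerivAt (fun v : ℝ => 4 * c * v ^ (1 / 4 : ℝ)) (c * v ^ (-(3 / 4) : ℝ)) v := by
    refine ((Real.hasDerivAt_rpow_const (p := (1 / 4 : ℝ))
      (Or.inl hv.ne')).const_mul (4 * c)).congr_deriv ?_
    rw [show (1 / 4 - 1 : ℝ) = -(3 / 4) by norm_num]
    ring
  have hA := abs_smoothDiff_le (μ := μ) (ν := ν) (x := x) hv₀ hv₁
    (Φ := fun v => 4 * a₁ * v ^ (1 / 4 : ℝ) + -a₂ * v⁻¹)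
    (fun v hv => (hroot a₁ v hv).add (hinv a₂ v hv)) hlow
  -- Smoothed at scale tending to infinity, both distribution functions tend to `1/2`, so no
  -- boundary term survives at the top.
  have hB : |smoothDiff μ ν x 1| ≤ a₃ := by
    have hlim : Tendsto (fun b => |smoothDiff μ ν x b| + a₃) atTop (𝓝 (0 + a₃)) :=
      (tendsto_smoothDiff μ ν x).add_const a₃
    rw [zero_add] at hlim
    refine ge_of_tendsto hlim ?_
    filter_upwards [eventually_ge_atTop (1 : ℝ)] with b hb
    have := abs_smoothDiff_le (μ := μ) (ν := ν) (x := x) one_pos hb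
      (Φ := fun v => -a₃ * v⁻¹) (fun v hv => hinv a₃ v hv) (fun v hv _ => hhigh v hv)
    have hb0 : 0 ≤ a₃ * b⁻¹ := by positivity
    simp only [inv_one] at this
    linarith
  simp only [Real.one_rpow, inv_one] at hA
  have h4 : 0 ≤ 4 * a₁ * v₀ ^ (1 / 4 : ℝ) := by positivity
  rw [div_eq_mul_inv]
  linarith

end VerticalIntegration

/-! ### Assembling the rate of convergence -/

section RateOfConvergence

variable {Ω : Type*} [MeasurableSpace Ω] {P : Measure Ω} [IsProbabilityMeasure P] {p n : ℕ}
  {X : Fin p → Fin n → Ω → ℝ}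

theorem norm_meanResolvent_le (Y : Fin p → Fin n → ℝ) {w : ℂ} (hw : 0 < w.im) :
    ‖meanResolvent (Matrix.of Y) w‖ ≤ 1 / n * (p * (1 / w.im)) := by
  rw [meanResolvent, trace_symResolvent_complexCov _ hw, norm_mul]
  have h1 : ‖(1 / (n : ℂ))‖ = 1 / n := by simp
  rw [h1]
  gcongr
  refine (norm_sum_le _ _).trans ((Finset.sum_le_sum fun k _ =>
    norm_div_sub_sq_le hw (covEigenvalue_nonneg k Y)).trans ?_)
  simp

theorem integrable_meanResolvent (hX : ∀ i j, Measurable (X i j)) {w : ℂ} (hw : 0 < w.im) :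
    Integrable (fun ω => meanResolvent (Matrix.of fun i j => X i j ω) w) P := by
  refine Integrable.of_bound ((measurable_meanResolvent w).comp
    (measurable_pi_lambda _ fun i => measurable_pi_lambda _ fun j => hX i j)).aestronglyMeasurable
    _ (Filter.Eventually.of_forall fun ω => norm_meanResolvent_le (fun i j => X i j ω) hw)

theorem mul_stieltjes_expectedSpectralMeasure (hX : ∀ i j, Measurable (X i j)) (hp : p ≠ 0)
    {w : ℂ} (hw : 0 < w.im) :
    ((p : ℂ) / n) * stieltjes (symmLaw (expectedSpectralMeasure P X)) w =
      ∫ ω, meanResolvent (Matrix.of fun i j => X i j ω) w ∂P := by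
  have := isProbabilityMeasure_expectedSpectralMeasure (P := P) hX hp
  have hp' : (p : ℂ) ≠ 0 := by exact_mod_cast hp
  rw [stieltjes_symmLaw (expectedSpectralMeasure_Iio_zero hX) hw,
    integral_expectedSpectralMeasure hX (by fun_prop) (fun x hx => norm_div_sub_sq_le hw hx)]
  simp only [meanResolvent]
  rw [integral_const_mul]
  have (ω : Ω) : (symResolvent (complexCov (Matrix.of fun i j => X i j ω)) w).trace =
      ∑ k, w / ((covEigenvalue k (fun i j => X i j ω) : ℂ) - w ^ 2) :=
    trace_symResolvent_complexCov _ hw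
  simp only [this]
  field_simp

theorem norm_stieltjes_sub_le (hX : ∀ i j, Measurable (X i j)) (hp : p ≠ 0) (hn : n ≠ 0)
    {w : ℂ} (hw : 0 < w.im) (S : ℂ) :
    ‖stieltjes (symmLaw (expectedSpectralMeasure P X)) w - S‖ ≤
      ((p : ℝ) / n)⁻¹ *
        ∫ ω, ‖meanResolvent (Matrix.of fun i j => X i j ω) w - ((p : ℂ) / n) * S‖ ∂P := by
  have hp' : (0 : ℝ) < p := by exact_mod_cast Nat.pos_of_ne_zero hp
  have hn' : (0 : ℝ) < n := by exact_mod_cast Nat.pos_of_ne_zero hn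
  have h1 : ((p : ℂ) / n) * (stieltjes (symmLaw (expectedSpectralMeasure P X)) w - S) =
      ∫ ω, (meanResolvent (Matrix.of fun i j => X i j ω) w - ((p : ℂ) / n) * S) ∂P := by
    rw [mul_sub, mul_stieltjes_expectedSpectralMeasure hX hp hw,
      integral_sub (integrable_meanResolvent hX hw) (integrable_const _)]
    simp
  have h2 := norm_integral_le_integral_norm (μ := P)
    fun ω => meanResolvent (Matrix.of fun i j => X i j ω) w - ((p : ℂ) / n) * S
  rw [← h1, norm_mul] at h2
  have h3 : ‖(p : ℂ) / n‖ = (p : ℝ) / n := by simp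
  rw [h3] at h2
  rw [le_inv_mul_iff₀ (by positivity)]
  exact h2

theorem mpLaw_selfConsistent {y : ℝ} (hy0 : 0 < y) (hy1 : y ≤ 1) {w : ℂ} (hw : 0 < w.im) :
    ((y : ℂ) * stieltjes (symmLaw (mpLaw y)) w - (1 - (y : ℂ)) / w) *
        (w + (y : ℂ) * stieltjes (symmLaw (mpLaw y)) w) = -1 ∧
      0 ≤ ((y : ℂ) * stieltjes (symmLaw (mpLaw y)) w).im := by
  have := isProbabilityMeasure_mpLaw hy0 hy1
  have hmp0 : mpLaw y (Set.Iio 0) = 0 :=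
    measure_mono_null (Set.Iio_subset_Iic_self.trans (Set.Iic_subset_Iic.2 (sq_nonneg _)))
      (mpLaw_Iic_left hy1)
  constructor
  · rw [stieltjes_symmLaw hmp0 hw]
    exact mp_selfConsistent hy0 hy1 hw
  · rw [Complex.im_ofReal_mul]
    exact mul_nonneg hy0.le (stieltjes_im_nonneg _ hw)

theorem sqrt_div_div_self {v₀ v : ℝ} (hv₀ : 0 ≤ v₀) (hv : 0 < v) :
    √(10 * v₀ ^ 2 / v / v) = √10 * v₀ / v := by
  rw [show 10 * v₀ ^ 2 / v / v = 10 * (v₀ / v) ^ 2 by field_simp, Real.sqrt_mul (by norm_num),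
    Real.sqrt_sq (by positivity)]
  ring

theorem sqrt_div_div_mul_sqrt {v₀ v e : ℝ} (hv₀ : 0 ≤ v₀) (hv : 0 < v) (he : 0 < e) :
    √(10 * v₀ ^ 2 / v / (e * √v)) = √(10 / e) * v₀ * v ^ (-(3 / 4) : ℝ) := by
  have h1 : (v ^ (-(3 / 4) : ℝ)) ^ 2 = (v * √v)⁻¹ := by
    have h3 : v * √v = v ^ (3 / 2 : ℝ) := by
      rw [Real.sqrt_eq_rpow, ← Real.rpow_one_add' hv.le (by norm_num)]
      norm_num
    rw [h3, ← Real.rpow_neg hv.le, pow_two, ← Real.rpow_add hv]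
    norm_num
  have h2 : 10 * v₀ ^ 2 / v / (e * √v) = 10 / e * (v₀ * v ^ (-(3 / 4) : ℝ)) ^ 2 := by
    rw [mul_pow, h1]
    field_simp
  rw [h2, Real.sqrt_mul (by positivity), Real.sqrt_sq (by positivity)]
  ring

/-- The two estimates use different lower bounds for the denominator: `D = v` with the far bound,
whose `v⁻²` decay is integrable at infinity, and `D = e √v` with the near bound, whose main term
`v^(-3/4)` is integrable at zero. -/
theorem integral_norm_meanResolvent_sub_le_of_bulk {M A N x₀ v₀ y e : ℝ}
    (h : StdIndep P (fun ij : Fin p × Fin n => X ij.1 ij.2) M) (hM : 1 ≤ M) (hn : n ≠ 0)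
    (hy : y = (p : ℝ) / n) (hy0 : 0 < y) (hy1 : y ≤ 1) (hv₀ : v₀ = √(M / n)) (hA : 0 ≤ A)
    {w g : ℂ} (hv₀0 : 0 < v₀) (hv : v₀ ≤ w.im)
    (h1 : 1 - √y ≤ x₀) (h2 : x₀ ≤ 1 + √y) (hx : |w.re - x₀| ≤ A * w.im)
    (hg : (g - (1 - (y : ℂ)) / w) * (w + g) = -1) (hg0 : 0 ≤ g.im)
    (hN : N = (A ^ 2 + A + 1) ^ 2 + 4 * (A ^ 2 + A + 1) + 5) (he0 : 0 < e) (he : e ≤ √(y / N)) :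
    ∫ ω, ‖meanResolvent (Matrix.of fun i j => X i j ω) w - g‖ ∂P ≤
        2 * √10 * v₀ * (w.im ^ 2)⁻¹ ∧
      ∫ ω, ‖meanResolvent (Matrix.of fun i j => X i j ω) w - g‖ ∂P ≤
        8 * (3 + 2 * A) * √(10 / e) * v₀ * w.im ^ (-(3 / 4) : ℝ) +
          40 * (3 + 2 * A) * v₀ ^ 2 * (w.im ^ 2)⁻¹ := by
  have hn' : (0 : ℝ) < n := by exact_mod_cast Nat.pos_of_ne_zero hn
  have hyC : (y : ℂ) = (p : ℂ) / n := by rw [hy]; push_cast; rfl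
  have hv₀2 : v₀ ^ 2 = M / n := by rw [hv₀, Real.sq_sqrt (div_nonneg (by linarith) hn'.le)]
  have hw : 0 < w.im := hv₀0.trans_le hv
  have hN0 : 0 < N := by rw [hN]; positivity
  obtain ⟨hD1, hD2, hc⟩ := selfConsistent_bounds hy0 hy1 hA hw h1 h2 hx hg hg0 hN
  have hnv : 1 ≤ n * w.im ^ 2 := by
    have e1 : v₀ ^ 2 ≤ w.im ^ 2 := by gcongr
    rw [hv₀2, div_le_iff₀ hn'] at e1
    linarith
  have hD3 : e * √w.im ≤ w.im + g.im - ((1 - (y : ℂ)) / w).im := by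
    refine le_trans ?_ hD1
    rw [Real.sqrt_mul (by positivity)]
    gcongr
  have hκ : 10 * M / (n * w.im) = 10 * v₀ ^ 2 / w.im := by
    rw [hv₀2]; field_simp
  rw [hyC] at hg hD2 hD3
  have hes : 0 < e * √w.im := mul_pos he0 (Real.sqrt_pos.2 hw)
  have k1 := (integral_norm_meanResolvent_sub_le (X := X) h hM hw hn (hy ▸ hy1) hg hg0 hnv hw
    hD2).1
  have k2 := (integral_norm_meanResolvent_sub_le (X := X) h hM hw hn (hy ▸ hy1) hg hg0 hnv
    hes hD3).2 (1 / (3 + 2 * A)) (by positivity) hc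
  rw [hκ, sqrt_div_div_self hv₀0.le hw] at k1
  rw [hκ, sqrt_div_div_mul_sqrt hv₀0.le hw he0] at k2
  refine ⟨k1.trans_eq ?_, k2.trans_eq ?_⟩
  · field_simp
  · field_simp
    ring

/-- Bounds for the difference of Stieltjes transforms near the bulk, at heights above
`√(M / n)`. -/
theorem norm_stieltjes_sub_mpLaw_le {M θ A N x₀ x v v₀ e y : ℝ}
    (h : StdIndep P (fun ij : Fin p × Fin n => X ij.1 ij.2) M) (hM : 1 ≤ M) (hp : p ≠ 0)
    (hn : n ≠ 0) (hy : y = (p : ℝ) / n) (hθ : 0 < θ) (hyθ : θ ≤ y) (hy1 : y ≤ 1)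
    (hv₀ : v₀ = √(M / n)) (hv : v₀ ≤ v) (hA : 0 ≤ A)
    (h1 : 1 - √y ≤ x₀) (h2 : x₀ ≤ 1 + √y) (hx : |x - x₀| ≤ A * v)
    (hN : N = (A ^ 2 + A + 1) ^ 2 + 4 * (A ^ 2 + A + 1) + 5) (he : e = √(θ / N)) :
    ‖stieltjes (symmLaw (expectedSpectralMeasure P X)) (x + v * Complex.I) -
        stieltjes (symmLaw (mpLaw y)) (x + v * Complex.I)‖ ≤ 2 * √10 / θ * v₀ * (v ^ 2)⁻¹ ∧
      ‖stieltjes (symmLaw (expectedSpectralMeasure P X)) (x + v * Complex.I) -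
        stieltjes (symmLaw (mpLaw y)) (x + v * Complex.I)‖ ≤
        8 * (3 + 2 * A) * √(10 / e) / θ * v₀ * v ^ (-(3 / 4) : ℝ) +
          40 * (3 + 2 * A) / θ * v₀ ^ 2 * (v ^ 2)⁻¹ := by
  have hn' : (0 : ℝ) < n := by exact_mod_cast Nat.pos_of_ne_zero hn
  have hX : ∀ i j, Measurable (X i j) := fun i j => h.meas (i, j)
  have hy0 : 0 < y := hθ.trans_le hyθ
  have hyC : (y : ℂ) = (p : ℂ) / n := by rw [hy]; push_cast; rfl
  have hv₀0 : 0 < v₀ := by rw [hv₀]; exact Real.sqrt_pos.2 (div_pos (by linarith) hn')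
  have hN0 : 0 < N := by rw [hN]; positivity
  have he0 : 0 < e := by rw [he]; positivity
  have heN : e ≤ √(y / N) := by rw [he]; gcongr
  obtain ⟨w, hw⟩ : ∃ w : ℂ, w = x + v * Complex.I := ⟨_, rfl⟩
  have hwim : w.im = v := by simp [hw]
  have hwre : w.re = x := by simp [hw]
  have hwpos : 0 < w.im := by rw [hwim]; exact hv₀0.trans_le hv
  rw [← hw]
  obtain ⟨hg, hg0⟩ := mpLaw_selfConsistent hy0 hy1 hwpos
  obtain ⟨k1, k2⟩ := integral_norm_meanResolvent_sub_le_of_bulk (X := X) h hM hn hy hy0 hy1 hv₀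
    hA hv₀0 (by rwa [hwim]) h1 h2 (by rwa [hwre, hwim]) hg hg0 hN he0 heN
  have hbase := norm_stieltjes_sub_le (P := P) hX hp hn hwpos (stieltjes (symmLaw (mpLaw y)) w)
  rw [← hyC, ← hy] at hbase
  rw [hwim] at k1 k2
  have hbase' := hbase.trans (mul_le_mul_of_nonneg_right (inv_anti₀ hθ hyθ)
    (integral_nonneg fun ω => norm_nonneg _))
  refine ⟨hbase'.trans ((mul_le_mul_of_nonneg_left k1 (by positivity)).trans_eq ?_),
    hbase'.trans ((mul_le_mul_of_nonneg_left k2 (by positivity)).trans_eq ?_)⟩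
  · ring
  · ring

/-- Uniform rate of convergence to the Marchenko–Pastur law for standardized entries. -/
theorem exists_abs_cdf_sub_le {θ : ℝ} (hθ : 0 < θ) : ∃ C : ℝ, 1 ≤ C ∧ ∀ (p n : ℕ) (M : ℝ),
    θ ≤ (p : ℝ) / n → (p : ℝ) / n ≤ 1 → p ≠ 0 → n ≠ 0 → 1 ≤ M →
    ∀ (Ω : Type*) [MeasurableSpace Ω] (P : Measure Ω) [IsProbabilityMeasure P]
      (X : Fin p → Fin n → Ω → ℝ), StdIndep P (fun ij : Fin p × Fin n => X ij.1 ij.2) M →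
      ∀ t : ℝ, |expectedSpectralCDF P X t - mpCDF ((p : ℝ) / n) t| ≤ C * √(M / n) := by
  set A := cauchyWidth with hA
  have hA0 : 0 < A := cauchyWidth_pos
  obtain ⟨N, hN⟩ : ∃ N, N = (A ^ 2 + A + 1) ^ 2 + 4 * (A ^ 2 + A + 1) + 5 := ⟨_, rfl⟩
  obtain ⟨e, he⟩ : ∃ e, e = √(θ / N) := ⟨_, rfl⟩
  set b₁ := 8 * (3 + 2 * A) * √(10 / e) / θ with hb₁
  set b₂ := 40 * (3 + 2 * A) / θ with hb₂
  set b₃ := 2 * √10 / θ with hb₃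
  have hb₁0 : 0 ≤ b₁ := by positivity
  have hb₂0 : 0 ≤ b₂ := by positivity
  have hb₃0 : 0 ≤ b₃ := by positivity
  refine ⟨1 + (4 * (4 * b₁ + b₂ + b₃) + 6 * (1 / θ) * A), le_add_of_nonneg_right (by positivity),
    fun p n M hpn' hpn hp hn hM Ω _ P _ X h t => ?_⟩
  have hn' : (0 : ℝ) < n := by exact_mod_cast Nat.pos_of_ne_zero hn
  have hX : ∀ i j, Measurable (X i j) := fun i j => h.meas (i, j)
  set y : ℝ := (p : ℝ) / n with hy
  have hy0 : 0 < y := hθ.trans_le hpn'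
  have hν := isProbabilityMeasure_mpLaw hy0 hpn
  have hμ := isProbabilityMeasure_expectedSpectralMeasure (P := P) hX hp
  have hatom := nullSingletonClass_mpLaw hpn
  rw [expectedSpectralCDF_eq hX, mpCDF]
  obtain ⟨v₀, hv₀⟩ : ∃ v₀, v₀ = √(M / n) := ⟨_, rfl⟩
  rw [← hv₀]
  have hv₀0 : 0 < v₀ := by rw [hv₀]; positivity
  -- For `v₀ > 1` the bound is trivial because distribution functions differ by at most `1`; the
  -- summand `1` in the constant is there for this case.
  rcases le_or_gt v₀ 1 with hv₁ | hv₁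
  · have hq1 : √y ≤ 1 := Real.sqrt_le_one.2 hpn
    have hq0 : 0 ≤ √y := Real.sqrt_nonneg y
    have hηb : ∀ x₀ x, 0 ≤ x₀ → (1 - √y) ^ 2 ≤ x₀ ^ 2 → x₀ ^ 2 ≤ (1 + √y) ^ 2 →
        |x - x₀| ≤ cauchyWidth * v₀ →
        |smoothDiff (symmLaw (expectedSpectralMeasure P X)) (symmLaw (mpLaw y)) x v₀| ≤
          (4 * b₁ + b₂ + b₃) * v₀ := by
      intro x₀ x hx₀ ha hb hx
      have ha' : 1 - √y ≤ x₀ := (sq_le_sq₀ (by linarith) hx₀).1 ha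
      have hb' : x₀ ≤ 1 + √y := (sq_le_sq₀ hx₀ (by linarith)).1 hb
      have hkey (v : ℝ) (hv : v₀ ≤ v) := norm_stieltjes_sub_mpLaw_le (X := X) (x := x) (v := v) h
        hM hp hn hy hθ hpn' hpn hv₀ hv hA0.le ha' hb'
        (hx.trans (mul_le_mul_of_nonneg_left hv hA0.le)) hN he
      have := abs_smoothDiff_le_of_stieltjes hv₀0 hv₁ (a₁ := b₁ * v₀) (a₂ := b₂ * v₀ ^ 2)
        (a₃ := b₃ * v₀) (by positivity) (by positivity) (by positivity)
        (fun v hv _ => (hkey v hv).2) (fun v hv => (hkey v (hv₁.trans hv)).1)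
      -- The three contributions `4 b₁ v₀`, `b₂ v₀²/v₀` and `b₃ v₀` are all linear in `v₀`.
      refine this.trans_eq ?_
      field_simp
    have hfin := abs_real_Iic_sub_le_of_smoothDiff (μ := expectedSpectralMeasure P X)
      (ν := mpLaw y) (sq_nonneg (1 - √y)) (by gcongr; linarith)
      (by rw [measureReal_def, mpLaw_Iic_left hpn, ENNReal.toReal_zero])
      (mpLaw_real_Iic_right hy0 hpn) (by positivity : 0 ≤ 1 / y)
      (fun s t hs hst => mpLaw_real_Iic_sub_le hy0 hpn hs hst) hv₀0 hηb t
    refine hfin.trans ?_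
    have hyθ : 1 / y ≤ 1 / θ := by gcongr
    have : 6 * (1 / y) * A * v₀ ≤ 6 * (1 / θ) * A * v₀ := by gcongr
    linarith
  · have h1 : (expectedSpectralMeasure P X).real (Set.Iic t) ≤ 1 := measureReal_le_one
    have h2 : (mpLaw y).real (Set.Iic t) ≤ 1 := measureReal_le_one
    have h3 : 0 ≤ (expectedSpectralMeasure P X).real (Set.Iic t) := measureReal_nonneg
    have h4 : 0 ≤ (mpLaw y).real (Set.Iic t) := measureReal_nonneg
    have h5 : 0 ≤ (4 * (4 * b₁ + b₂ + b₃) + 6 * (1 / θ) * A) * v₀ := by positivity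
    rw [abs_le]
    constructor <;> linarith

end RateOfConvergence

end SampleCov

theorem theorem1p1 :
    ∀ θ : ℝ, 0 < θ → ∃ C : ℝ, 0 < C ∧
      ∀ (p n : ℕ), θ < (p : ℝ) / (n : ℝ) → (p : ℝ) / (n : ℝ) ≤ 1 →
      ∀ (Ω : Type*) [MeasurableSpace Ω] (P : Measure Ω) [IsProbabilityMeasure P]
        (X : Fin p → Fin n → Ω → ℝ),
        (∀ i j, Measurable (X i j)) →
        iIndepFun (fun (ij : Fin p × Fin n) => X ij.1 ij.2) P →
        (∀ i j, ∫ ω, X i j ω ∂P = 0) →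
        (∀ i j, ∫ ω, |X i j ω| ^ 2 ∂P = 1) →
        (∀ i j, Integrable (fun ω => |X i j ω| ^ 4) P) →
        SampleCov.kolmogorovDist (SampleCov.expectedSpectralCDF P X)
            (SampleCov.mpCDF ((p : ℝ) / (n : ℝ))) ≤
          ENNReal.ofReal (C * (SampleCov.maxFourthMoment P X) ^ (1 / 2 : ℝ) *
            (n : ℝ) ^ (-(1 / 2) : ℝ)) := by
  intro θ hθ
  obtain ⟨C, hC, hbound⟩ := SampleCov.exists_abs_cdf_sub_le hθ
  refine ⟨C, by linarith, fun p n hpn' hpn Ω _ P _ X hX hind hmean hvar hint => ?_⟩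
  -- If `p` or `n` vanished, the ratio `p/n` would be `0` (division by zero included), contradicting
  -- `0 < θ < p/n`.
  have hp : p ≠ 0 := by rintro rfl; simp at hpn'; linarith
  have hn : n ≠ 0 := by rintro rfl; simp at hpn'; linarith
  have hn' : (0 : ℝ) < n := by exact_mod_cast Nat.pos_of_ne_zero hn
  have hstd : SampleCov.StdIndep P (fun ij : Fin p × Fin n => X ij.1 ij.2)
      (SampleCov.maxFourthMoment P X) :=
    { meas := fun ij => hX ij.1 ij.2
      indep := hind
      mean := fun ij => hmean ij.1 ij.2
      var := fun ij => hvar ij.1 ij.2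
      int4 := fun ij => hint ij.1 ij.2
      le4 := fun ij => le_ciSup (f := fun ij : Fin p × Fin n => ∫ ω, |X ij.1 ij.2 ω| ^ 4 ∂P)
        (Set.finite_range _).bddAbove ij }
  have hM : 1 ≤ SampleCov.maxFourthMoment P X :=
    hstd.one_le (⟨0, Nat.pos_of_ne_zero hp⟩, ⟨0, Nat.pos_of_ne_zero hn⟩)
  rw [SampleCov.kolmogorovDist]
  refine iSup_le fun t => ENNReal.ofReal_le_ofReal ?_
  refine (hbound p n _ hpn'.le hpn hp hn hM Ω P X hstd t).trans_eq ?_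
  rw [Real.sqrt_div (by linarith), Real.sqrt_eq_rpow, Real.sqrt_eq_rpow, Real.rpow_neg hn'.le]
  ring
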